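/- Let $n\ge 3$, let $\Omega\subset\mathbf R^n$ be a bounded open set with $C^\infty$ boundary, let $A=(A_j)\in C^2(\bar\Omega;\mathbf R^n)$ and $q\in L^\infty(\Omega;\mathbf C)$, and set $$\mathcal L_{A,q}=\sum_{j=1}^n (D_j+A_j)^2+q,\qquad D_j=-i\partial_j .$$ Here $C^2(\bar\Omega)$ denotes the restrictions to $\bar\Omega$ of $C^2$ functions on $\mathbf R^n$. Let $x_0\in\mathbf R^n\setminus\overline{\mathrm{ch}(\Omega)}$, where $\mathrm{ch}(\Omega)$ is the convex hull of $\Omega$. Then there is $h_0>0$ such that the following holds for every $\omega\in S^{n-1}$ for which the line $x_0+\mathbf R\omega$ does not meet $\bar\Omega$. Put $$\varphi(x)=\log|x-x_0|,\qquad \psi(x)=d_{S^{n-1}}\Big(\frac{x-x_0}{|x-x_0|},\omega\Big),$$ where $d_{S^{n-1}}$ is the geodesic (angular) distance on the sphere. (1) There is $\Phi\in C^2(\bar\Omega;\mathbf C)$ satisfying $$(\nabla\varphi+i\nabla\psi)\cdot\nabla\Phi+i(\nabla\varphi+i\nabla\psi)\cdot A+\tfrac12\Delta(\varphi+i\psi)=0\quad\text{on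 }\Omega. \qquad (*)$$ (2) For every $\Phi\in C^2(\bar\Omega;\mathbf C)$ satisfying $(*)$ there are a constant $C$ and functions $r(\cdot,h)\in H^1(\Omega)$, $0<h\le h_0$, such that for all $0<h\le h_0$ $$\|r(\cdot,h)\|_{H^1_{\rm scl}(\Omega)}=\Big(\|h\nabla r(\cdot,h)\|_{L^2(\Omega)}^2+\|r(\cdot,h)\|_{L^2(\Omega)}^2\Big)^{1/2}\le C,$$ and $$u(x,h)=e^{\frac1h(\varphi+i\psi)}\big(e^{\Phi(x)}+h\,r(x,h)\big)$$ belongs to $H^1(\Omega)$ and is a weak solution of $\mathcal L_{A,q}u=0$ in $\Omega$. -/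

import Mathlib

open MeasureTheory Set
open scoped ContDiff ENNReal

noncomputable section

namespace MagneticCGO

/-- The Euclidean space `ℝⁿ`. -/
abbrev E (n : ℕ) : Type := EuclideanSpace ℝ (Fin n)

/-- The (classical) partial derivative `∂_j f` of a complex-valued function on `ℝⁿ`. -/
def pd {n : ℕ} (j : Fin n) (f : E n → ℂ) (x : E n) : ℂ :=
  fderiv ℝ f x (EuclideanSpace.single j 1)

/-- `Ω` has `C^∞` boundary: near each of its boundary points, `Ω` is the set where a smooth real
function with nowhere vanishing differential is negative. -/
def HasSmoothBoundary {n : ℕ} (Ω : Set (E n)) : Prop :=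
  ∀ x ∈ frontier Ω, ∃ (U : Set (E n)) (ρ : E n → ℝ), IsOpen U ∧ x ∈ U ∧
    ContDiffOn ℝ ∞ ρ U ∧ (∀ y ∈ U, fderiv ℝ ρ y ≠ 0) ∧ U ∩ Ω = {y ∈ U | ρ y < 0}

/-- `f ∈ C²(Ω̄)`: on the closure of `Ω`, `f` coincides with a `C²` function on `ℝⁿ`. -/
def C2Closure {n : ℕ} {F : Type*} [NormedAddCommGroup F] [NormedSpace ℝ F]
    (Ω : Set (E n)) (f : E n → F) : Prop :=
  ∃ g : E n → F, ContDiff ℝ 2 g ∧ EqOn f g (closure Ω)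

/-- `v ∈ C_0^∞(Ω)`, complex-valued. -/
def IsTest {n : ℕ} (Ω : Set (E n)) (v : E n → ℂ) : Prop :=
  ContDiff ℝ ∞ v ∧ HasCompactSupport v ∧ tsupport v ⊆ Ω

/-- The vector field `G` is the gradient of `u` on `Ω` in the sense of distributions. -/
def IsWeakGrad {n : ℕ} (Ω : Set (E n)) (u : E n → ℂ)
    (G : E n → EuclideanSpace ℂ (Fin n)) : Prop :=
  LocallyIntegrableOn u Ω volume ∧ LocallyIntegrableOn G Ω volume ∧
    ∀ v : E n → ℂ, IsTest Ω v → ∀ j : Fin n,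
      ∫ x in Ω, u x * pd j v x = -∫ x in Ω, G x j * v x

open Classical in
/-- The distributional gradient of `u` on `Ω` (unique up to a null set of `Ω`); the value `0` is
assigned when there is none. -/
def weakGrad {n : ℕ} (Ω : Set (E n)) (u : E n → ℂ) : E n → EuclideanSpace ℂ (Fin n) :=
  if h : ∃ G, IsWeakGrad Ω u G then h.choose else 0

/-- `u ∈ H¹(Ω)`: `u` and its distributional gradient are in `L²(Ω)`. -/
def MemH1 {n : ℕ} (Ω : Set (E n)) (u : E n → ℂ) : Prop :=
  MemLp u 2 (volume.restrict Ω) ∧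
    ∃ G, IsWeakGrad Ω u G ∧ MemLp G 2 (volume.restrict Ω)

/-- The semi-classical norm `‖u‖_{H¹_scl(Ω)} = (‖h∇u‖² + ‖u‖²)^{1/2}` of `u ∈ H¹(Ω)`, with
`L²(Ω)` norms on the right. -/
def normH1scl {n : ℕ} (Ω : Set (E n)) (h : ℝ) (u : E n → ℂ) : ℝ :=
  Real.sqrt ((∫ x in Ω, ‖(h : ℂ) • weakGrad Ω u x‖ ^ 2) + ∫ x in Ω, ‖u x‖ ^ 2)

/-- `u ∈ H¹(Ω)` is a weak solution on `Ω` of `L_{A,q} u = ∑_j (D_j + A_j)² u + q u = 0`, where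
`D_j = -i ∂_j`: for all test functions `v`,
`∑_j ((D_j + A_j) u | (D_j + A_j) v) + (q u | v) = 0`, with `(f | g) = ∫_Ω f ḡ dx`. -/
def IsMagneticSolution {n : ℕ} (Ω : Set (E n)) (A : E n → E n) (q : E n → ℂ)
    (u : E n → ℂ) : Prop :=
  MemH1 Ω u ∧ ∀ v : E n → ℂ, IsTest Ω v →
    ∫ x in Ω, ((∑ j, (-Complex.I * weakGrad Ω u x j + (A x j : ℂ) * u x) *
        (starRingEnd ℂ) (-Complex.I * pd j v x + (A x j : ℂ) * v x))
      + q x * u x * (starRingEnd ℂ) (v x)) = 0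

/-- The limiting Carleman weight `φ(x) = log |x - x₀|`. -/
def phi {n : ℕ} (x₀ x : E n) : ℝ := Real.log ‖x - x₀‖

/-- `ψ(x) = d_{S^{n-1}}((x - x₀)/|x - x₀|, e)`: the geodesic distance on the sphere of two unit
vectors is the angle between them, and angles do not change under positive scaling. -/
def psi {n : ℕ} (x₀ e x : E n) : ℝ := InnerProductGeometry.angle (x - x₀) e

/-- The complex phase `φ + iψ`. -/
def phase {n : ℕ} (x₀ e x : E n) : ℂ := (phi x₀ x : ℂ) + Complex.I * (psi x₀ e x : ℂ)

/-- `Φ` satisfies on `Ω` the transport (Cauchy–Riemann) equation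
`(∇φ + i∇ψ)·∇Φ + i(∇φ + i∇ψ)·A + ½ Δ(φ + iψ) = 0`. -/
def SolvesTransport {n : ℕ} (Ω : Set (E n)) (A : E n → E n) (x₀ e : E n)
    (Φ : E n → ℂ) : Prop :=
  ∀ x ∈ Ω, (∑ j, pd j (phase x₀ e) x * pd j Φ x)
    + Complex.I * (∑ j, pd j (phase x₀ e) x * (A x j : ℂ))
    + (1 / 2 : ℂ) * Laplacian.laplacian (phase x₀ e) x = 0

/-- The function `e^{(φ + iψ)/h} (e^Φ + h r)`. -/
def cgo {n : ℕ} (x₀ e : E n) (Φ r : E n → ℂ) (h : ℝ) (x : E n) : ℂ :=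
  Complex.exp (phase x₀ e x / (h : ℂ)) * (Complex.exp (Φ x) + (h : ℂ) * r x)

end MagneticCGO

end

noncomputable section

namespace MagneticCGO

/-! ### Partial derivatives -/

/-! Put Z = φ + iψ and τ = 1/h. Off the line x₀ + ℝω one has Z = log ζ with ζ = ⟨x - x₀, ω⟩ + i|(x -
x₀)^⊥| (`phase_eq_log`). The gradients of Re ζ and Im ζ are orthonormal, so (∇ζ)² = 0 and therefore
(∇Z)² = 0. Conjugation of L = L_{A,q} by e^{τZ} then produces no τ² term, and the transport equation
removes the τ term: L(e^{τZ} e^Φ) = e^{τZ} L(e^Φ) (`magL_exp_mul`).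

The transport equation, multiplied by ζ, reads (∂_ω + i∂_θ)Φ = f, where θ is the unit vector along
(x - x₀)^⊥. It is a Cauchy–Riemann equation on each plane spanned by ω and θ, on which θ is locally
constant, and a Cauchy transform along these planes solves it (`planeCauchy_spec`,
`exists_solvesTransport`).

For the correction write r = τ e^{-iτψ} R. Then e^{τZ} h r = e^{τφ} R, and R has to satisfy e^{-τφ}
L(e^{τφ} R) = -e^{iτψ} L(e^Φ) weakly in Ω, with a right side bounded in L² uniformly in τ. A
Carleman estimate τ‖e^{τφ} v‖ ≤ C‖e^{τφ} Lᵗ v‖ for test functions v supported near the closure of Ω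
(`IsLogWeight.exists_carleman`) gives R with ‖R‖ = O(1/τ) by Hahn–Banach and Riesz
(`IsLogWeight.exists_l2_solution`).

The Carleman estimate rests on the coordinates t = log|x - x₀| and ϑ in the sphere, in which |x -
x₀|²Δ has coefficients independent of t. Replacing τt by τt + bt²/2 makes the commutator of the
symmetric and antisymmetric parts of the conjugated operator positive of size b. The constant b is
fixed, large enough to absorb the first order terms of Lᵗ; since t is bounded, the extra factor
e^{bt²/2} only costs a constant.

The bound on ∇R comes from interior regularity: for a cutoff X, the weak equation controls Δ(XR),
and the resolvent (τ² - Δ)⁻¹ turns this into an L² bound for ∇(XR) uniform in τ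
(`exists_weak_derivative`, `IsLogWeight.exists_h1_solution`). Hence h∇r and r are O(1) in L².

The threshold h₀ comes from the Carleman estimate alone, hence from φ, A and q. The direction ω
enters only through ψ, which is fixed after h₀; this is why h₀ is uniform in ω. -/

/-- The partial derivative `∂_j f` of a function on `ℝⁿ` with values in a normed space. -/
def dd {n : ℕ} {F : Type*} [NormedAddCommGroup F] [NormedSpace ℝ F] (j : Fin n) (f : E n → F)
    (x : E n) : F :=
  fderiv ℝ f x (EuclideanSpace.single j 1)

section dd

variable {n : ℕ} {F : Type*} [NormedAddCommGroup F] [NormedSpace ℝ F]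
  {R : Type*} [NormedCommRing R] [NormedAlgebra ℝ R] {j i : Fin n} {x : E n}

theorem pd_eq_dd (j : Fin n) (f : E n → ℂ) : pd j f = dd j f := rfl

theorem dd_add {f g : E n → F} (hf : DifferentiableAt ℝ f x) (hg : DifferentiableAt ℝ g x) :
    dd j (fun y => f y + g y) x = dd j f x + dd j g x := by
  simp [dd, fderiv_fun_add hf hg]

theorem dd_sub {f g : E n → F} (hf : DifferentiableAt ℝ f x) (hg : DifferentiableAt ℝ g x) :
    dd j (fun y => f y - g y) x = dd j f x - dd j g x := by
  simp [dd, fderiv_fun_sub hf hg]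

theorem dd_neg {f : E n → F} : dd j (fun y => -f y) x = -dd j f x := by
  simp [dd, fderiv_fun_neg]

theorem dd_const (c : F) : dd j (fun _ : E n => c) x = 0 := by
  simp [dd]

theorem dd_sum {ι : Type*} {s : Finset ι} {f : ι → E n → F}
    (hf : ∀ k ∈ s, DifferentiableAt ℝ (f k) x) :
    dd j (fun y => ∑ k ∈ s, f k y) x = ∑ k ∈ s, dd j (f k) x := by
  simp [dd, fderiv_fun_sum hf]

theorem dd_mul {f g : E n → R} (hf : DifferentiableAt ℝ f x) (hg : DifferentiableAt ℝ g x) :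
    dd j (fun y => f y * g y) x = dd j f x * g x + f x * dd j g x := by
  simp [dd, fderiv_fun_mul hf hg]; ring

theorem dd_const_mul {g : E n → R} (c : R) (hg : DifferentiableAt ℝ g x) :
    dd j (fun y => c * g y) x = c * dd j g x := by
  rw [dd_mul (by fun_prop) hg, dd_const]; simp

theorem dd_pow {f : E n → R} (hf : DifferentiableAt ℝ f x) (k : ℕ) :
    dd j (fun y => f y ^ k) x = k * f x ^ (k - 1) * dd j f x := by
  simp [dd, fderiv_fun_pow k hf, mul_assoc]

theorem dd_rexp {f : E n → ℝ} (hf : DifferentiableAt ℝ f x) :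
    dd j (fun y => Real.exp (f y)) x = Real.exp (f x) * dd j f x := by
  simp [dd, fderiv_exp hf]

theorem dd_cexp {f : E n → ℂ} (hf : DifferentiableAt ℝ f x) :
    dd j (fun y => Complex.exp (f y)) x = Complex.exp (f x) * dd j f x := by
  simp [dd, (hf.hasFDerivAt.cexp).fderiv]

theorem dd_ofReal {f : E n → ℝ} (hf : DifferentiableAt ℝ f x) :
    dd j (fun y => ((f y : ℝ) : ℂ)) x = ((dd j f x : ℝ) : ℂ) := by
  have h := (Complex.ofRealCLM.hasFDerivAt (x := f x)).comp x hf.hasFDerivAt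
  have : fderiv ℝ (fun y => ((f y : ℝ) : ℂ)) x = Complex.ofRealCLM.comp (fderiv ℝ f x) := h.fderiv
  simp [dd, this]

theorem dd_clm_comp {G : Type*} [NormedAddCommGroup G] [NormedSpace ℝ G] (L : F →L[ℝ] G)
    {f : E n → F} (hf : DifferentiableAt ℝ f x) :
    dd j (fun y => L (f y)) x = L (dd j f x) := by
  have h := (L.hasFDerivAt (x := f x)).comp x hf.hasFDerivAt
  have : fderiv ℝ (fun y => L (f y)) x = L.comp (fderiv ℝ f x) := h.fderiv
  simp [dd, this]

theorem dd_congr {f g : E n → F} (h : f =ᶠ[nhds x] g) : dd j f x = dd j g x := by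
  simp [dd, h.fderiv_eq]

theorem dd_congr_nhds {f g : E n → F} (h : f =ᶠ[nhds x] g) : dd j f =ᶠ[nhds x] dd j g := by
  filter_upwards [h.eventuallyEq_nhds] with y hy using dd_congr hy

theorem contDiff_dd {f : E n → F} {k m : WithTop ℕ∞} (hf : ContDiff ℝ m f) (hk : k + 1 ≤ m) :
    ContDiff ℝ k (dd j f) := by
  unfold dd
  exact (hf.fderiv_right hk).clm_apply contDiff_const

theorem contDiffAt_dd {f : E n → F} {k m : WithTop ℕ∞} (hf : ContDiffAt ℝ m f x)
    (hk : k + 1 ≤ m) : ContDiffAt ℝ k (dd j f) x := by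
  unfold dd
  exact (hf.fderiv_right hk).clm_apply contDiffAt_const

theorem dd_comm {f : E n → F} (hf : ContDiffAt ℝ 2 f x) :
    dd i (dd j f) x = dd j (dd i f) x := by
  have hd : DifferentiableAt ℝ (fderiv ℝ f) x :=
    (hf.fderiv_right (m := 1) (by norm_num)).differentiableAt (by norm_num)
  have key : ∀ a b : Fin n, dd a (dd b f) x
      = fderiv ℝ (fderiv ℝ f) x (EuclideanSpace.single a 1) (EuclideanSpace.single b 1) := by
    intro a b
    unfold dd
    rw [fderiv_clm_apply hd (by fun_prop)]
    simp
  rw [key, key]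
  have := (hf.isSymmSndFDerivAt (by simp)) (EuclideanSpace.single i 1)
    (EuclideanSpace.single j 1)
  exact this

theorem laplacian_eq_sum_dd {f : E n → F} (hf : ContDiffAt ℝ 2 f x) :
    Laplacian.laplacian f x = ∑ j, dd j (dd j f) x := by
  have hd : DifferentiableAt ℝ (fderiv ℝ f) x :=
    (hf.fderiv_right (m := 1) (by norm_num)).differentiableAt (by norm_num)
  rw [InnerProductSpace.laplacian_eq_iteratedFDeriv_orthonormalBasis f
    (EuclideanSpace.basisFun (Fin n) ℝ)]
  refine Finset.sum_congr rfl fun j _ => ?_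
  unfold dd
  rw [fderiv_clm_apply hd (by fun_prop)]
  simp [iteratedFDeriv_two_apply]

theorem tsupport_dd_subset (f : E n → F) : tsupport (dd j f) ⊆ tsupport f := by
  refine closure_minimal (fun y hy => ?_) (isClosed_tsupport f)
  by_contra h
  apply hy
  have := support_fderiv_subset ℝ (f := f)
  simp only [dd]
  rw [Function.notMem_support.1 fun h' => h (this h')]
  rfl

theorem hasCompactSupport_dd {f : E n → F} (hf : HasCompactSupport f) :
    HasCompactSupport (dd j f) :=
  hf.of_isClosed_subset (isClosed_tsupport _) (tsupport_dd_subset f)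

theorem dd_eq_zero_of_notMem {f : E n → F} (h : x ∉ tsupport f) : dd j f x = 0 :=
  image_eq_zero_of_notMem_tsupport fun h' => h (tsupport_dd_subset f h')

theorem fderiv_apply_eq_sum (f : E n → F) (v : E n) :
    fderiv ℝ f x v = ∑ j, v j • dd j f x := by
  have : v = ∑ j, v j • EuclideanSpace.single j (1 : ℝ) := by
    ext k; simp [Pi.single_apply]
  conv_lhs => rw [this]
  simp [dd, map_sum]

end dd

/-! ### Integration by parts -/

section ibp

variable {n : ℕ} {j : Fin n}

theorem integral_mul_dd {𝕜 : Type*} [NormedField 𝕜] [NormedAlgebra ℝ 𝕜] {f g : E n → 𝕜}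
    (hf : ContDiff ℝ 1 f) (hg : ContDiff ℝ 1 g) (hg' : HasCompactSupport g) :
    ∫ x, f x * dd j g x = -∫ x, dd j f x * g x := by
  refine integral_mul_fderiv_eq_neg_fderiv_mul_of_integrable ?_ ?_ ?_
    (fun x _ => hf.differentiable (by norm_num) x) (fun x _ => hg.differentiable (by norm_num) x)
  · exact ((contDiff_dd (k := 0) hf (by norm_num)).continuous.mul
      hg.continuous).integrable_of_hasCompactSupport (hg'.mul_left)
  · exact (hf.continuous.mul (contDiff_dd (k := 0) hg (by norm_num)).continuous
      ).integrable_of_hasCompactSupport ((hasCompactSupport_dd hg').mul_left)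
  · exact (hf.continuous.mul hg.continuous).integrable_of_hasCompactSupport (hg'.mul_left)

theorem integral_dd_eq_zero {𝕜 : Type*} [NormedField 𝕜] [NormedAlgebra ℝ 𝕜] {f : E n → 𝕜}
    (hf : ContDiff ℝ 1 f) (hf' : HasCompactSupport f) : ∫ x, dd j f x = 0 := by
  have := integral_mul_dd (j := j) (f := fun _ => (1 : 𝕜)) contDiff_const hf hf'
  simpa [dd_const] using this

end ibp

/-! ### Smooth cutoffs and extensions -/

section cutoff

variable {n : ℕ} {F : Type*} [NormedAddCommGroup F] [NormedSpace ℝ F]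

theorem exists_cutoff {K U : Set (E n)} (hK : IsCompact K) (hU : IsOpen U) (hKU : K ⊆ U) :
    ∃ χ : E n → ℝ, ContDiff ℝ ∞ χ ∧ HasCompactSupport χ ∧ tsupport χ ⊆ U ∧
      ∃ W : Set (E n), IsOpen W ∧ K ⊆ W ∧ ∀ x ∈ W, χ x = 1 := by
  obtain ⟨L, hL, hKL, hLU⟩ := exists_compact_between hK hU hKU
  obtain ⟨L', hL', hLL', hLU'⟩ := exists_compact_between hL hU hLU
  obtain ⟨f, hf, -, hf0, hf1⟩ :=
    exists_contMDiff_zero_iff_one_iff_of_isClosed (n := ⊤) (modelWithCornersSelf ℝ (E n))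
      (isOpen_interior (s := L')).isClosed_compl hL.isClosed
      (Set.disjoint_left.2 fun x hx hx' => hx (hLL' hx'))
  have hsupp : Function.support f ⊆ L' := by
    intro x hx
    by_contra h
    exact hx ((hf0 x).1 fun h' => h (interior_subset h'))
  have hts : tsupport f ⊆ L' := closure_minimal hsupp hL'.isClosed
  exact ⟨f, hf.contDiff.of_le (by simp), hL'.of_isClosed_subset (isClosed_tsupport _) hts,
    hts.trans hLU', interior L, isOpen_interior, hKL,
    fun x hx => (hf1 x).1 (interior_subset hx)⟩

theorem contDiff_of_contDiffAt_tsupport {k : WithTop ℕ∞} {f : E n → F}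
    (h : ∀ x ∈ tsupport f, ContDiffAt ℝ k f x) : ContDiff ℝ k f := by
  refine contDiff_iff_contDiffAt.2 fun x => ?_
  by_cases hx : x ∈ tsupport f
  · exact h x hx
  · exact contDiffAt_const.congr_of_eventuallyEq (notMem_tsupport_iff_eventuallyEq.1 hx)

theorem contDiff_cutoff_smul {χ : E n → ℝ} {U : Set (E n)} {k : WithTop ℕ∞} (hU : IsOpen U)
    (hχ : ContDiff ℝ k χ) (hsupp : tsupport χ ⊆ U) {f : E n → F} (hf : ContDiffOn ℝ k f U) :
    ContDiff ℝ k (fun x => χ x • f x) := by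
  refine contDiff_of_contDiffAt_tsupport fun x hx => ?_
  have hxU : x ∈ U := hsupp (tsupport_smul_subset_left χ f hx)
  exact hχ.contDiffAt.smul (hf.contDiffAt (hU.mem_nhds hxU))

/-- A function that is `C^k` near a compact set agrees near that set with a `C^k` function on the
whole space. -/
theorem exists_contDiff_extension {K U : Set (E n)} {k : ℕ∞} (hK : IsCompact K) (hU : IsOpen U)
    (hKU : K ⊆ U) {f : E n → F} (hf : ContDiffOn ℝ k f U) :
    ∃ g : E n → F, ContDiff ℝ k g ∧ ∃ W : Set (E n), IsOpen W ∧ K ⊆ W ∧ W ⊆ U ∧ EqOn g f W := by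
  obtain ⟨χ, h1, -, h3, W, hW, hKW, h4⟩ := exists_cutoff hK hU hKU
  refine ⟨fun x => χ x • f x, contDiff_cutoff_smul hU (h1.of_le ?_) h3 hf, W ∩ U,
    hW.inter hU, subset_inter hKW hKU, inter_subset_right, fun x hx => ?_⟩
  · exact_mod_cast le_top
  · simp [h4 x hx.1]

end cutoff

/-! ### Weak gradients -/

section weak

variable {n : ℕ}

/-- Mollification at a scale below δ and below the moduli of uniform continuity of v and ∂_j v; the
derivative of the convolution can be put on v. -/
theorem exists_smooth_approx {v : E n → ℂ} (hv : ContDiff ℝ 1 v) (hvc : HasCompactSupport v)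
    {δ ε : ℝ} (hδ : 0 < δ) (hε : 0 < ε) (j : Fin n) :
    ∃ w : E n → ℂ, ContDiff ℝ ∞ w ∧ tsupport w ⊆ Metric.cthickening δ (tsupport v) ∧
      (∀ x, ‖w x - v x‖ ≤ ε) ∧ ∀ x, ‖dd j w x - dd j v x‖ ≤ ε := by
  have hdc : Continuous (dd j v) := (contDiff_dd (k := 0) hv (by norm_num)).continuous
  have hu1 : UniformContinuous v := hvc.uniformContinuous_of_continuous hv.continuous
  have hu2 : UniformContinuous (dd j v) :=
    (hasCompactSupport_dd hvc).uniformContinuous_of_continuous hdc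
  obtain ⟨δ1, hδ1, h1⟩ := Metric.uniformContinuous_iff.1 hu1 ε hε
  obtain ⟨δ2, hδ2, h2⟩ := Metric.uniformContinuous_iff.1 hu2 ε hε
  set r := min δ (min δ1 δ2) with hr
  have hr0 : 0 < r := by positivity
  set φ : ContDiffBump (0 : E n) := ⟨r / 2, r, half_pos hr0, half_lt_self hr0⟩
  set L := ContinuousLinearMap.lsmul ℝ ℝ (E := ℂ)
  set w : E n → ℂ := convolution (φ.normed volume) v L volume with hw
  have hφ : LocallyIntegrable (φ.normed volume) (volume : Measure (E n)) :=
    φ.continuous_normed.locallyIntegrable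
  have hdw : ∀ x, dd j w x = convolution (φ.normed volume) (dd j v) L volume x := by
    intro x
    have := (hvc.hasFDerivAt_convolution_right L hφ hv x).fderiv
    rw [dd, hw, this, convolution_precompR_apply (hf := hφ) (hcg := hvc.fderiv ℝ)
      (hg := hv.continuous_fderiv (by norm_num))]
    rfl
  refine ⟨w, ?_, ?_, fun x => ?_, fun x => ?_⟩
  · exact φ.hasCompactSupport_normed.contDiff_convolution_left _ φ.contDiff_normed
      hv.continuous.locallyIntegrable
  · refine closure_minimal ?_ Metric.isClosed_cthickening
    refine (support_convolution_subset _).trans ?_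
    rw [φ.support_normed_eq]
    rintro _ ⟨a, ha, b, hb, rfl⟩
    refine Metric.mem_cthickening_of_dist_le _ b _ _ (subset_tsupport _ hb) ?_
    have : ‖a‖ < r := by simpa using ha
    simp only [dist_add_self_left]
    exact this.le.trans (min_le_left _ _)
  · rw [← dist_eq_norm]
    refine φ.dist_normed_convolution_le hv.continuous.aestronglyMeasurable fun y hy => (h1 ?_).le
    exact (Metric.mem_ball.1 hy).trans_le ((min_le_right _ _).trans (min_le_left _ _))
  · rw [← dist_eq_norm, hdw]
    refine φ.dist_normed_convolution_le hdc.aestronglyMeasurable fun y hy => (h2 ?_).le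
    exact (Metric.mem_ball.1 hy).trans_le ((min_le_right _ _).trans (min_le_right _ _))

theorem locallyIntegrableOn_apply {Ω : Set (E n)} {G : E n → EuclideanSpace ℂ (Fin n)}
    (hG : LocallyIntegrableOn G Ω volume) (j : Fin n) :
    LocallyIntegrableOn (fun x => G x j) Ω volume := by
  intro x hx
  obtain ⟨s, hs, hsi⟩ := hG x hx
  exact ⟨s, hs, (EuclideanSpace.proj (𝕜 := ℂ) j : _ →L[ℂ] ℂ).integrable_comp hsi⟩

theorem integrable_mul_of_locallyIntegrableOn {Ω : Set (E n)} {u : E n → ℂ}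
    (hu : LocallyIntegrableOn u Ω volume) {f : E n → ℂ} (hf : Continuous f)
    (hfc : HasCompactSupport f) (hfs : tsupport f ⊆ Ω) :
    Integrable (fun x => u x * f x) (volume.restrict Ω) := by
  have h1 : IntegrableOn u (tsupport f) volume := hu.integrableOn_compact_subset hfs hfc
  have h2 : IntegrableOn (fun x => u x * f x) (tsupport f) volume := by
    have := h1.continuousOn_mul (g := f) (g' := u) hf.continuousOn hfc
    simpa [mul_comm] using this
  refine Integrable.integrableOn ?_
  refine (integrableOn_iff_integrable_of_support_subset ?_).1 h2
  intro x hx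
  exact subset_tsupport f (right_ne_zero_of_mul hx)

/-- Test functions of class C¹ are needed because the coefficients are only C²: products of a
coefficient with a smooth test function are not smooth. Mollified test functions satisfy the
identity exactly, and the error is at most ε times the L¹ norms of u and of the component of G on a
compact neighbourhood of the support. -/
theorem IsWeakGrad.integral_mul_dd_of_contDiff_one {Ω : Set (E n)} (hΩ : IsOpen Ω) {u : E n → ℂ}
    {G : E n → EuclideanSpace ℂ (Fin n)} (h : IsWeakGrad Ω u G) {v : E n → ℂ}
    (hv : ContDiff ℝ 1 v) (hvc : HasCompactSupport v) (hvs : tsupport v ⊆ Ω) (j : Fin n) :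
    ∫ x in Ω, u x * dd j v x = -∫ x in Ω, G x j * v x := by
  obtain ⟨hu, hG, hw⟩ := h
  obtain ⟨δ, hδ, hδΩ⟩ := hvc.isCompact.exists_cthickening_subset_open hΩ hvs
  set K := Metric.cthickening δ (tsupport v) with hK
  have hKc : IsCompact K := hvc.isCompact.cthickening
  have hvK : tsupport v ⊆ K := Metric.self_subset_cthickening _
  have hGj := locallyIntegrableOn_apply hG j
  have huK : IntegrableOn u K volume := hu.integrableOn_compact_subset hδΩ hKc
  have hGK : IntegrableOn (fun x => G x j) K volume :=
    hGj.integrableOn_compact_subset hδΩ hKc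
  have hdc : Continuous (dd j v) := (contDiff_dd (k := 0) hv (by norm_num)).continuous
  have bound : ∀ (g : E n → ℂ), LocallyIntegrableOn g Ω volume → ∀ f : E n → ℂ, Continuous f →
      HasCompactSupport f → tsupport f ⊆ K → ∀ ε, 0 < ε → (∀ x, ‖f x‖ ≤ ε) →
      ‖∫ x in Ω, g x * f x‖ ≤ ε * ∫ x in K, ‖g x‖ := by
    intro g hg f hf hfc hfK ε hε hfε
    have e1 : ∫ x in Ω, g x * f x = ∫ x in K, g x * f x := by
      rw [← setIntegral_eq_of_subset_of_forall_sdiff_eq_zero hΩ.measurableSet hδΩ]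
      intro x hx
      rw [image_eq_zero_of_notMem_tsupport fun h' => hx.2 (hfK h'), mul_zero]
    rw [e1, ← integral_const_mul]
    refine norm_integral_le_of_norm_le
      ((hg.integrableOn_compact_subset hδΩ hKc).norm.const_mul ε) ?_
    refine Filter.Eventually.of_forall fun x => ?_
    rw [norm_mul, mul_comm]
    exact mul_le_mul_of_nonneg_right (hfε x) (norm_nonneg _)
  have key : ∀ ε : ℝ, 0 < ε → ‖(∫ x in Ω, u x * dd j v x) + ∫ x in Ω, G x j * v x‖
      ≤ ε * ((∫ x in K, ‖u x‖) + ∫ x in K, ‖G x j‖) := by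
    intro ε hε
    obtain ⟨w, hw1, hw2, hw3, hw4⟩ := exists_smooth_approx hv hvc hδ hε j
    have hwc : HasCompactSupport w := hKc.of_isClosed_subset (isClosed_tsupport _) hw2
    have hweq := hw w ⟨hw1, hwc, hw2.trans hδΩ⟩ j
    rw [pd_eq_dd] at hweq
    have hdwc : Continuous (dd j w) := (contDiff_dd (k := 0) hw1 (by simp)).continuous
    have d1 : (∫ x in Ω, u x * dd j w x) - ∫ x in Ω, u x * dd j v x
        = ∫ x in Ω, u x * (dd j w x - dd j v x) := by
      rw [← integral_sub]
      · simp only [mul_sub]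
      · exact integrable_mul_of_locallyIntegrableOn hu hdwc (hasCompactSupport_dd hwc)
          ((tsupport_dd_subset w).trans (hw2.trans hδΩ))
      · exact integrable_mul_of_locallyIntegrableOn hu hdc (hasCompactSupport_dd hvc)
          ((tsupport_dd_subset v).trans hvs)
    have d2 : (∫ x in Ω, G x j * w x) - ∫ x in Ω, G x j * v x
        = ∫ x in Ω, G x j * (w x - v x) := by
      rw [← integral_sub]
      · simp only [mul_sub]
      · exact integrable_mul_of_locallyIntegrableOn hGj hw1.continuous hwc (hw2.trans hδΩ)
      · exact integrable_mul_of_locallyIntegrableOn hGj hv.continuous hvc hvs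
    have b1 := bound u hu (fun x => dd j w x - dd j v x) (hdwc.sub hdc)
      ((hasCompactSupport_dd hwc).sub (hasCompactSupport_dd hvc))
      ((tsupport_sub _ _).trans (union_subset ((tsupport_dd_subset w).trans hw2)
        ((tsupport_dd_subset v).trans hvK))) ε hε hw4
    have b2 := bound (fun x => G x j) hGj (fun x => w x - v x) (hw1.continuous.sub hv.continuous)
      (hwc.sub hvc) ((tsupport_sub _ _).trans (union_subset hw2 hvK)) ε hε hw3
    rw [← d1] at b1
    rw [← d2] at b2
    have e : (∫ x in Ω, u x * dd j v x) + ∫ x in Ω, G x j * v x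
        = -((∫ x in Ω, u x * dd j w x) - ∫ x in Ω, u x * dd j v x)
          - ((∫ x in Ω, G x j * w x) - ∫ x in Ω, G x j * v x) := by
      rw [hweq]; ring
    rw [e, mul_add]
    refine (norm_sub_le _ _).trans ?_
    rw [norm_neg]
    exact add_le_add b1 b2
  have h0 : ‖(∫ x in Ω, u x * dd j v x) + ∫ x in Ω, G x j * v x‖ ≤ 0 := by
    set S := (∫ x in K, ‖u x‖) + ∫ x in K, ‖G x j‖ with hS
    have hS0 : 0 ≤ S := add_nonneg (integral_nonneg fun _ => norm_nonneg _)
      (integral_nonneg fun _ => norm_nonneg _)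
    refine le_of_forall_pos_le_add fun ε hε => ?_
    -- The sum S of the L¹ norms may vanish, hence the division by S + 1.
    refine (key (ε / (S + 1)) (by positivity)).trans ?_
    rw [zero_add, div_mul_eq_mul_div, div_le_iff₀ (by positivity)]
    nlinarith
  exact eq_neg_of_add_eq_zero_left (norm_le_zero_iff.1 h0)

/-- The fundamental lemma of the calculus of variations, one component at a time. Since `weakGrad`
is an arbitrary choice, this is what allows it to be replaced by an explicitly computed gradient
under integrals. -/
theorem IsWeakGrad.ae_unique {Ω : Set (E n)} (hΩ : IsOpen Ω) {u : E n → ℂ}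
    {G G' : E n → EuclideanSpace ℂ (Fin n)} (h : IsWeakGrad Ω u G) (h' : IsWeakGrad Ω u G') :
    ∀ᵐ x ∂(volume.restrict Ω), G x = G' x := by
  have hj : ∀ j : Fin n, ∀ᵐ x ∂(volume : Measure (E n)), x ∈ Ω → G x j - G' x j = 0 := by
    intro j
    have hGj := locallyIntegrableOn_apply h.2.1 j
    have hGj' := locallyIntegrableOn_apply h'.2.1 j
    refine hΩ.ae_eq_zero_of_integral_contDiff_smul_eq_zero (hGj.sub hGj') ?_
    intro g hg hgc hgs
    have hts : tsupport (fun x => (g x : ℂ)) ⊆ tsupport g :=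
      closure_mono fun x hx hx' => hx (by simp [hx'])
    have hgC : ContDiff ℝ ∞ (fun x => (g x : ℂ)) := Complex.ofRealCLM.contDiff.comp hg
    have hcc : HasCompactSupport (fun x => (g x : ℂ)) :=
      hgc.isCompact.of_isClosed_subset (isClosed_tsupport _) hts
    have ht : IsTest Ω (fun x => (g x : ℂ)) := ⟨hgC, hcc, hts.trans hgs⟩
    have e1 := h.2.2 _ ht j
    have e2 := h'.2.2 _ ht j
    rw [e1] at e2
    have e3 : ∫ x in Ω, (G x j - G' x j) * (g x : ℂ) = 0 := by
      simp only [sub_mul]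
      rw [integral_sub, sub_eq_zero]
      · exact neg_inj.1 e2
      · exact integrable_mul_of_locallyIntegrableOn hGj hgC.continuous hcc ht.2.2
      · exact integrable_mul_of_locallyIntegrableOn hGj' hgC.continuous hcc ht.2.2
    rw [← e3, setIntegral_eq_integral_of_forall_compl_eq_zero]
    · refine integral_congr_ae (Filter.Eventually.of_forall fun x => ?_)
      simp [mul_comm]
    · intro x hx
      have : g x = 0 := image_eq_zero_of_notMem_tsupport fun h' => hx (hgs h')
      simp [this]
  rw [ae_restrict_iff' hΩ.measurableSet]
  filter_upwards [ae_all_iff.2 hj] with x hx hxΩ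
  ext j
  exact sub_eq_zero.1 (hx j hxΩ)

theorem IsWeakGrad.weakGrad_spec {Ω : Set (E n)} {u : E n → ℂ}
    {G : E n → EuclideanSpace ℂ (Fin n)} (h : IsWeakGrad Ω u G) :
    IsWeakGrad Ω u (weakGrad Ω u) := by
  have : ∃ G, IsWeakGrad Ω u G := ⟨G, h⟩
  rw [weakGrad, dif_pos this]
  exact this.choose_spec

theorem IsWeakGrad.weakGrad_ae_eq {Ω : Set (E n)} (hΩ : IsOpen Ω) {u : E n → ℂ}
    {G : E n → EuclideanSpace ℂ (Fin n)} (h : IsWeakGrad Ω u G) :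
    ∀ᵐ x ∂(volume.restrict Ω), weakGrad Ω u x = G x :=
  h.weakGrad_spec.ae_unique hΩ h

end weak

/-! ### The Carleman estimate -/

/-- The radial derivative `(x - x₀)·∇f`. -/
def euler {n : ℕ} (x₀ : E n) (f : E n → ℝ) (x : E n) : ℝ := fderiv ℝ f x (x - x₀)

/-- The smooth function `p` agrees on the open set `U` with `log |x - x₀|`, and is bounded by `M`
there; this is expressed through `|x - x₀|² = e^{2p}` and `∇p = e^{-2p} (x - x₀)`. -/
structure IsLogWeight {n : ℕ} (x₀ : E n) (U : Set (E n)) (M : ℝ) (p : E n → ℝ) : Prop where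
  isOpen : IsOpen U
  contDiff : ContDiff ℝ ∞ p
  sum_sq : ∀ x ∈ U, ∑ j, (x j - x₀ j) ^ 2 = Real.exp (2 * p x)
  dd_eq : ∀ x ∈ U, ∀ j, dd j p x = Real.exp (-2 * p x) * (x j - x₀ j)
  bound : ∀ x ∈ U, |p x| ≤ M

section euler

variable {n : ℕ} {x₀ x : E n} {f g : E n → ℝ}

theorem euler_eq_sum (f : E n → ℝ) : euler x₀ f x = ∑ j, (x j - x₀ j) * dd j f x := by
  simp [euler, fderiv_apply_eq_sum]

theorem euler_mul (hf : DifferentiableAt ℝ f x) (hg : DifferentiableAt ℝ g x) :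
    euler x₀ (fun y => f y * g y) x = euler x₀ f x * g x + f x * euler x₀ g x := by
  simp [euler, fderiv_fun_mul hf hg]; ring

theorem euler_sub (hf : DifferentiableAt ℝ f x) (hg : DifferentiableAt ℝ g x) :
    euler x₀ (fun y => f y - g y) x = euler x₀ f x - euler x₀ g x := by
  simp [euler, fderiv_fun_sub hf hg]

theorem euler_neg : euler x₀ (fun y => -f y) x = -euler x₀ f x := by
  simp [euler, fderiv_fun_neg]

theorem euler_const_add (c : ℝ) :
    euler x₀ (fun y => c + f y) x = euler x₀ f x := by
  simp [euler]

theorem euler_const_mul (c : ℝ) (hf : DifferentiableAt ℝ f x) :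
    euler x₀ (fun y => c * f y) x = c * euler x₀ f x := by
  simp [euler, fderiv_const_mul hf]

theorem euler_sub_const (c : ℝ) :
    euler x₀ (fun y => f y - c) x = euler x₀ f x := by
  simp only [euler, fderiv_sub_const]

theorem euler_pow (hf : DifferentiableAt ℝ f x) (k : ℕ) :
    euler x₀ (fun y => f y ^ k) x = k * f x ^ (k - 1) * euler x₀ f x := by
  simp [euler, fderiv_fun_pow k hf, mul_assoc]

theorem euler_exp (hf : DifferentiableAt ℝ f x) :
    euler x₀ (fun y => Real.exp (f y)) x = Real.exp (f x) * euler x₀ f x := by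
  simp [euler, fderiv_exp hf]

theorem contDiff_coord_sub (j : Fin n) {k : WithTop ℕ∞} :
    ContDiff ℝ k (fun y : E n => y j - x₀ j) := by
  fun_prop

theorem dd_coord_sub (i j : Fin n) :
    dd i (fun y : E n => y j - x₀ j) x = if i = j then 1 else 0 := by
  have h : HasFDerivAt (fun y : E n => y j - x₀ j) (EuclideanSpace.proj (𝕜 := ℝ) j : E n →L[ℝ] ℝ)
      x := ((EuclideanSpace.proj (𝕜 := ℝ) j : E n →L[ℝ] ℝ).hasFDerivAt).sub_const _
  simp [dd, h.fderiv, eq_comm]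

theorem contDiff_euler (hf : ContDiff ℝ 2 f) : ContDiff ℝ 1 (euler x₀ f) := by
  have : euler x₀ f = fun x => ∑ j, (x j - x₀ j) * dd j f x := funext fun x => euler_eq_sum f
  rw [this]
  exact ContDiff.sum fun j _ => (contDiff_coord_sub j).mul (contDiff_dd hf (by norm_num))

theorem dd_euler (hf : ContDiff ℝ 2 f) (j : Fin n) :
    dd j (euler x₀ f) x = dd j f x + ∑ i, (x i - x₀ i) * dd j (dd i f) x := by
  have : euler x₀ f = fun x => ∑ j, (x j - x₀ j) * dd j f x := funext fun x => euler_eq_sum f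
  have hd : ∀ i, DifferentiableAt ℝ (dd i f) x := fun i =>
    (contDiff_dd (k := 1) hf (by norm_num)).differentiable (by norm_num) x
  have hc : ∀ i, DifferentiableAt ℝ (fun y : E n => y i - x₀ i) x := fun i =>
    (contDiff_coord_sub (k := 1) i).differentiable (by norm_num) x
  rw [this, dd_sum fun i _ => (hc i).fun_mul (hd i)]
  rw [Finset.sum_congr rfl fun i _ => dd_mul (hc i) (hd i)]
  simp only [dd_coord_sub, Finset.sum_add_distrib, ite_mul, one_mul, zero_mul]
  simp

/-- The radial field X = (x - x₀)·∇ satisfies ∂_j X = X ∂_j + ∂_j, and ∇f · X∇f is half of X|∇f|².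
-/
theorem sum_dd_mul_dd_euler (hf : ContDiff ℝ 2 f) :
    ∑ j, dd j f x * dd j (euler x₀ f) x
      = ∑ j, dd j f x ^ 2 + euler x₀ (fun y => ∑ j, dd j f y ^ 2) x / 2 := by
  have hd : ∀ i, DifferentiableAt ℝ (dd i f) x := fun i =>
    (contDiff_dd (k := 1) hf (by norm_num)).differentiable (by norm_num) x
  rw [euler_eq_sum]
  have e1 : ∀ i, dd i (fun y => ∑ j, dd j f y ^ 2) x
      = ∑ j, 2 * dd j f x * dd j (dd i f) x := by
    intro i
    rw [dd_sum fun j _ => (hd j).fun_pow 2]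
    refine Finset.sum_congr rfl fun j _ => ?_
    rw [dd_pow (hd j), dd_comm hf.contDiffAt]
    norm_num
  simp only [dd_euler hf, mul_add, e1, Finset.sum_add_distrib, Finset.mul_sum, Finset.sum_div]
  rw [Finset.sum_comm]
  congr 1
  · exact Finset.sum_congr rfl fun j _ => by ring
  · exact Finset.sum_congr rfl fun j _ => Finset.sum_congr rfl fun i _ => by ring

end euler

/-! ### Divergence identities in logarithmic polar coordinates -/

namespace IsLogWeight

variable {n : ℕ} {x₀ x : E n} {U : Set (E n)} {M : ℝ} {p : E n → ℝ} {w : E n → ℝ}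

theorem differentiableAt (hp : IsLogWeight x₀ U M p) : DifferentiableAt ℝ p x :=
  hp.contDiff.differentiable (by simp) x

theorem euler_eq_one (hp : IsLogWeight x₀ U M p) (hx : x ∈ U) : euler x₀ p x = 1 := by
  rw [euler_eq_sum]
  simp only [hp.dd_eq x hx]
  have : ∀ j, (x j - x₀ j) * (Real.exp (-2 * p x) * (x j - x₀ j))
      = Real.exp (-2 * p x) * (x j - x₀ j) ^ 2 := fun j => by ring
  simp only [this]
  rw [← Finset.mul_sum, hp.sum_sq x hx, ← Real.exp_add]
  simp

theorem contDiff_exp (hp : IsLogWeight x₀ U M p) (k : ℝ) :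
    ContDiff ℝ ∞ (fun y => Real.exp (k * p y)) :=
  Real.contDiff_exp.comp (contDiff_const.mul hp.contDiff)

theorem dd_exp (hp : IsLogWeight x₀ U M p) (k : ℝ) (j : Fin n) :
    dd j (fun y => Real.exp (k * p y)) x = Real.exp (k * p x) * (k * dd j p x) := by
  rw [dd_rexp (hp.differentiableAt.const_mul k), dd_const_mul _ hp.differentiableAt]

/-- The field e^{-np}(x - x₀) is divergence free away from x₀. In coordinates t = p and ϑ on the
sphere, e^{-np} dx is dt dϑ and `euler` is ∂_t, so the identity expresses that ∂_t f integrates to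
zero. -/
theorem sum_dd_radial (hp : IsLogWeight x₀ U M p) (hx : x ∈ U) {f : E n → ℝ}
    (hf : DifferentiableAt ℝ f x) :
    ∑ j, dd j (fun y => Real.exp (-n * p y) * (y j - x₀ j) * f y) x
      = Real.exp (-n * p x) * euler x₀ f x := by
  have hE : DifferentiableAt ℝ (fun y => Real.exp (-n * p y)) x :=
    (hp.contDiff_exp _).differentiable (by simp) x
  have hc : ∀ i, DifferentiableAt ℝ (fun y : E n => y i - x₀ i) x := fun i =>
    (contDiff_coord_sub (k := 1) i).differentiable (by norm_num) x
  have h1 : ∀ j, dd j (fun y => Real.exp (-n * p y) * (y j - x₀ j) * f y) x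
      = Real.exp (-n * p x) * ((x j - x₀ j) * dd j f x)
        + Real.exp (-n * p x) * f x * (1 - n * (Real.exp (-2 * p x) * (x j - x₀ j) ^ 2)) := by
    intro j
    rw [dd_mul (hE.fun_mul (hc j)) hf, dd_mul hE (hc j), dd_coord_sub, if_pos rfl, hp.dd_exp,
      hp.dd_eq x hx]
    ring
  simp only [h1, Finset.sum_add_distrib, ← Finset.mul_sum, ← euler_eq_sum, Finset.sum_sub_distrib,
    hp.sum_sq x hx, ← Real.exp_add]
  simp

/-- Green's formula for the density e^{-np} dx. The operator e^{2p}Δ - (n - 2)∂_t equals ∂_t² plus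
the spherical Laplacian, which is symmetric for dt dϑ; the first order term comes from
differentiating the weight e^{(2-n)p}. -/
theorem sum_dd_flux (hp : IsLogWeight x₀ U M p) (hx : x ∈ U) {f g : E n → ℝ}
    (hf : ContDiff ℝ 2 f) (hg : DifferentiableAt ℝ g x) :
    ∑ j, dd j (fun y => Real.exp ((2 - n) * p y) * dd j f y * g y) x
      = Real.exp (-n * p x) * ((Real.exp (2 * p x) * ∑ j, dd j (dd j f) x
          - (n - 2) * euler x₀ f x) * g x + Real.exp (2 * p x) * ∑ j, dd j f x * dd j g x) := by
  have hE : DifferentiableAt ℝ (fun y => Real.exp ((2 - n) * p y)) x :=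
    (hp.contDiff_exp _).differentiable (by simp) x
  have hd : ∀ i, DifferentiableAt ℝ (dd i f) x := fun i =>
    (contDiff_dd (k := 1) hf (by norm_num)).differentiable (by norm_num) x
  have hexp : Real.exp ((2 - n) * p x) = Real.exp (-n * p x) * Real.exp (2 * p x) := by
    rw [← Real.exp_add]; ring_nf
  have h2 : Real.exp (2 * p x) * Real.exp (-2 * p x) = 1 := by
    rw [← Real.exp_add]; simp
  have h1 : ∀ j, dd j (fun y => Real.exp ((2 - n) * p y) * dd j f y * g y) x
      = Real.exp (-n * p x) * (Real.exp (2 * p x) * g x * dd j (dd j f) x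
          - (n - 2) * g x * ((x j - x₀ j) * dd j f x)
          + Real.exp (2 * p x) * (dd j f x * dd j g x)) := by
    intro j
    rw [dd_mul (hE.fun_mul (hd j)) hg, dd_mul hE (hd j), hp.dd_exp, hp.dd_eq x hx, hexp]
    linear_combination ((2 - n) * Real.exp (-n * p x) * (x j - x₀ j) * dd j f x * g x) * h2
  simp only [h1, Finset.sum_add_distrib, ← Finset.mul_sum, ← euler_eq_sum, Finset.sum_sub_distrib]
  ring

/-- The integral of the divergence of a compactly supported field, evaluated on `U` only. -/
theorem integral_eq_zero_of_sum_dd {V : Fin n → E n → ℝ} {g : E n → ℝ}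
    (hV : ∀ j, ContDiff ℝ 1 (V j)) (hVc : ∀ j, HasCompactSupport (V j))
    (hVU : ∀ j, tsupport (V j) ⊆ U) (h : ∀ x ∈ U, g x = ∑ j, dd j (V j) x)
    (h0 : ∀ x ∉ U, g x = 0) : ∫ x, g x = 0 := by
  have : g = fun x => ∑ j, dd j (V j) x := by
    funext x
    by_cases hx : x ∈ U
    · exact h x hx
    · rw [h0 x hx, Finset.sum_eq_zero]
      exact fun j _ => dd_eq_zero_of_notMem fun h' => hx (hVU j h')
  rw [this, integral_finsetSum]
  · exact Finset.sum_eq_zero fun j _ => integral_dd_eq_zero (hV j) (hVc j)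
  · exact fun j _ => (contDiff_dd (k := 0) (hV j) (by norm_num)).continuous.integrable_of_hasCompactSupport
      (hasCompactSupport_dd (hVc j))

end IsLogWeight

/-- The operator `e^{2p} e^σ Δ e^{-σ}`, `σ = τ p + b p² / 2`, in terms of `s = τ + b p`. -/
def conjLap {n : ℕ} (x₀ : E n) (p : E n → ℝ) (b : ℝ) (s : ℝ) (w : E n → ℝ) (x : E n) : ℝ :=
  Real.exp (2 * p x) * ∑ j, dd j (dd j w) x - 2 * s * euler x₀ w x
    + (s ^ 2 - (n - 2) * s - b) * w x

namespace IsLogWeight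

variable {n : ℕ} {x₀ x : E n} {U : Set (E n)} {M : ℝ} {p : E n → ℝ} {w : E n → ℝ}

/-- With κ = (n - 2)/2 and μ = s - κ, the conjugated operator splits into the symmetric part ∂_t² +
Δ_ϑ + μ² - κ² and the antisymmetric part T = -2μ∂_t - b with respect to dt dϑ. The terms 2b(∂_t w)²
+ 2bμ²w² are half the quadratic form of their commutator, positive because ∂_t μ = b. The integrand
is exhibited as an exact divergence. -/
theorem integral_conjLap_mul_antisymm (hp : IsLogWeight x₀ U M p) (hw : ContDiff ℝ 2 w)
    (hwc : HasCompactSupport w) (hwU : tsupport w ⊆ U) (τ b : ℝ) :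
    ∫ x, Real.exp (-n * p x) * (conjLap x₀ p b (τ + b * p x) w x
        * (-2 * (τ + b * p x - (n - 2) / 2) * euler x₀ w x - b * w x)
      - (-2 * (τ + b * p x - (n - 2) / 2) * euler x₀ w x - b * w x) ^ 2
      - 2 * b * euler x₀ w x ^ 2 - 2 * b * (τ + b * p x - (n - 2) / 2) ^ 2 * w x ^ 2) = 0 := by
  set κ : ℝ := (n - 2) / 2 with hκ
  set μ : E n → ℝ := fun y => τ + b * p y - κ with hμ
  set S : E n → ℝ := fun y => ∑ j, dd j w y ^ 2 with hS
  have hμc : ContDiff ℝ 1 μ :=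
    (contDiff_const.add (contDiff_const.mul (hp.contDiff.of_le (by simp)))).sub contDiff_const
  have hXc : ContDiff ℝ 1 (euler x₀ w) := contDiff_euler hw
  have hSc : ContDiff ℝ 1 S :=
    ContDiff.sum fun j _ => (contDiff_dd hw (by norm_num)).pow 2
  have hEc : ∀ k : ℝ, ContDiff ℝ 1 (fun y => Real.exp (k * p y)) := fun k =>
    (hp.contDiff_exp k).of_le (by simp)
  set T : E n → ℝ := fun y => -2 * μ y * euler x₀ w y - b * w y with hT
  have hw1 : ContDiff ℝ 1 w := hw.of_le (by norm_num)
  have hTc : ContDiff ℝ 1 T :=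
    ((contDiff_const.mul hμc).mul hXc).sub (contDiff_const.mul hw1)
  -- Potential for the radial part of the field: its first term cancels the |∇w|² terms left by
  -- Green's formula, its second is the primitive of (μ² - κ²) w · 2μ ∂_t w up to terms in w².
  set F : E n → ℝ := fun y => μ y * (Real.exp (2 * p y) * S y)
    - (μ y ^ 2 - κ ^ 2) * μ y * w y ^ 2 with hF
  have hFc : ContDiff ℝ 1 F :=
    (hμc.mul ((hEc 2).mul hSc)).sub ((((hμc.pow 2).sub contDiff_const).mul hμc).mul (hw1.pow 2))
  set V : Fin n → E n → ℝ := fun j y => Real.exp ((2 - n) * p y) * dd j w y * T y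
    + Real.exp (-n * p y) * (y j - x₀ j) * F y with hV
  have hVts : ∀ j, tsupport (V j) ⊆ tsupport w := by
    intro j
    refine closure_minimal (fun x hx => ?_) (isClosed_tsupport w)
    by_contra h
    apply hx
    have h1 : ∀ i, dd i w x = 0 := fun i => dd_eq_zero_of_notMem h
    have h2 : w x = 0 := image_eq_zero_of_notMem_tsupport h
    simp [hV, hF, hS, h1, h2]
  refine integral_eq_zero_of_sum_dd (U := U) (V := V) (fun j => ?_)
    (fun j => hwc.of_isClosed_subset (isClosed_tsupport _) (hVts j))
    (fun j => (hVts j).trans hwU) (fun x hx => ?_) (fun x hx => ?_)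
  · exact (((hEc _).mul (contDiff_dd hw (by norm_num))).mul hTc).add
      (((hEc _).mul (contDiff_coord_sub j)).mul hFc)
  · have dμ : DifferentiableAt ℝ μ x := hμc.differentiable (by norm_num) x
    have dX : DifferentiableAt ℝ (euler x₀ w) x := hXc.differentiable (by norm_num) x
    have dS : DifferentiableAt ℝ S x := hSc.differentiable (by norm_num) x
    have dE : ∀ k : ℝ, DifferentiableAt ℝ (fun y => Real.exp (k * p y)) x := fun k =>
      (hEc k).differentiable (by norm_num) x
    have dw : DifferentiableAt ℝ w x := hw1.differentiable (by norm_num) x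
    have dT : DifferentiableAt ℝ T x := hTc.differentiable (by norm_num) x
    have dF : DifferentiableAt ℝ F x := hFc.differentiable (by norm_num) x
    have dV : ∀ j, dd j (V j) x = dd j (fun y => Real.exp ((2 - n) * p y) * dd j w y * T y) x
        + dd j (fun y => Real.exp (-n * p y) * (y j - x₀ j) * F y) x := by
      intro j
      refine dd_add ?_ ?_
      · exact ((((hEc _).mul (contDiff_dd hw (by norm_num))).mul hTc).differentiable
          (by norm_num) x)
      · exact ((((hEc _).mul (contDiff_coord_sub j)).mul hFc).differentiable (by norm_num) x)
    simp only [dV, Finset.sum_add_distrib]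
    rw [hp.sum_dd_flux hx hw dT, hp.sum_dd_radial hx dF]
    have eμ : euler x₀ μ x = b := by
      rw [hμ, euler_sub_const, euler_const_add, euler_const_mul _ hp.differentiableAt,
        hp.euler_eq_one hx, mul_one]
    have eE : euler x₀ (fun y => Real.exp (2 * p y)) x = 2 * Real.exp (2 * p x) := by
      rw [euler_exp (hp.differentiableAt.const_mul _), euler_const_mul _ hp.differentiableAt,
        hp.euler_eq_one hx]
      ring
    have eF : euler x₀ F x = b * (Real.exp (2 * p x) * S x)
        + μ x * (2 * Real.exp (2 * p x) * S x + Real.exp (2 * p x) * euler x₀ S x)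
        - ((3 * μ x ^ 2 - κ ^ 2) * b * w x ^ 2
          + (μ x ^ 2 - κ ^ 2) * μ x * (2 * w x * euler x₀ w x)) := by
      rw [hF, euler_sub (dμ.fun_mul ((dE 2).fun_mul dS))
        ((((dμ.fun_pow 2).sub_const _).fun_mul dμ).fun_mul (dw.fun_pow 2)), euler_mul dμ ((dE 2).fun_mul dS),
        euler_mul (dE 2) dS, euler_mul (((dμ.fun_pow 2).sub_const _).fun_mul dμ) (dw.fun_pow 2),
        euler_mul ((dμ.fun_pow 2).sub_const _) dμ,
        euler_sub_const (f := fun y => μ y ^ 2), euler_pow dμ, euler_pow dw, eμ, eE]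
      simp only [Nat.cast_ofNat, Nat.reduceSub, pow_one]
      ring
    have dTj : ∀ j, dd j T x = -2 * b * dd j p x * euler x₀ w x
        - 2 * μ x * dd j (euler x₀ w) x - b * dd j w x := by
      intro j
      have dμj : dd j μ x = b * dd j p x := by
        rw [hμ, dd_sub ((hp.differentiableAt.const_mul b).const_add τ) (by fun_prop),
          dd_add (by fun_prop) (hp.differentiableAt.const_mul b),
          dd_const_mul _ hp.differentiableAt, dd_const, dd_const]
        ring
      rw [hT, dd_sub ((dμ.const_mul (-2)).fun_mul dX) (dw.const_mul b),
        dd_mul (dμ.const_mul (-2)) dX, dd_const_mul _ dμ, dd_const_mul _ dw, dμj]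
      ring
    have eT : ∑ j, dd j w x * dd j T x = -2 * b * Real.exp (-2 * p x) * euler x₀ w x ^ 2
        - 2 * μ x * (S x + euler x₀ S x / 2) - b * S x := by
      rw [← sum_dd_mul_dd_euler hw]
      have : ∀ j, dd j w x * dd j T x
          = -2 * b * Real.exp (-2 * p x) * euler x₀ w x * ((x j - x₀ j) * dd j w x)
            - 2 * μ x * (dd j w x * dd j (euler x₀ w) x) - b * dd j w x ^ 2 := by
        intro j
        rw [dTj, hp.dd_eq x hx]; ring
      simp only [this, Finset.sum_sub_distrib, ← Finset.mul_sum, ← euler_eq_sum]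
      simp only [hS]
      ring
    have h2 : Real.exp (2 * p x) * Real.exp (-2 * p x) = 1 := by
      rw [← Real.exp_add]; simp
    rw [eF, eT]
    simp only [conjLap, hT, hμ, hκ]
    linear_combination (2 * b * Real.exp (-n * p x) * euler x₀ w x ^ 2) * h2
  · have h : x ∉ tsupport w := fun h' => hx (hwU h')
    have h1 : ∀ i, dd i w x = 0 := fun i => dd_eq_zero_of_notMem h
    have h2 : w x = 0 := image_eq_zero_of_notMem_tsupport h
    have h3 : euler x₀ w x = 0 := by rw [euler_eq_sum]; simp [h1]
    simp [h2, h3]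

/-- Pairing with w leaves only the symmetric part; the pairing of w with T w is the exact derivative
-∂_t(μ w²). This identity supplies the full gradient, whereas the commutator controls only ∂_t w and
μw. -/
theorem integral_conjLap_mul_self (hp : IsLogWeight x₀ U M p) (hw : ContDiff ℝ 2 w)
    (hwc : HasCompactSupport w) (hwU : tsupport w ⊆ U) (τ b : ℝ) :
    ∫ x, Real.exp (-n * p x) * (conjLap x₀ p b (τ + b * p x) w x * w x
      + Real.exp (2 * p x) * ∑ j, dd j w x ^ 2
      - ((τ + b * p x - (n - 2) / 2) ^ 2 - ((n - 2) / 2) ^ 2) * w x ^ 2) = 0 := by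
  set κ : ℝ := (n - 2) / 2 with hκ
  set μ : E n → ℝ := fun y => τ + b * p y - κ with hμ
  have hμc : ContDiff ℝ 1 μ :=
    (contDiff_const.add (contDiff_const.mul (hp.contDiff.of_le (by simp)))).sub contDiff_const
  have hEc : ∀ k : ℝ, ContDiff ℝ 1 (fun y => Real.exp (k * p y)) := fun k =>
    (hp.contDiff_exp k).of_le (by simp)
  have hw1 : ContDiff ℝ 1 w := hw.of_le (by norm_num)
  set F : E n → ℝ := fun y => -(μ y * w y ^ 2) with hF
  have hFc : ContDiff ℝ 1 F := (hμc.mul (hw1.pow 2)).neg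
  set V : Fin n → E n → ℝ := fun j y => Real.exp ((2 - n) * p y) * dd j w y * w y
    + Real.exp (-n * p y) * (y j - x₀ j) * F y with hV
  have hVts : ∀ j, tsupport (V j) ⊆ tsupport w := by
    intro j
    refine closure_minimal (fun x hx => ?_) (isClosed_tsupport w)
    by_contra h
    apply hx
    have h2 : w x = 0 := image_eq_zero_of_notMem_tsupport h
    simp [hV, hF, h2]
  refine integral_eq_zero_of_sum_dd (U := U) (V := V) (fun j => ?_)
    (fun j => hwc.of_isClosed_subset (isClosed_tsupport _) (hVts j))
    (fun j => (hVts j).trans hwU) (fun x hx => ?_) (fun x hx => ?_)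
  · exact (((hEc _).mul (contDiff_dd hw (by norm_num))).mul hw1).add
      (((hEc _).mul (contDiff_coord_sub j)).mul hFc)
  · have dμ : DifferentiableAt ℝ μ x := hμc.differentiable (by norm_num) x
    have dw : DifferentiableAt ℝ w x := hw1.differentiable (by norm_num) x
    have dF : DifferentiableAt ℝ F x := hFc.differentiable (by norm_num) x
    have dV : ∀ j, dd j (V j) x = dd j (fun y => Real.exp ((2 - n) * p y) * dd j w y * w y) x
        + dd j (fun y => Real.exp (-n * p y) * (y j - x₀ j) * F y) x := by
      intro j
      refine dd_add ?_ ?_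
      · exact ((((hEc _).mul (contDiff_dd hw (by norm_num))).mul hw1).differentiable
          (by norm_num) x)
      · exact ((((hEc _).mul (contDiff_coord_sub j)).mul hFc).differentiable (by norm_num) x)
    simp only [dV, Finset.sum_add_distrib]
    rw [hp.sum_dd_flux hx hw dw, hp.sum_dd_radial hx dF]
    have eμ : euler x₀ μ x = b := by
      rw [hμ, euler_sub_const, euler_const_add, euler_const_mul _ hp.differentiableAt,
        hp.euler_eq_one hx, mul_one]
    have eF : euler x₀ F x = -(b * w x ^ 2 + μ x * (2 * w x * euler x₀ w x)) := by
      rw [hF, euler_neg, euler_mul dμ (dw.fun_pow 2), euler_pow dw, eμ]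
      norm_num
    rw [eF]
    simp only [conjLap, hμ, hκ, ← sq]
    ring
  · have h : x ∉ tsupport w := fun h' => hx (hwU h')
    have h1 : ∀ i, dd i w x = 0 := fun i => dd_eq_zero_of_notMem h
    have h2 : w x = 0 := image_eq_zero_of_notMem_tsupport h
    simp [h1, h2]

end IsLogWeight

/-! ### Carleman estimate for the Laplacian, in conjugated and in original form -/

namespace IsLogWeight

variable {n : ℕ} {x₀ x : E n} {U : Set (E n)} {M : ℝ} {p : E n → ℝ} {w : E n → ℝ}

theorem continuous_conjLap (hp : IsLogWeight x₀ U M p) (hw : ContDiff ℝ 2 w) (τ b : ℝ) :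
    Continuous fun x => conjLap x₀ p b (τ + b * p x) w x := by
  have h1 : Continuous p := hp.contDiff.continuous
  have h2 : Continuous (euler x₀ w) := (contDiff_euler hw).continuous
  have h3 : ∀ j, Continuous (dd j (dd j w)) := fun j =>
    (contDiff_dd (k := 0) (contDiff_dd (k := 1) hw (by norm_num)) (by norm_num)).continuous
  have h4 : Continuous w := hw.continuous
  unfold conjLap
  fun_prop

theorem conjLap_eq_zero (h : x ∉ tsupport w) (b s : ℝ) : conjLap x₀ p b s w x = 0 := by
  have h1 : ∀ i, dd i w x = 0 := fun i => dd_eq_zero_of_notMem h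
  have h2 : w x = 0 := image_eq_zero_of_notMem_tsupport h
  have h3 : euler x₀ w x = 0 := by rw [euler_eq_sum]; simp [h1]
  have h4 : ∀ i, dd i (dd i w) x = 0 := fun i =>
    dd_eq_zero_of_notMem fun h' => h (tsupport_dd_subset w h')
  simp [conjLap, h2, h3, h4]

/-- Twice the commutator identity minus b times the identity paired with w: the first bounds μw, the
second trades part of this bound for the gradient. The condition on μ lets b²w² be absorbed by
bμ²w². -/
theorem integral_conjLap_sq_ge (hp : IsLogWeight x₀ U M p) (hw : ContDiff ℝ 2 w)
    (hwc : HasCompactSupport w) (hwU : tsupport w ⊆ U) {τ b : ℝ} (hb : 0 < b)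
    (hμ : ∀ x ∈ U, b ≤ (τ + b * p x - (n - 2) / 2) ^ 2) :
    0 ≤ ∫ x, Real.exp (-n * p x) * (conjLap x₀ p b (τ + b * p x) w x ^ 2
      - b * (Real.exp (2 * p x) * ∑ j, dd j w x ^ 2)
      - b * (τ + b * p x - (n - 2) / 2) ^ 2 * w x ^ 2) := by
  have hA := hp.integral_conjLap_mul_antisymm hw hwc hwU τ b
  have hB := hp.integral_conjLap_mul_self hw hwc hwU τ b
  have c1 : Continuous p := hp.contDiff.continuous
  have c2 : Continuous (euler x₀ w) := (contDiff_euler hw).continuous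
  have c3 : ∀ j, Continuous (dd j w) := fun j => (contDiff_dd (k := 1) hw (by norm_num)).continuous
  have c4 : Continuous w := hw.continuous
  have c5 := hp.continuous_conjLap hw τ b
  have z1 : ∀ x ∉ tsupport w, ∀ i, dd i w x = 0 := fun x h i => dd_eq_zero_of_notMem h
  have z2 : ∀ x ∉ tsupport w, w x = 0 := fun x h => image_eq_zero_of_notMem_tsupport h
  have z3 : ∀ x ∉ tsupport w, euler x₀ w x = 0 := fun x h => by
    rw [euler_eq_sum]; simp [z1 x h]
  have z4 : ∀ x ∉ tsupport w, conjLap x₀ p b (τ + b * p x) w x = 0 := fun x h =>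
    conjLap_eq_zero h b _
  set A : E n → ℝ := fun x => Real.exp (-n * p x) * (conjLap x₀ p b (τ + b * p x) w x
        * (-2 * (τ + b * p x - (n - 2) / 2) * euler x₀ w x - b * w x)
      - (-2 * (τ + b * p x - (n - 2) / 2) * euler x₀ w x - b * w x) ^ 2
      - 2 * b * euler x₀ w x ^ 2 - 2 * b * (τ + b * p x - (n - 2) / 2) ^ 2 * w x ^ 2) with hAdef
  set B : E n → ℝ := fun x => Real.exp (-n * p x) * (conjLap x₀ p b (τ + b * p x) w x * w x
      + Real.exp (2 * p x) * ∑ j, dd j w x ^ 2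
      - ((τ + b * p x - (n - 2) / 2) ^ 2 - ((n - 2) / 2) ^ 2) * w x ^ 2) with hBdef
  have iA : Integrable A := by
    refine Continuous.integrable_of_hasCompactSupport (by fun_prop)
      (HasCompactSupport.intro hwc fun x hx => ?_)
    simp [hAdef, z2 x hx, z3 x hx]
  have iB : Integrable B := by
    refine Continuous.integrable_of_hasCompactSupport (by fun_prop)
      (HasCompactSupport.intro hwc fun x hx => ?_)
    simp [hBdef, z2 x hx, z1 x hx]
  have key : ∫ x, (2 * A x - b * B x) = 0 := by
    rw [integral_sub (iA.const_mul 2) (iB.const_mul b), integral_const_mul, integral_const_mul,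
      hA, hB]
    simp
  rw [← key]
  refine integral_mono ((iA.const_mul 2).sub (iB.const_mul b)) ?_ fun x => ?_
  · refine Continuous.integrable_of_hasCompactSupport (by fun_prop)
      (HasCompactSupport.intro hwc fun x hx => ?_)
    simp [z2 x hx, z1 x hx, z4 x hx]
  · by_cases hx : x ∈ tsupport w
    · have hμx := hμ x (hwU hx)
      simp only [hAdef, hBdef]
      set μ := τ + b * p x - (n - 2) / 2
      set κ : ℝ := (n - 2) / 2
      set f := conjLap x₀ p b (τ + b * p x) w x
      set G := Real.exp (2 * p x) * ∑ j, dd j w x ^ 2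
      set T := -2 * μ * euler x₀ w x - b * w x
      have hE := (Real.exp_pos (-n * p x)).le
      -- Two completed squares, 2fT - 2T² ≤ f²/2 and -bfw ≤ f²/2 + b²w²/2, use up exactly one f². Of
      -- the -4bμ²w² available, bμ²w² pays for the gradient identity and at most bμ²w²/2 for the
      -- second square.
      have : 2 * (f * T - T ^ 2 - 2 * b * euler x₀ w x ^ 2 - 2 * b * μ ^ 2 * w x ^ 2)
          - b * (f * w x + G - (μ ^ 2 - κ ^ 2) * w x ^ 2)
          ≤ f ^ 2 - b * G - b * μ ^ 2 * w x ^ 2 := by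
        have h1 := sq_nonneg (f - 2 * T)
        have h2 := sq_nonneg (f + b * w x)
        have h3 : b * (b * w x ^ 2) ≤ b * (μ ^ 2 * w x ^ 2) :=
          mul_le_mul_of_nonneg_left (mul_le_mul_of_nonneg_right hμx (sq_nonneg _)) hb.le
        have h4 : 0 ≤ b * euler x₀ w x ^ 2 := by positivity
        have h5 : 0 ≤ b * κ ^ 2 * w x ^ 2 := by positivity
        have h6 : 0 ≤ b * (μ ^ 2 * w x ^ 2) := by positivity
        nlinarith
      calc _ = Real.exp (-n * p x)
            * (2 * (f * T - T ^ 2 - 2 * b * euler x₀ w x ^ 2 - 2 * b * μ ^ 2 * w x ^ 2)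
              - b * (f * w x + G - (μ ^ 2 - κ ^ 2) * w x ^ 2)) := by ring
        _ ≤ _ := mul_le_mul_of_nonneg_left this hE
    · simp [hAdef, hBdef, z1 x hx, z2 x hx, z3 x hx, z4 x hx]

theorem dd_dd_eq (hp : IsLogWeight x₀ U M p) (hx : x ∈ U) (j : Fin n) :
    dd j (dd j p) x = Real.exp (-2 * p x)
      - 2 * Real.exp (-2 * p x) ^ 2 * (x j - x₀ j) ^ 2 := by
  have h : dd j p =ᶠ[nhds x] fun y => Real.exp (-2 * p y) * (y j - x₀ j) := by
    filter_upwards [hp.isOpen.mem_nhds hx] with y hy using hp.dd_eq y hy j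
  rw [dd_congr h, dd_mul ((hp.contDiff_exp _).differentiable (by simp) x)
    ((contDiff_coord_sub (k := 1) j).differentiable (by norm_num) x), hp.dd_exp, dd_coord_sub,
    if_pos rfl, hp.dd_eq x hx]
  ring

section

variable {v : E n → ℝ} {τ b : ℝ}

theorem dd_exp_mul (hp : IsLogWeight x₀ U M p) (hv : DifferentiableAt ℝ v x) (j : Fin n) :
    dd j (fun y => Real.exp (τ * p y + b / 2 * p y ^ 2) * v y) x
      = Real.exp (τ * p x + b / 2 * p x ^ 2) * ((τ + b * p x) * dd j p x * v x + dd j v x) := by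
  have hd := hp.differentiableAt (x := x)
  have h1 : DifferentiableAt ℝ (fun y => τ * p y + b / 2 * p y ^ 2) x := by fun_prop
  rw [dd_mul (by fun_prop) hv, dd_rexp h1, dd_add (by fun_prop) (by fun_prop),
    dd_const_mul _ hd, dd_const_mul _ (hd.fun_pow 2), dd_pow hd]
  norm_num
  ring

/-- Chain rule for a weight that is a function of p alone: σ = τp + bp²/2 has σ' = τ + bp and σ'' =
b, and the n in the coefficients comes from summing the trace part of the Hessian of p. -/
theorem conjLap_exp_mul (hp : IsLogWeight x₀ U M p) (hx : x ∈ U) (hv : ContDiff ℝ 2 v) :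
    conjLap x₀ p b (τ + b * p x) (fun y => Real.exp (τ * p y + b / 2 * p y ^ 2) * v y) x
      = Real.exp (2 * p x) * Real.exp (τ * p x + b / 2 * p x ^ 2) * ∑ j, dd j (dd j v) x := by
  have hd := hp.differentiableAt (x := x)
  have hv1 : ∀ y, DifferentiableAt ℝ v y := fun y => hv.differentiable (by norm_num) y
  have hvj : ∀ j, DifferentiableAt ℝ (dd j v) x := fun j =>
    (contDiff_dd (k := 1) hv (by norm_num)).differentiable (by norm_num) x
  have hpj : ∀ j, DifferentiableAt ℝ (dd j p) x := fun j =>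
    (contDiff_dd (k := 1) (m := 2) (by exact_mod_cast contDiff_infty.1 hp.contDiff 2) (by norm_num)).differentiable (by norm_num) x
  have hdj : ∀ j, dd j (fun y => Real.exp (τ * p y + b / 2 * p y ^ 2) * v y)
      = fun y => Real.exp (τ * p y + b / 2 * p y ^ 2)
        * ((τ + b * p y) * dd j p y * v y + dd j v y) :=
    fun j => funext fun y => hp.dd_exp_mul (hv1 y) j
  set e := Real.exp (τ * p x + b / 2 * p x ^ 2) with he
  set s := τ + b * p x with hs
  have hg : ∀ j, DifferentiableAt ℝ (fun y => (τ + b * p y) * dd j p y * v y) x := fun j =>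
    (((hd.const_mul b).const_add τ).fun_mul (hpj j)).fun_mul (hv1 x)
  have hjj : ∀ j, dd j (dd j (fun y => Real.exp (τ * p y + b / 2 * p y ^ 2) * v y)) x
      = e * (s * dd j p x * (s * dd j p x * v x + dd j v x)
        + (b * dd j p x * dd j p x * v x + s * dd j (dd j p) x * v x + s * dd j p x * dd j v x)
        + dd j (dd j v) x) := by
    intro j
    rw [hdj, hp.dd_exp_mul ((hg j).fun_add (hvj j)), dd_add (hg j) (hvj j),
      dd_mul (((hd.const_mul b).const_add τ).fun_mul (hpj j)) (hv1 x),
      dd_mul ((hd.const_mul b).const_add τ) (hpj j), dd_add (by fun_prop) (hd.const_mul b),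
      dd_const_mul _ hd, dd_const]
    ring
  have hX : euler x₀ (fun y => Real.exp (τ * p y + b / 2 * p y ^ 2) * v y) x
      = e * (s * v x + euler x₀ v x) := by
    rw [euler_eq_sum, euler_eq_sum]
    simp only [hdj]
    have h1 := hp.euler_eq_one hx
    rw [euler_eq_sum] at h1
    have : ∀ j, (x j - x₀ j) * (e * (s * dd j p x * v x + dd j v x))
        = e * s * v x * ((x j - x₀ j) * dd j p x) + e * ((x j - x₀ j) * dd j v x) := fun j => by
      ring
    rw [Finset.sum_congr rfl fun j _ => this j, Finset.sum_add_distrib, ← Finset.mul_sum,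
      ← Finset.mul_sum, h1]
    ring
  have h2 : Real.exp (2 * p x) * Real.exp (-2 * p x) = 1 := by rw [← Real.exp_add]; simp
  have hL : ∑ j, dd j (dd j (fun y => Real.exp (τ * p y + b / 2 * p y ^ 2) * v y)) x
      = e * (∑ j, dd j (dd j v) x + Real.exp (-2 * p x) * ((s ^ 2 + b + (n - 2) * s) * v x
        + 2 * s * euler x₀ v x)) := by
    have : ∀ j, dd j (dd j (fun y => Real.exp (τ * p y + b / 2 * p y ^ 2) * v y)) x
      = e * dd j (dd j v) x
        + e * Real.exp (-2 * p x) ^ 2 * (s ^ 2 + b - 2 * s) * v x * (x j - x₀ j) ^ 2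
        + e * Real.exp (-2 * p x) * s * v x
        + 2 * e * s * Real.exp (-2 * p x) * ((x j - x₀ j) * dd j v x) := by
      intro j
      rw [hjj, hp.dd_eq x hx, hp.dd_dd_eq hx]
      ring
    simp only [this, Finset.sum_add_distrib, ← Finset.mul_sum, ← euler_eq_sum, hp.sum_sq x hx,
      Finset.sum_const, Finset.card_univ, Fintype.card_fin, nsmul_eq_mul]
    linear_combination (e * Real.exp (-2 * p x) * (s ^ 2 + b - 2 * s) * v x) * h2
  rw [conjLap, hL, hX]
  linear_combination (e * ((s ^ 2 + b + (n - 2) * s) * v x + 2 * s * euler x₀ v x)) * h2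

end

end IsLogWeight

/-- Passage from w = e^σ v back to v at one point, with m = e^{-np} and X = e^{2p} in the
application. The constant c bounds the powers of e^p that occur, once from above and once from
below, hence c². The 12 is 8 + 4: at most 8μ²w² arises from ∇v = e^{-σ}(∇w - s w∇p), and 4μ²w² from
τ²w². -/
theorem carleman_pointwise {c m X Y e S W L b s μ τ v w : ℝ} (hc : 0 < c) (hm : 0 < m)
    (hX : 0 < X) (hb : 0 < b) (hS : 0 ≤ S) (hW : 0 ≤ W)
    (hgrad : e ^ 2 * S ≤ 2 * W + 2 * s ^ 2 * Y * w ^ 2) (einv : X * Y = 1)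
    (hsμ : s ^ 2 ≤ 4 * μ ^ 2) (hτμ : τ ^ 2 ≤ 4 * μ ^ 2) (hw2 : w ^ 2 = e ^ 2 * v ^ 2)
    (hb1 : m * X ^ 2 ≤ c) (hb2 : 1 ≤ c * (m * X)) (hb3 : 1 ≤ c * m) :
    12 * c * (m * ((X * e * L) ^ 2 - b * (X * W) - b * μ ^ 2 * w ^ 2))
      ≤ e ^ 2 * (12 * c ^ 2 * L ^ 2 - b * (S + τ ^ 2 * v ^ 2)) := by
  have hgrad' : X * (e ^ 2 * S) ≤ 2 * (X * W) + 8 * (μ ^ 2 * w ^ 2) := by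
    have h6 := mul_le_mul_of_nonneg_left hgrad hX.le
    have h7 : X * (2 * W + 2 * s ^ 2 * Y * w ^ 2) = 2 * (X * W) + 2 * (s ^ 2 * w ^ 2) := by
      linear_combination (2 * s ^ 2 * w ^ 2) * einv
    have h8 : s ^ 2 * w ^ 2 ≤ 4 * μ ^ 2 * w ^ 2 := mul_le_mul_of_nonneg_right hsμ (sq_nonneg _)
    rw [h7] at h6
    linarith
  have h9 : τ ^ 2 * w ^ 2 ≤ 4 * μ ^ 2 * w ^ 2 := mul_le_mul_of_nonneg_right hτμ (sq_nonneg _)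
  have hW0 : 0 ≤ X * W := mul_nonneg hX.le hW
  have hμw : 0 ≤ μ ^ 2 * w ^ 2 := by positivity
  have h10 : X * (e ^ 2 * S) + τ ^ 2 * w ^ 2 ≤ 12 * (X * W + μ ^ 2 * w ^ 2) := by linarith
  have h11 : e ^ 2 * (S + τ ^ 2 * v ^ 2) ≤ c * m * (X * (e ^ 2 * S) + τ ^ 2 * w ^ 2) := by
    have g1 := mul_le_mul_of_nonneg_right hb2 (by positivity : 0 ≤ e ^ 2 * S)
    have g2 := mul_le_mul_of_nonneg_right hb3 (by positivity : 0 ≤ τ ^ 2 * w ^ 2)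
    have g3 : e ^ 2 * (S + τ ^ 2 * v ^ 2) = 1 * (e ^ 2 * S) + 1 * (τ ^ 2 * w ^ 2) := by
      rw [hw2]; ring
    have g4 : c * m * (X * (e ^ 2 * S) + τ ^ 2 * w ^ 2)
        = c * (m * X) * (e ^ 2 * S) + c * m * (τ ^ 2 * w ^ 2) := by ring
    rw [g3, g4]
    exact add_le_add g1 g2
  have h12 := mul_le_mul_of_nonneg_right hb1 (by positivity : 0 ≤ c * (e ^ 2 * L ^ 2))
  have h13 := mul_le_mul_of_nonneg_left h10 (by positivity : 0 ≤ c * m)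
  have h14 := mul_le_mul_of_nonneg_left (h11.trans h13) hb.le
  have e1 : e ^ 2 * (12 * c ^ 2 * L ^ 2 - b * (S + τ ^ 2 * v ^ 2))
      = 12 * (c * (c * (e ^ 2 * L ^ 2))) - b * (e ^ 2 * (S + τ ^ 2 * v ^ 2)) := by ring
  have e2 : 12 * c * (m * ((X * e * L) ^ 2 - b * (X * W) - b * μ ^ 2 * w ^ 2))
      = 12 * (m * X ^ 2 * (c * (e ^ 2 * L ^ 2)))
        - b * (c * m * (12 * (X * W + μ ^ 2 * w ^ 2))) := by ring
  rw [e1, e2]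
  linarith

/-- Choice of the convexification parameter: b exceeds what the first order perturbation produces in
front of the gradient and, as V ≤ τ²V, in front of the zeroth order term; a full τ²V remains. -/
theorem carleman_absorb {c n K b τ S V L D : ℝ} (hc : 0 ≤ c) (hn : 0 ≤ n) (hS : 0 ≤ S)
    (hV : 0 ≤ V) (hτ : 1 ≤ τ ^ 2) (hb : b = 3 * c * (n + 1) * K ^ 2 + 1)
    (hD : D ≤ 3 * (L + n * K ^ 2 * S + K ^ 2 * V)) :
    c * D - b * (S + τ ^ 2 * V) ≤ 3 * c * L - τ ^ 2 * V := by
  have g1 := mul_le_mul_of_nonneg_left hD hc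
  have g2 : 0 ≤ c * K ^ 2 * S := by positivity
  have g3 : c * K ^ 2 * V ≤ c * K ^ 2 * (τ ^ 2 * V) := by
    have : V ≤ τ ^ 2 * V := by nlinarith
    gcongr
  have g4 : 0 ≤ n * (c * K ^ 2 * (τ ^ 2 * V)) := by positivity
  have g5 : b * (S + τ ^ 2 * V) = 3 * (n * (c * K ^ 2 * S)) + 3 * (c * K ^ 2 * S) + S
      + (3 * (n * (c * K ^ 2 * (τ ^ 2 * V))) + 3 * (c * K ^ 2 * (τ ^ 2 * V)) + τ ^ 2 * V) := by
    rw [hb]; ring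
  rw [g5]
  nlinarith

/-! ### Removal of the conjugation; complex-valued functions -/

namespace IsLogWeight

variable {n : ℕ} {x₀ x : E n} {U : Set (E n)} {M : ℝ} {p : E n → ℝ}

theorem exp_mul_bounds (hp : IsLogWeight x₀ U M p) (hx : x ∈ U) {k N : ℝ} (hk : |k| ≤ N) :
    Real.exp (k * p x) ≤ Real.exp (N * M) ∧ 1 ≤ Real.exp (N * M) * Real.exp (k * p x) := by
  have h : |k * p x| ≤ N * M := by
    rw [abs_mul]
    exact mul_le_mul hk (hp.bound x hx) (abs_nonneg _) ((abs_nonneg _).trans hk)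
  have h' := abs_le.1 h
  refine ⟨Real.exp_le_exp.2 h'.2, ?_⟩
  rw [← Real.exp_add]
  exact Real.one_le_exp (by linarith)

/-- The Carleman estimate for the Laplacian with the convexified logarithmic weight
`τ p + b p² / 2`. -/
theorem integral_exp_laplacian_ge (hp : IsLogWeight x₀ U M p) (hM : 0 ≤ M) {v : E n → ℝ}
    (hv : ContDiff ℝ 2 v) (hvc : HasCompactSupport v) (hvU : tsupport v ⊆ U) {τ b : ℝ}
    (hb : 0 < b) (hτ : 2 * b * (M + 1) + n + 2 ≤ τ) :
    0 ≤ ∫ x, Real.exp (τ * p x + b / 2 * p x ^ 2) ^ 2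
      * (12 * Real.exp ((n + 4) * M) ^ 2 * (∑ j, dd j (dd j v) x) ^ 2
        - b * (∑ j, dd j v x ^ 2 + τ ^ 2 * v x ^ 2)) := by
  set e : E n → ℝ := fun y => Real.exp (τ * p y + b / 2 * p y ^ 2) with he
  set w : E n → ℝ := fun y => e y * v y with hw
  have hpc2 : ContDiff ℝ 2 p := by exact_mod_cast contDiff_infty.1 hp.contDiff 2
  have hec : ContDiff ℝ 2 e :=
    Real.contDiff_exp.comp ((contDiff_const.mul hpc2).add (contDiff_const.mul (hpc2.pow 2)))
  have hwc2 : ContDiff ℝ 2 w := hec.mul hv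
  have hwc : HasCompactSupport w := hvc.mul_left
  have hwv : tsupport w ⊆ tsupport v := tsupport_mul_subset_right
  have hn0 : (0 : ℝ) ≤ n := Nat.cast_nonneg n
  -- The threshold for τ dominates |bp| ≤ bM and the shift (n - 2)/2, so μ, s and τ are comparable
  -- on U; it also gives μ ≥ τ/2 ≥ max(1, b), whence b ≤ μ².
  have hs : ∀ x ∈ U, τ / 2 ≤ τ + b * p x - (n - 2) / 2 ∧ 0 ≤ τ + b * p x
      ∧ τ + b * p x ≤ 2 * (τ + b * p x - (n - 2) / 2) ∧ 1 ≤ τ / 2 ∧ b ≤ τ / 2 := by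
    intro x hx
    have h1 := abs_le.1 (hp.bound x hx)
    have h2 : -(b * M) ≤ b * p x := by nlinarith
    have h3 : 0 ≤ b * M := by positivity
    refine ⟨?_, ?_, ?_, ?_, ?_⟩ <;> linarith
  have hμ : ∀ x ∈ U, b ≤ (τ + b * p x - (n - 2) / 2) ^ 2 := by
    intro x hx
    obtain ⟨h1, h2, h3, h4, h5⟩ := hs x hx
    nlinarith
  have hD := hp.integral_conjLap_sq_ge hwc2 hwc (hwv.trans hvU) hb hμ
  set c := Real.exp ((n + 4) * M) with hc
  have hc0 : 0 < c := Real.exp_pos _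
  have c1 : Continuous p := hp.contDiff.continuous
  have c3 : ∀ j, Continuous (dd j w) := fun j =>
    (contDiff_dd (k := 1) hwc2 (by norm_num)).continuous
  have c4 : Continuous w := hwc2.continuous
  have c5 := hp.continuous_conjLap hwc2 τ b
  have c6 : ∀ j, Continuous (dd j v) := fun j => (contDiff_dd (k := 1) hv (by norm_num)).continuous
  have c7 : ∀ j, Continuous (dd j (dd j v)) := fun j =>
    (contDiff_dd (k := 0) (contDiff_dd (k := 1) hv (by norm_num)) (by norm_num)).continuous
  have c8 : Continuous v := hv.continuous
  have c9 : Continuous e := hec.continuous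
  have z1 : ∀ x ∉ tsupport v, ∀ i, dd i v x = 0 := fun x h i => dd_eq_zero_of_notMem h
  have z2 : ∀ x ∉ tsupport v, v x = 0 := fun x h => image_eq_zero_of_notMem_tsupport h
  have z3 : ∀ x ∉ tsupport v, ∀ i, dd i (dd i v) x = 0 := fun x h i =>
    dd_eq_zero_of_notMem fun h' => h (tsupport_dd_subset v h')
  have z4 : ∀ x ∉ tsupport v, conjLap x₀ p b (τ + b * p x) w x = 0 := fun x h =>
    conjLap_eq_zero (fun h' => h (hwv h')) b _
  have z5 : ∀ x ∉ tsupport v, ∀ i, dd i w x = 0 := fun x h i =>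
    dd_eq_zero_of_notMem fun h' => h (hwv h')
  have key := mul_nonneg (by positivity : (0 : ℝ) ≤ 12 * c) hD
  rw [← integral_const_mul] at key
  refine key.trans (integral_mono ?_ ?_ fun x => ?_)
  · refine Continuous.integrable_of_hasCompactSupport (by fun_prop)
      (HasCompactSupport.intro hvc fun x hx => ?_)
    simp only [z4 x hx, z5 x hx, show w x = 0 by simp [hw, z2 x hx]]
    simp
  · refine Continuous.integrable_of_hasCompactSupport (by fun_prop)
      (HasCompactSupport.intro hvc fun x hx => ?_)
    simp [z1 x hx, z2 x hx, z3 x hx]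
  · by_cases hx : x ∈ tsupport v
    · have hxU := hvU hx
      obtain ⟨h1, h2, h3, h4, h5⟩ := hs x hxU
      have hf : conjLap x₀ p b (τ + b * p x) w x = _ := hp.conjLap_exp_mul hxU hv
      have hwj : ∀ j, e x * dd j v x
          = dd j w x - (τ + b * p x) * (Real.exp (-2 * p x) * (x j - x₀ j)) * w x := by
        intro j
        have := hp.dd_exp_mul (x := x) (τ := τ) (b := b) (hv.differentiable (by norm_num) x) j
        simp only [hw]
        rw [show dd j (fun y => e y * v y) x = _ from this, hp.dd_eq x hxU]
        simp only [he]
        ring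
      have hb1 := (hp.exp_mul_bounds hxU (k := 4 - n) (N := n + 4)
        (abs_le.2 ⟨by linarith, by linarith⟩)).1
      have hb2 := (hp.exp_mul_bounds hxU (k := 2 - n) (N := n + 4)
        (abs_le.2 ⟨by linarith, by linarith⟩)).2
      have hb3 := (hp.exp_mul_bounds hxU (k := -n) (N := n + 4)
        (abs_le.2 ⟨by linarith, by linarith⟩)).2
      rw [← hc] at hb1 hb2 hb3
      have e4 : Real.exp ((4 - n) * p x) = Real.exp (-n * p x) * Real.exp (2 * p x) ^ 2 := by
        rw [sq, ← Real.exp_add, ← Real.exp_add]; ring_nf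
      have e2 : Real.exp ((2 - n) * p x) = Real.exp (-n * p x) * Real.exp (2 * p x) := by
        rw [← Real.exp_add]; ring_nf
      rw [e4] at hb1
      rw [e2] at hb2
      have einv : Real.exp (2 * p x) * Real.exp (-2 * p x) = 1 := by rw [← Real.exp_add]; simp
      set s := τ + b * p x with hs
      set μ := s - (n - 2) / 2 with hμ
      set m := Real.exp (-n * p x) with hm
      set X := Real.exp (2 * p x) with hX
      set Y := Real.exp (-2 * p x) with hY
      have hm0 : 0 < m := Real.exp_pos _
      have hX0 : 0 < X := Real.exp_pos _
      have hY0 : 0 < Y := Real.exp_pos _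
      set S := ∑ j, dd j v x ^ 2 with hS
      set W := ∑ j, dd j w x ^ 2 with hW
      set Lv := ∑ j, dd j (dd j v) x with hLv
      have hS0 : 0 ≤ S := Finset.sum_nonneg fun _ _ => sq_nonneg _
      have hsμ : s ^ 2 ≤ 4 * μ ^ 2 := (pow_le_pow_left₀ h2 h3 2).trans_eq (by ring)
      have hτμ : τ ^ 2 ≤ 4 * μ ^ 2 :=
        (pow_le_pow_left₀ (by linarith) (by linarith : τ ≤ 2 * μ) 2).trans_eq (by ring)
      have hw2 : w x ^ 2 = e x ^ 2 * v x ^ 2 := by simp only [hw]; ring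
      have hgrad : e x ^ 2 * S ≤ 2 * W + 2 * s ^ 2 * Y * w x ^ 2 := by
        have hsum : ∑ j, (2 * dd j w x ^ 2 + 2 * s ^ 2 * Y ^ 2 * w x ^ 2 * (x j - x₀ j) ^ 2)
            = 2 * W + 2 * s ^ 2 * Y * w x ^ 2 := by
          rw [Finset.sum_add_distrib, ← Finset.mul_sum, ← Finset.mul_sum, hp.sum_sq x hxU, ← hX]
          linear_combination (2 * s ^ 2 * Y * w x ^ 2) * einv
        rw [← hsum, hS, Finset.mul_sum]
        refine Finset.sum_le_sum fun j _ => ?_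
        have : e x ^ 2 * dd j v x ^ 2 = (e x * dd j v x) ^ 2 := by ring
        rw [this, hwj]
        have h6 := sq_nonneg (dd j w x + s * (Y * (x j - x₀ j)) * w x)
        generalize dd j w x = a at h6 ⊢
        linarith [h6, show (a - s * (Y * (x j - x₀ j)) * w x) ^ 2
          = 2 * a ^ 2 + 2 * s ^ 2 * Y ^ 2 * w x ^ 2 * (x j - x₀ j) ^ 2
            - (a + s * (Y * (x j - x₀ j)) * w x) ^ 2 by ring]
      have hfe : conjLap x₀ p b s w x = X * e x * Lv := hf
      rw [hfe]
      exact carleman_pointwise hc0 hm0 hX0 hb hS0 (Finset.sum_nonneg fun _ _ => sq_nonneg _)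
        hgrad einv hsμ hτμ hw2 hb1 hb2 hb3
    · simp only [z1 x hx, z2 x hx, z3 x hx, z4 x hx, z5 x hx, show w x = 0 by simp [hw, z2 x hx]]
      simp

/-- Laplacian and weight are real, so the real estimate applies to Re v and Im v separately, and the
two are added. -/
theorem integral_exp_laplacian_complex_ge (hp : IsLogWeight x₀ U M p) (hM : 0 ≤ M) {v : E n → ℂ}
    (hv : ContDiff ℝ 2 v) (hvc : HasCompactSupport v) (hvU : tsupport v ⊆ U) {τ b : ℝ}
    (hb : 0 < b) (hτ : 2 * b * (M + 1) + n + 2 ≤ τ) :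
    0 ≤ ∫ x, Real.exp (τ * p x + b / 2 * p x ^ 2) ^ 2
      * (12 * Real.exp ((n + 4) * M) ^ 2 * ‖∑ j, dd j (dd j v) x‖ ^ 2
        - b * (∑ j, ‖dd j v x‖ ^ 2 + τ ^ 2 * ‖v x‖ ^ 2)) := by
  have hdv : ∀ y, DifferentiableAt ℝ v y := fun y => hv.differentiable (by norm_num) y
  have hdvj : ∀ j y, DifferentiableAt ℝ (dd j v) y := fun j y =>
    (contDiff_dd (k := 1) hv (by norm_num)).differentiable (by norm_num) y
  have part : ∀ L : ℂ →L[ℝ] ℝ,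
      (0 ≤ ∫ x, Real.exp (τ * p x + b / 2 * p x ^ 2) ^ 2
        * (12 * Real.exp ((n + 4) * M) ^ 2 * (L (∑ j, dd j (dd j v) x)) ^ 2
          - b * (∑ j, L (dd j v x) ^ 2 + τ ^ 2 * L (v x) ^ 2)))
      ∧ Integrable (fun x => Real.exp (τ * p x + b / 2 * p x ^ 2) ^ 2
        * (12 * Real.exp ((n + 4) * M) ^ 2 * (L (∑ j, dd j (dd j v) x)) ^ 2
          - b * (∑ j, L (dd j v x) ^ 2 + τ ^ 2 * L (v x) ^ 2))) := by
    intro L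
    have hts : tsupport (fun y => L (v y)) ⊆ tsupport v :=
      closure_mono fun x hx hx' => hx (by simp [hx'])
    have h1 : ∀ j, dd j (fun y => L (v y)) = fun y => L (dd j v y) := fun j =>
      funext fun y => dd_clm_comp L (hdv y)
    have h2 : ∀ j, dd j (fun y => L (dd j v y)) = fun y => L (dd j (dd j v) y) := fun j =>
      funext fun y => dd_clm_comp L (hdvj j y)
    have h3 := hp.integral_exp_laplacian_ge hM (v := fun y => L (v y)) (L.contDiff.comp hv)
      (hvc.of_isClosed_subset (isClosed_tsupport _) hts) (hts.trans hvU) hb hτ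
    simp only [h1, h2, ← map_sum] at h3
    refine ⟨h3, ?_⟩
    have c1 : Continuous p := hp.contDiff.continuous
    have c6 : ∀ j, Continuous (dd j v) := fun j =>
      (contDiff_dd (k := 1) hv (by norm_num)).continuous
    have c7 : ∀ j, Continuous (dd j (dd j v)) := fun j =>
      (contDiff_dd (k := 0) (contDiff_dd (k := 1) hv (by norm_num)) (by norm_num)).continuous
    have c8 : Continuous v := hv.continuous
    refine Continuous.integrable_of_hasCompactSupport (by fun_prop)
      (HasCompactSupport.intro hvc fun x hx => ?_)
    have z1 : ∀ i, dd i v x = 0 := fun i => dd_eq_zero_of_notMem hx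
    have z2 : v x = 0 := image_eq_zero_of_notMem_tsupport hx
    have z3 : ∀ i, dd i (dd i v) x = 0 := fun i =>
      dd_eq_zero_of_notMem fun h' => hx (tsupport_dd_subset v h')
    simp [z1, z2, z3]
  obtain ⟨a1, i1⟩ := part Complex.reCLM
  obtain ⟨a2, i2⟩ := part Complex.imCLM
  have := add_nonneg a1 a2
  rw [← integral_add i1 i2] at this
  refine this.trans_eq (integral_congr_ae (Filter.Eventually.of_forall fun x => ?_))
  simp only [Complex.sq_norm, Complex.normSq_apply, Complex.reCLM_apply, Complex.imCLM_apply,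
    Finset.sum_add_distrib, ← sq]
  ring

end IsLogWeight

/-- The first order perturbation `-Δv + ∑ β_j ∂_j v + γ v` of the Laplacian. -/
def ellOp {n : ℕ} (β : Fin n → E n → ℂ) (γ : E n → ℂ) (v : E n → ℂ) (x : E n) : ℂ :=
  -(∑ j, dd j (dd j v) x) + ∑ j, β j x * dd j v x + γ x * v x

/-! ### First order perturbations of the Laplacian with bounded coefficients -/

section ellOp

variable {n : ℕ} {β : Fin n → E n → ℂ} {γ : E n → ℂ} {v : E n → ℂ} {x : E n} {K : ℝ}

theorem ellOp_eq_zero (h : x ∉ tsupport v) : ellOp β γ v x = 0 := by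
  have z1 : ∀ i, dd i v x = 0 := fun i => dd_eq_zero_of_notMem h
  have z2 : v x = 0 := image_eq_zero_of_notMem_tsupport h
  have z3 : ∀ i, dd i (dd i v) x = 0 := fun i =>
    dd_eq_zero_of_notMem fun h' => h (tsupport_dd_subset v h')
  simp [ellOp, z1, z2, z3]

theorem aestronglyMeasurable_ellOp (hβ : ∀ j, AEStronglyMeasurable (β j) volume)
    (hγ : AEStronglyMeasurable γ volume) (hv : ContDiff ℝ 2 v) :
    AEStronglyMeasurable (ellOp β γ v) volume := by
  have c6 : ∀ j, Continuous (dd j v) := fun j =>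
    (contDiff_dd (k := 1) hv (by norm_num)).continuous
  have c7 : ∀ j, Continuous (dd j (dd j v)) := fun j =>
    (contDiff_dd (k := 0) (contDiff_dd (k := 1) hv (by norm_num)) (by norm_num)).continuous
  unfold ellOp
  refine ((continuous_finsetSum _ fun j _ => c7 j).neg.aestronglyMeasurable.add ?_).add
    (hγ.mul hv.continuous.aestronglyMeasurable)
  exact Finset.aestronglyMeasurable_fun_sum _ fun j _ => (hβ j).mul (c6 j).aestronglyMeasurable

theorem exists_bound_ellOp (hβK : ∀ j x, ‖β j x‖ ≤ K) (hγK : ∀ x, ‖γ x‖ ≤ K)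
    (hv : ContDiff ℝ 2 v) (hvc : HasCompactSupport v) : ∃ B, ∀ x, ‖ellOp β γ v x‖ ≤ B := by
  have c6 : ∀ j, Continuous (dd j v) := fun j =>
    (contDiff_dd (k := 1) hv (by norm_num)).continuous
  have c7 : ∀ j, Continuous (dd j (dd j v)) := fun j =>
    (contDiff_dd (k := 0) (contDiff_dd (k := 1) hv (by norm_num)) (by norm_num)).continuous
  have c8 : Continuous v := hv.continuous
  set g : E n → ℝ := fun x => ∑ j, ‖dd j (dd j v) x‖ + ∑ j, K * ‖dd j v x‖ + K * ‖v x‖ with hg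
  have hgc : Continuous g := by fun_prop
  have hgs : HasCompactSupport g := HasCompactSupport.intro hvc fun x hx => by
    have z1 : ∀ i, dd i v x = 0 := fun i => dd_eq_zero_of_notMem hx
    have z2 : v x = 0 := image_eq_zero_of_notMem_tsupport hx
    have z3 : ∀ i, dd i (dd i v) x = 0 := fun i =>
      dd_eq_zero_of_notMem fun h' => hx (tsupport_dd_subset v h')
    simp [hg, z1, z2, z3]
  obtain ⟨B, hB⟩ := hgs.exists_bound_of_continuous hgc
  refine ⟨B, fun x => le_trans ?_ ((le_abs_self _).trans (hB x))⟩
  unfold ellOp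
  refine (norm_add_le _ _).trans (add_le_add ((norm_add_le _ _).trans (add_le_add ?_ ?_)) ?_)
  · rw [norm_neg]; exact norm_sum_le _ _
  · refine (norm_sum_le _ _).trans (Finset.sum_le_sum fun j _ => ?_)
    rw [norm_mul]; exact mul_le_mul_of_nonneg_right (hβK j x) (norm_nonneg _)
  · rw [norm_mul]; exact mul_le_mul_of_nonneg_right (hγK x) (norm_nonneg _)

theorem memLp_mul_ellOp (hβ : ∀ j, AEStronglyMeasurable (β j) volume)
    (hγ : AEStronglyMeasurable γ volume) (hβK : ∀ j x, ‖β j x‖ ≤ K) (hγK : ∀ x, ‖γ x‖ ≤ K)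
    (hv : ContDiff ℝ 2 v) (hvc : HasCompactSupport v) {e : E n → ℂ} (he : Continuous e) :
    MemLp (fun x => e x * ellOp β γ v x) 2 volume := by
  obtain ⟨B, hB⟩ := exists_bound_ellOp hβK hγK hv hvc
  obtain ⟨B', hB'⟩ := hvc.isCompact.exists_bound_of_continuousOn he.continuousOn
  have h0 : Function.support (fun x => e x * ellOp β γ v x) ⊆ tsupport v := by
    intro x hx
    by_contra h
    exact hx (by simp [ellOp_eq_zero h])
  have hm : AEStronglyMeasurable (fun x => e x * ellOp β γ v x) volume :=
    he.aestronglyMeasurable.mul (aestronglyMeasurable_ellOp hβ hγ hv)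
  have : MemLp (fun x => e x * ellOp β γ v x) 2 (volume.restrict (tsupport v)) := by
    have : IsFiniteMeasure (volume.restrict (tsupport v)) :=
      ⟨by rw [Measure.restrict_apply_univ]; exact hvc.isCompact.measure_lt_top⟩
    refine MemLp.of_bound hm.restrict (B' * B) ?_
    refine (ae_restrict_iff' (isClosed_tsupport v).measurableSet).2
      (Filter.Eventually.of_forall fun x hx => ?_)
    rw [norm_mul]
    exact mul_le_mul (hB' x hx) (hB x) (norm_nonneg _) ((norm_nonneg _).trans (hB' x hx))
  have h2 := (memLp_indicator_iff_restrict (isClosed_tsupport v).measurableSet).2 this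
  rwa [indicator_eq_self.2 h0] at h2

end ellOp

/-- The `L²` Carleman estimate with the logarithmic weight for first order perturbations of the
Laplacian with bounded coefficients. -/
theorem IsLogWeight.exists_carleman {n : ℕ} {x₀ : E n} {U : Set (E n)} {M : ℝ} {p : E n → ℝ}
    (hp : IsLogWeight x₀ U M p) (hM : 0 ≤ M) (K : ℝ) :
    ∃ C τ₀ : ℝ, 0 < C ∧ 1 ≤ τ₀ ∧ ∀ (β : Fin n → E n → ℂ) (γ : E n → ℂ),
      (∀ j, AEStronglyMeasurable (β j) volume) → AEStronglyMeasurable γ volume →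
      (∀ j x, ‖β j x‖ ≤ K) → (∀ x, ‖γ x‖ ≤ K) →
      ∀ τ : ℝ, τ₀ ≤ τ → ∀ v : E n → ℂ, ContDiff ℝ 2 v → HasCompactSupport v → tsupport v ⊆ U →
        τ ^ 2 * ∫ x, ‖(Real.exp (τ * p x) : ℂ) * v x‖ ^ 2
          ≤ C * ∫ x, ‖(Real.exp (τ * p x) : ℂ) * ellOp β γ v x‖ ^ 2 := by
  set c := 12 * Real.exp ((n + 4) * M) ^ 2 with hc
  have hc0 : 0 < c := by positivity
  -- The convexification b depends only on n, M and K, not on τ. The 3 comes from the square of a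
  -- sum of three terms, and n + 1 accounts for the n first order terms and the zeroth order one.
  set b : ℝ := 3 * c * (n + 1) * K ^ 2 + 1 with hb
  have hb0 : 1 ≤ b := by
    have : 0 ≤ 3 * c * (n + 1) * K ^ 2 := by positivity
    linarith
  refine ⟨3 * c * Real.exp (b * M ^ 2), 2 * b * (M + 1) + n + 2, by positivity, ?_, ?_⟩
  · have : 0 ≤ 2 * b * (M + 1) := by positivity
    have : (0 : ℝ) ≤ n := Nat.cast_nonneg n
    linarith
  intro β γ hβ hγ hβK hγK τ hτ v hv hvc hvU
  have h1 := hp.integral_exp_laplacian_complex_ge hM hv hvc hvU (by linarith) hτ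
  have hτ1 : 1 ≤ τ := by
    have : 0 ≤ 2 * b * (M + 1) := by positivity
    have : (0 : ℝ) ≤ n := Nat.cast_nonneg n
    linarith
  have c1 : Continuous p := hp.contDiff.continuous
  have c6 : ∀ j, Continuous (dd j v) := fun j =>
    (contDiff_dd (k := 1) hv (by norm_num)).continuous
  have c7 : ∀ j, Continuous (dd j (dd j v)) := fun j =>
    (contDiff_dd (k := 0) (contDiff_dd (k := 1) hv (by norm_num)) (by norm_num)).continuous
  have c8 : Continuous v := hv.continuous
  set e : E n → ℝ := fun x => Real.exp (τ * p x) with he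
  have ce : Continuous e := by fun_prop
  have iL : Integrable (fun x => ‖(e x : ℂ) * ellOp β γ v x‖ ^ 2) volume :=
    (memLp_two_iff_integrable_sq_norm (memLp_mul_ellOp hβ hγ hβK hγK hv hvc
      (Complex.continuous_ofReal.comp ce)).1).1 (memLp_mul_ellOp hβ hγ hβK hγK hv hvc
      (Complex.continuous_ofReal.comp ce))
  have z2 : ∀ x ∉ tsupport v, v x = 0 := fun x h => image_eq_zero_of_notMem_tsupport h
  have iv : Integrable (fun x => ‖(e x : ℂ) * v x‖ ^ 2) volume :=
    Continuous.integrable_of_hasCompactSupport (by fun_prop)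
      (HasCompactSupport.intro hvc fun x hx => by simp [z2 x hx])
  rw [← sub_nonneg, ← integral_const_mul, ← integral_const_mul,
    ← integral_sub (iL.const_mul _) (iv.const_mul _)]
  refine h1.trans (integral_mono ?_ ((iL.const_mul _).sub (iv.const_mul _)) fun x => ?_)
  · refine Continuous.integrable_of_hasCompactSupport (by fun_prop)
      (HasCompactSupport.intro hvc fun x hx => ?_)
    have z1 : ∀ i, dd i v x = 0 := fun i => dd_eq_zero_of_notMem hx
    have z3 : ∀ i, dd i (dd i v) x = 0 := fun i =>
      dd_eq_zero_of_notMem fun h' => hx (tsupport_dd_subset v h')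
    simp [z1, z2 x hx, z3]
  · by_cases hx : x ∈ tsupport v
    · have hxU := hvU hx
      set S := ∑ j, ‖dd j v x‖ ^ 2 with hS
      have hS0 : 0 ≤ S := Finset.sum_nonneg fun _ _ => sq_nonneg _
      have hsum : ‖∑ j, β j x * dd j v x‖ ^ 2 ≤ n * K ^ 2 * S := by
        have h2 : ‖∑ j, β j x * dd j v x‖ ≤ ∑ j, K * ‖dd j v x‖ := by
          refine (norm_sum_le _ _).trans (Finset.sum_le_sum fun j _ => ?_)
          rw [norm_mul]; exact mul_le_mul_of_nonneg_right (hβK j x) (norm_nonneg _)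
        calc ‖∑ j, β j x * dd j v x‖ ^ 2 ≤ (∑ j, K * ‖dd j v x‖) ^ 2 := by gcongr
          _ ≤ n * ∑ j, (K * ‖dd j v x‖) ^ 2 := by
            have := sq_sum_le_card_mul_sum_sq (s := Finset.univ) (f := fun j => K * ‖dd j v x‖)
            simpa using this
          _ = n * K ^ 2 * S := by simp only [mul_pow, ← Finset.mul_sum]; ring
      have hγv : ‖γ x * v x‖ ^ 2 ≤ K ^ 2 * ‖v x‖ ^ 2 := by
        rw [norm_mul, mul_pow]
        have := hγK x
        gcongr
      have hlap : ‖∑ j, dd j (dd j v) x‖ ^ 2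
          ≤ 3 * (‖ellOp β γ v x‖ ^ 2 + n * K ^ 2 * S + K ^ 2 * ‖v x‖ ^ 2) := by
        have e1 : ∑ j, dd j (dd j v) x
            = -ellOp β γ v x + ∑ j, β j x * dd j v x + γ x * v x := by
          unfold ellOp; ring
        have h3 : ‖∑ j, dd j (dd j v) x‖
            ≤ ‖ellOp β γ v x‖ + ‖∑ j, β j x * dd j v x‖ + ‖γ x * v x‖ := by
          rw [e1]
          refine (norm_add_le _ _).trans (add_le_add_left ((norm_add_le _ _).trans ?_) _)
          rw [norm_neg]
        set a1 := ‖ellOp β γ v x‖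
        set a2 := ‖∑ j, β j x * dd j v x‖
        set a3 := ‖γ x * v x‖
        have h4 : ‖∑ j, dd j (dd j v) x‖ ^ 2 ≤ (a1 + a2 + a3) ^ 2 := by gcongr
        nlinarith [sq_nonneg (a1 - a2), sq_nonneg (a1 - a3), sq_nonneg (a2 - a3)]
      have hpx := abs_le.1 (hp.bound x hxU)
      have hsq : p x ^ 2 ≤ M ^ 2 := by nlinarith
      -- The convexifying factor e^{bp²} lies between 1 and e^{bM²}, so it can be dropped at the
      -- price of a constant.
      have hexp : Real.exp (τ * p x + b / 2 * p x ^ 2) ^ 2 = e x ^ 2 * Real.exp (b * p x ^ 2) := by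
        simp only [he, sq, ← Real.exp_add]; ring_nf
      have hq1 : 1 ≤ Real.exp (b * p x ^ 2) := Real.one_le_exp (by positivity)
      have hq2 : Real.exp (b * p x ^ 2) ≤ Real.exp (b * M ^ 2) :=
        Real.exp_le_exp.2 (by gcongr)
      set Q := Real.exp (b * p x ^ 2) with hQ
      set L2 := ‖ellOp β γ v x‖ ^ 2 with hL2
      have hnorm : ∀ z : ℂ, ‖(e x : ℂ) * z‖ ^ 2 = e x ^ 2 * ‖z‖ ^ 2 := by
        intro z
        rw [norm_mul, mul_pow, Complex.norm_real, Real.norm_eq_abs, sq_abs]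
      simp only [hnorm, hexp]
      have hV0 : 0 ≤ ‖v x‖ ^ 2 := sq_nonneg _
      have hL0 : 0 ≤ L2 := sq_nonneg _
      have hτ2 : 1 ≤ τ ^ 2 := one_le_pow₀ hτ1
      have main := carleman_absorb hc0.le (Nat.cast_nonneg n) hS0 hV0 hτ2 hb hlap
      set V2 := ‖v x‖ ^ 2
      set D2 := ‖∑ j, dd j (dd j v) x‖ ^ 2
      calc e x ^ 2 * Q * (c * D2 - b * (S + τ ^ 2 * V2))
          ≤ e x ^ 2 * Q * (3 * c * L2 - τ ^ 2 * V2) := by gcongr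
        _ = e x ^ 2 * (3 * c * (Q * L2)) - e x ^ 2 * (Q * (τ ^ 2 * V2)) := by ring
        _ ≤ e x ^ 2 * (3 * c * (Real.exp (b * M ^ 2) * L2))
            - e x ^ 2 * (1 * (τ ^ 2 * V2)) := by gcongr
        _ = _ := by ring
    · have z1 : ∀ i, dd i v x = 0 := fun i => dd_eq_zero_of_notMem hx
      have z3 : ∀ i, dd i (dd i v) x = 0 := fun i =>
        dd_eq_zero_of_notMem fun h' => hx (tsupport_dd_subset v h')
      simp [z1, z2 x hx, z3, ellOp_eq_zero hx]

/-! ### Duality in `L²` -/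

/-- The norm of `L²(ℝⁿ; ℂ)`, as a function of functions. -/
def l2 {n : ℕ} (f : E n → ℂ) : ℝ := Real.sqrt (∫ x, ‖f x‖ ^ 2)

section l2

variable {n : ℕ} {f g : E n → ℂ}

theorem l2_nonneg (f : E n → ℂ) : 0 ≤ l2 f := Real.sqrt_nonneg _

theorem l2_sq (f : E n → ℂ) : l2 f ^ 2 = ∫ x, ‖f x‖ ^ 2 :=
  Real.sq_sqrt (integral_nonneg fun _ => sq_nonneg _)

theorem norm_toLp_eq_l2 (hf : MemLp f 2 volume) : ‖hf.toLp f‖ = l2 f := by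
  have h : ‖hf.toLp f‖ ^ 2 = l2 f ^ 2 := by
    rw [l2_sq, ← inner_self_eq_norm_sq (𝕜 := ℂ), L2.inner_def, ← integral_re]
    · refine integral_congr_ae ?_
      filter_upwards [hf.coeFn_toLp] with x hx
      rw [hx, inner_self_eq_norm_sq]
    · exact L2.integrable_inner _ _
  exact (pow_left_inj₀ (norm_nonneg _) (l2_nonneg _) two_ne_zero).1 h

theorem inner_toLp (hf : MemLp f 2 volume) (hg : MemLp g 2 volume) :
    inner ℂ (hf.toLp f) (hg.toLp g) = ∫ x, (starRingEnd ℂ) (f x) * g x := by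
  rw [L2.inner_def]
  refine integral_congr_ae ?_
  filter_upwards [hf.coeFn_toLp, hg.coeFn_toLp] with x hx hy
  rw [hx, hy, RCLike.inner_apply, mul_comm]

theorem memLp_conj (hf : MemLp f 2 volume) : MemLp (fun x => (starRingEnd ℂ) (f x)) 2 volume :=
  (Complex.conjLIE.toContinuousLinearEquiv : ℂ →L[ℝ] ℂ).comp_memLp' hf

theorem l2_conj (f : E n → ℂ) : l2 (fun x => (starRingEnd ℂ) (f x)) = l2 f := by
  simp [l2]

theorem norm_integral_mul_le (hf : MemLp f 2 volume) (hg : MemLp g 2 volume) :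
    ‖∫ x, f x * g x‖ ≤ l2 f * l2 g := by
  have h := norm_inner_le_norm (𝕜 := ℂ) ((memLp_conj hf).toLp _) (hg.toLp g)
  rw [inner_toLp, norm_toLp_eq_l2, norm_toLp_eq_l2, l2_conj] at h
  simpa using h

theorem integrable_mul_of_memLp (hf : MemLp f 2 volume) (hg : MemLp g 2 volume) :
    Integrable (fun x => f x * g x) volume :=
  hf.integrable_mul hg

end l2

/-- The bound makes ℓ vanish on ker T, so it descends to a bounded functional on the range of T;
Hahn–Banach extends it with the same norm and Riesz represents it. -/
theorem exists_inner_eq_of_bound {V H : Type*} [AddCommGroup V] [Module ℂ V]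
    [NormedAddCommGroup H] [InnerProductSpace ℂ H] [CompleteSpace H] (T : V →ₗ[ℂ] H)
    (ℓ : V →ₗ[ℂ] ℂ) {K : ℝ} (hK : 0 ≤ K) (h : ∀ v, ‖ℓ v‖ ≤ K * ‖T v‖) :
    ∃ R : H, ‖R‖ ≤ K ∧ ∀ v, inner ℂ R (T v) = ℓ v := by
  have hker : LinearMap.ker T ≤ LinearMap.ker ℓ := by
    intro v hv
    have := h v
    rw [LinearMap.mem_ker.1 hv, norm_zero, mul_zero] at this
    exact norm_le_zero_iff.1 this
  set ℓ' : LinearMap.range T →ₗ[ℂ] ℂ :=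
    ((LinearMap.ker T).liftQ ℓ hker).comp T.quotKerEquivRange.symm.toLinearMap with hℓ'
  have hval : ∀ v, ℓ' ⟨T v, LinearMap.mem_range_self T v⟩ = ℓ v := by
    intro v
    have : T.quotKerEquivRange.symm ⟨T v, LinearMap.mem_range_self T v⟩
        = (LinearMap.ker T).mkQ v := by
      rw [LinearEquiv.symm_apply_eq]
      exact Subtype.ext (LinearMap.quotKerEquivRange_apply_mk T v).symm
    simp only [hℓ', LinearMap.comp_apply, LinearEquiv.coe_coe, this]
    simp
  have hbound : ∀ y : LinearMap.range T, ‖ℓ' y‖ ≤ K * ‖y‖ := by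
    rintro ⟨_, v, rfl⟩
    rw [hval]
    exact h v
  obtain ⟨g, hg1, hg2⟩ := exists_extension_norm_eq (LinearMap.range T) (ℓ'.mkContinuous K hbound)
  refine ⟨(InnerProductSpace.toDual ℂ H).symm g, ?_, fun v => ?_⟩
  · rw [LinearIsometryEquiv.norm_map, hg2]
    exact LinearMap.mkContinuous_norm_le _ hK _
  · rw [InnerProductSpace.toDual_symm_apply]
    have := hg1 ⟨T v, LinearMap.mem_range_self T v⟩
    rw [this]
    exact hval v

/-- The pairing here is bilinear, so the solution is the complex conjugate of the Riesz
representative. -/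
theorem exists_l2_dual {n : ℕ} {V : Type*} [AddCommGroup V] [Module ℂ V]
    (T : V →ₗ[ℂ] (E n → ℂ)) (hT : ∀ v, MemLp (T v) 2 volume) (ℓ : V →ₗ[ℂ] ℂ) {K : ℝ}
    (hK : 0 ≤ K) (h : ∀ v, ‖ℓ v‖ ≤ K * l2 (T v)) :
    ∃ R : E n → ℂ, MemLp R 2 volume ∧ l2 R ≤ K ∧ ∀ v, ∫ x, R x * T v x = ℓ v := by
  set T' : V →ₗ[ℂ] Lp ℂ 2 (volume : Measure (E n)) :=
    { toFun := fun v => (hT v).toLp (T v)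
      map_add' := fun a b => by
        rw [← MemLp.toLp_add (hT a) (hT b)]
        exact MemLp.toLp_congr _ _ (by rw [map_add])
      map_smul' := fun c a => by
        rw [RingHom.id_apply, ← MemLp.toLp_const_smul c (hT a)]
        exact MemLp.toLp_congr _ _ (by rw [map_smul]) } with hT'
  obtain ⟨R, hR1, hR2⟩ := exists_inner_eq_of_bound T' ℓ hK (fun v => by
    have : ‖T' v‖ = l2 (T v) := norm_toLp_eq_l2 (hT v)
    rw [this]; exact h v)
  have hRm : MemLp (R : E n → ℂ) 2 volume := Lp.memLp R
  have hRe : hRm.toLp (R : E n → ℂ) = R := Lp.toLp_coeFn R hRm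
  refine ⟨fun x => (starRingEnd ℂ) (R x), memLp_conj hRm, ?_, fun v => ?_⟩
  · rw [l2_conj, ← norm_toLp_eq_l2 hRm, hRe]; exact hR1
  · rw [← hR2 v, ← inner_toLp hRm (hT v), hRe]; rfl

/-! ### Interior elliptic regularity -/

section elliptic

open scoped SchwartzMap FourierTransform LineDeriv

variable {n : ℕ}

theorem fourier_dd (w : 𝓢(E n, ℂ)) (j : Fin n) (ξ : E n) :
    (𝓕 (∂_{(EuclideanSpace.single j (1 : ℝ) : E n)} w) : 𝓢(E n, ℂ)) ξ
      = 2 * Real.pi * Complex.I * (ξ j : ℂ) * (𝓕 w : 𝓢(E n, ℂ)) ξ := by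
  rw [SchwartzMap.fourier_lineDerivOp_eq, _root_.smul_apply,
    SchwartzMap.smulLeftCLM_apply_apply (by fun_prop)]
  simp [EuclideanSpace.inner_single_right, mul_assoc]

theorem hasTemperateGrowth_resolvent {τ : ℝ} (hτ : 0 < τ) :
    (fun ξ : E n => (τ ^ 2 + 4 * Real.pi ^ 2 * ‖ξ‖ ^ 2)⁻¹).HasTemperateGrowth := by
  have h1 := Function.hasTemperateGrowth_one_add_norm_sq_rpow (H := E n) (-1)
  have h2 : (fun ξ : E n => (2 * Real.pi / τ) • ξ).HasTemperateGrowth :=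
    ((2 * Real.pi / τ) • ContinuousLinearMap.id ℝ (E n)).hasTemperateGrowth
  have h3 := (Function.HasTemperateGrowth.const (E := E n) ((τ ^ 2)⁻¹)).mul (h1.comp h2)
  suffices h : (fun ξ : E n => (τ ^ 2 + 4 * Real.pi ^ 2 * ‖ξ‖ ^ 2)⁻¹)
      = (fun _ => (τ ^ 2)⁻¹) * ((fun x : E n => (1 + ‖x‖ ^ 2) ^ (-1 : ℝ)) ∘
        fun ξ : E n => (2 * Real.pi / τ) • ξ) by
    rw [h]; exact h3
  funext ξ
  simp only [Function.comp_apply, Pi.mul_apply, norm_smul, Real.norm_eq_abs, mul_pow, sq_abs,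
    Real.rpow_neg_one]
  rw [← mul_inv]
  congr 1
  field_simp
  ring

/-- The function w is (τ² - Δ)⁻¹ψ, given by the Fourier multiplier (τ² + 4π²|ξ|²)⁻¹. By Plancherel
the bounds reduce to 2π|ξ_j| ≤ τ⁻¹(τ² + 4π²|ξ|²) and 4π²|ξ_i ξ_j| ≤ τ² + 4π²|ξ|². -/
theorem exists_resolvent {τ : ℝ} (hτ : 0 < τ) (ψ : 𝓢(E n, ℂ)) :
    ∃ w : 𝓢(E n, ℂ), (∀ x, ψ x = τ ^ 2 * w x - ∑ j, dd j (dd j w) x) ∧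
      (∀ j, l2 (dd j w) ≤ τ⁻¹ * l2 ψ) ∧ ∀ i j, l2 (dd i (dd j w)) ≤ l2 ψ := by
  set m : E n → ℝ := fun ξ => (τ ^ 2 + 4 * Real.pi ^ 2 * ‖ξ‖ ^ 2)⁻¹ with hm
  have hmg : m.HasTemperateGrowth := hasTemperateGrowth_resolvent hτ
  set w : 𝓢(E n, ℂ) := 𝓕⁻ (SchwartzMap.smulLeftCLM ℂ m (𝓕 ψ)) with hw
  have hFw : ∀ ξ, (𝓕 w : 𝓢(E n, ℂ)) ξ = (m ξ : ℂ) * (𝓕 ψ : 𝓢(E n, ℂ)) ξ := by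
    intro ξ
    rw [hw, FourierTransform.fourier_fourierInv_eq, SchwartzMap.smulLeftCLM_apply_apply hmg]
    simp
  have hpos : ∀ ξ : E n, 0 < τ ^ 2 + 4 * Real.pi ^ 2 * ‖ξ‖ ^ 2 := fun ξ => by positivity
  set e : Fin n → E n := fun j => EuclideanSpace.single j (1 : ℝ) with he
  have hnorm : ∀ ξ : E n, ‖ξ‖ ^ 2 = ∑ j, ξ j ^ 2 := fun ξ => by
    rw [EuclideanSpace.norm_sq_eq]; simp
  have hcoord : ∀ (ξ : E n) j, ξ j ^ 2 ≤ ‖ξ‖ ^ 2 := fun ξ j => by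
    rw [hnorm]
    exact Finset.single_le_sum (f := fun j => ξ j ^ 2) (fun _ _ => sq_nonneg _) (Finset.mem_univ j)
  have bound : ∀ (u : 𝓢(E n, ℂ)) (c : ℝ), 0 ≤ c →
      (∀ ξ, ‖(𝓕 u : 𝓢(E n, ℂ)) ξ‖ ^ 2 ≤ c ^ 2 * ‖(𝓕 ψ : 𝓢(E n, ℂ)) ξ‖ ^ 2) →
      l2 u ≤ c * l2 ψ := by
    intro u c hc h
    refine le_of_sq_le_sq ?_ (mul_nonneg hc (l2_nonneg _))
    rw [mul_pow, l2_sq, l2_sq, ← SchwartzMap.integral_norm_sq_fourier u,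
      ← SchwartzMap.integral_norm_sq_fourier ψ, ← integral_const_mul]
    have hint : ∀ φ : 𝓢(E n, ℂ), Integrable (fun ξ => ‖φ ξ‖ ^ 2) volume := fun φ =>
      (memLp_two_iff_integrable_sq_norm (φ.memLp 2 volume).1).1 (φ.memLp 2 volume)
    exact integral_mono (hint _) ((hint _).const_mul _) h
  refine ⟨w, fun x => ?_, fun j => ?_, fun i j => ?_⟩
  · have : ψ = ((τ : ℂ) ^ 2) • w - ∑ j, ∂_{e j} (∂_{e j} w) := by
      have hinj : Function.Injective (fun u : 𝓢(E n, ℂ) => 𝓕 u) := fun u u' h => by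
        have := congrArg (fun z : 𝓢(E n, ℂ) => 𝓕⁻ z) h
        simpa using this
      apply hinj
      ext ξ
      have e1 : (𝓕 (((τ : ℂ) ^ 2) • w - ∑ j, ∂_{e j} (∂_{e j} w)) : 𝓢(E n, ℂ))
          = ((τ : ℂ) ^ 2) • 𝓕 w - ∑ j, 𝓕 (∂_{e j} (∂_{e j} w)) := by
        simp only [← FourierTransform.fourierCLM_apply (R := ℂ)]
        rw [map_sub, map_smul, map_sum]
      change (𝓕 ψ : 𝓢(E n, ℂ)) ξ
        = (𝓕 (((τ : ℂ) ^ 2) • w - ∑ j, ∂_{e j} (∂_{e j} w)) : 𝓢(E n, ℂ)) ξ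
      rw [e1]
      simp only [_root_.sub_apply, _root_.smul_apply, _root_.sum_apply, he,
        fourier_dd, hFw]
      have e2 : ∀ j : Fin n, 2 * (Real.pi : ℂ) * Complex.I * (ξ j : ℂ)
          * (2 * (Real.pi : ℂ) * Complex.I * (ξ j : ℂ) * ((m ξ : ℂ) * (𝓕 ψ : 𝓢(E n, ℂ)) ξ))
          = -(4 * (Real.pi : ℂ) ^ 2 * (m ξ : ℂ) * (𝓕 ψ : 𝓢(E n, ℂ)) ξ) * (ξ j : ℂ) ^ 2 := by
        intro j
        linear_combination (4 * (Real.pi : ℂ) ^ 2 * (m ξ : ℂ) * (𝓕 ψ : 𝓢(E n, ℂ)) ξ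
          * (ξ j : ℂ) ^ 2) * Complex.I_sq
      simp only [e2, ← Finset.mul_sum, smul_eq_mul]
      have e3 : (∑ j, (ξ j : ℂ) ^ 2) = ((‖ξ‖ ^ 2 : ℝ) : ℂ) := by
        rw [hnorm]; push_cast; rfl
      rw [e3]
      have e4 : ((τ : ℂ) ^ 2 + 4 * (Real.pi : ℂ) ^ 2 * ((‖ξ‖ ^ 2 : ℝ) : ℂ)) * (m ξ : ℂ) = 1 := by
        have := mul_inv_cancel₀ (hpos ξ).ne'
        simp only [hm]
        exact_mod_cast this
      linear_combination (-(𝓕 ψ : 𝓢(E n, ℂ)) ξ) * e4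
    conv_lhs => rw [this]
    simp only [_root_.sub_apply, _root_.smul_apply, _root_.sum_apply, smul_eq_mul]
    rfl
  · refine bound (∂_{e j} w) τ⁻¹ (by positivity) fun ξ => ?_
    rw [fourier_dd, hFw, ← mul_assoc, norm_mul, mul_pow]
    refine mul_le_mul_of_nonneg_right ?_ (sq_nonneg _)
    have : ‖2 * (Real.pi : ℂ) * Complex.I * (ξ j : ℂ) * (m ξ : ℂ)‖ ^ 2
        = 4 * Real.pi ^ 2 * ξ j ^ 2 * (m ξ) ^ 2 := by
      simp only [norm_mul, Complex.norm_I, Complex.norm_real, mul_pow, Real.norm_eq_abs, sq_abs]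
      norm_num
    rw [this]
    simp only [hm, inv_pow]
    rw [← div_eq_mul_inv, div_le_iff₀ (by have := hpos ξ; positivity)]
    have h1 : 4 * Real.pi ^ 2 * ξ j ^ 2 ≤ 4 * Real.pi ^ 2 * ‖ξ‖ ^ 2 :=
      mul_le_mul_of_nonneg_left (hcoord ξ j) (by positivity)
    refine h1.trans ?_
    rw [inv_mul_eq_div, le_div_iff₀ (by positivity)]
    have h2 : 0 ≤ 4 * Real.pi ^ 2 * ‖ξ‖ ^ 2 := by positivity
    have h3 : 0 ≤ τ ^ 2 := by positivity
    nlinarith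
  · refine (bound (∂_{e i} (∂_{e j} w)) 1 (by positivity) fun ξ => ?_).trans_eq (one_mul _)
    rw [fourier_dd, fourier_dd, hFw, ← mul_assoc, ← mul_assoc, norm_mul, mul_pow]
    refine mul_le_mul_of_nonneg_right ?_ (sq_nonneg _)
    have : ‖2 * (Real.pi : ℂ) * Complex.I * (ξ i : ℂ)
        * (2 * (Real.pi : ℂ) * Complex.I * (ξ j : ℂ)) * (m ξ : ℂ)‖ ^ 2
        = (4 * Real.pi ^ 2 * ξ i ^ 2) * (4 * Real.pi ^ 2 * ξ j ^ 2) * (m ξ) ^ 2 := by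
      simp only [norm_mul, Complex.norm_I, Complex.norm_real, mul_pow, Real.norm_eq_abs, sq_abs]
      norm_num
    rw [this]
    simp only [hm, inv_pow]
    rw [← div_eq_mul_inv, div_le_iff₀ (by have := hpos ξ; positivity)]
    have h1 : 4 * Real.pi ^ 2 * ξ j ^ 2 ≤ τ ^ 2 + 4 * Real.pi ^ 2 * ‖ξ‖ ^ 2 :=
      (mul_le_mul_of_nonneg_left (hcoord ξ j) (by positivity)).trans
        (le_add_of_nonneg_left (by positivity))
    have h2 : 4 * Real.pi ^ 2 * ξ i ^ 2 ≤ τ ^ 2 + 4 * Real.pi ^ 2 * ‖ξ‖ ^ 2 :=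
      (mul_le_mul_of_nonneg_left (hcoord ξ i) (by positivity)).trans
        (le_add_of_nonneg_left (by positivity))
    calc _ ≤ (τ ^ 2 + 4 * Real.pi ^ 2 * ‖ξ‖ ^ 2) * (τ ^ 2 + 4 * Real.pi ^ 2 * ‖ξ‖ ^ 2) :=
          mul_le_mul h2 h1 (by positivity) (hpos ξ).le
      _ = _ := by ring

/-- An `L²` function `g` whose distributional Laplacian is the sum of an `L²` function and of
first derivatives of `L²` functions has a distributional gradient in `L²`. -/
theorem exists_weak_derivative {g : E n → ℂ} (hg : MemLp g 2 volume) {K₁ K₀ τ : ℝ} (hτ : 0 < τ)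
    (hK₁ : 0 ≤ K₁) (hK₀ : 0 ≤ K₀)
    (h : ∀ η : 𝓢(E n, ℂ), ‖∫ x, g x * ∑ j, dd j (dd j η) x‖ ≤ K₁ * ∑ j, l2 (dd j η) + K₀ * l2 η)
    (j : Fin n) :
    ∃ D : E n → ℂ, MemLp D 2 volume ∧ l2 D ≤ τ * l2 g + n * K₁ + K₀ / τ ∧
      ∀ ψ : 𝓢(E n, ℂ), ∫ x, g x * dd j ψ x = -∫ x, D x * ψ x := by
  set e : Fin n → E n := fun j => EuclideanSpace.single j (1 : ℝ) with he
  have hmem : ∀ ψ : 𝓢(E n, ℂ), MemLp (dd j ψ) 2 volume := fun ψ => (∂_{e j} ψ).memLp 2 volume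
  set T : 𝓢(E n, ℂ) →ₗ[ℂ] (E n → ℂ) :=
    { toFun := fun ψ => ψ, map_add' := fun _ _ => rfl, map_smul' := fun _ _ => rfl } with hT
  set ℓ : 𝓢(E n, ℂ) →ₗ[ℂ] ℂ :=
    { toFun := fun ψ => -∫ x, g x * dd j ψ x
      map_add' := fun a b => by
        have : ∀ x, g x * dd j (a + b : 𝓢(E n, ℂ)) x = g x * dd j a x + g x * dd j b x := by
          intro x
          rw [← mul_add]
          congr 1
          exact dd_add a.differentiableAt b.differentiableAt
        simp only [this]
        rw [integral_add (integrable_mul_of_memLp hg (hmem a))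
          (integrable_mul_of_memLp hg (hmem b))]
        ring
      map_smul' := fun c a => by
        have : ∀ x, g x * dd j (c • a : 𝓢(E n, ℂ)) x = c * (g x * dd j a x) := by
          intro x
          have : dd j (c • a : 𝓢(E n, ℂ)) x = c * dd j a x := dd_const_mul c a.differentiableAt
          rw [this]; ring
        simp only [this]
        rw [integral_const_mul]
        simp } with hℓ
  have hl2 := l2_nonneg g
  obtain ⟨D, hD1, hD2, hD3⟩ := exists_l2_dual T (fun ψ => ψ.memLp 2 volume) ℓ
    (K := τ * l2 g + n * K₁ + K₀ / τ) (by positivity) (fun ψ => by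
      -- With η = ∂_j w one has ∂_j ψ = (τ² - Δ)η, and η, ∇η are bounded by τ⁻¹‖ψ‖ and ‖ψ‖. Thus the
      -- pairing of g with ∂_j ψ is bounded by ‖ψ‖ itself, which is the gain of one derivative.
      obtain ⟨w, hw1, hw2, hw3⟩ := exists_resolvent hτ ψ
      set η : 𝓢(E n, ℂ) := ∂_{e j} w with hη
      have hηc : ∀ i, dd i η = dd i (dd j w) := fun i => rfl
      have hψj : ∀ x, dd j ψ x = τ ^ 2 * η x - ∑ i, dd i (dd i η) x := by
        intro x
        have hw4 : (ψ : E n → ℂ) = fun x => (τ : ℂ) ^ 2 * w x - ∑ i, dd i (dd i w) x := by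
          funext x; exact_mod_cast hw1 x
        have d1 : ∀ i, DifferentiableAt ℝ (dd i (dd i w)) x := fun i =>
          (∂_{e i} (∂_{e i} w)).differentiableAt
        rw [hw4, dd_sub (w.differentiableAt.const_mul _) (DifferentiableAt.fun_sum fun i _ => d1 i),
          dd_const_mul _ w.differentiableAt, dd_sum fun i _ => d1 i]
        have d2 : ∀ i, dd j (dd i (dd i w)) x = dd i (dd i η) x := by
          intro i
          have hs : ContDiff ℝ 2 (dd i w) := (∂_{e i} w).smooth 2
          have hs' : ∀ y, dd j (dd i w) y = dd i (dd j w) y := fun y =>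
            dd_comm (w.smooth 2).contDiffAt
          rw [dd_comm hs.contDiffAt, show dd j (dd i w) = dd i (dd j w) from funext hs']
          rfl
        simp only [d2]
        rfl
      have hηL : MemLp (fun x => ∑ i, dd i (dd i η) x) 2 volume :=
        memLp_finsetSum _ fun i _ => (∂_{e i} (∂_{e i} η)).memLp 2 volume
      have hηm : MemLp η 2 volume := η.memLp 2 volume
      have e1 : ℓ ψ = -((τ : ℂ) ^ 2 * ∫ x, g x * η x) + ∫ x, g x * ∑ i, dd i (dd i η) x := by
        have : ∀ x, g x * dd j ψ x
            = (τ : ℂ) ^ 2 * (g x * η x) - g x * ∑ i, dd i (dd i η) x := by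
          intro x; rw [hψj]; ring
        simp only [hℓ, LinearMap.coe_mk, AddHom.coe_mk, this]
        rw [integral_sub ((integrable_mul_of_memLp hg hηm).const_mul _)
          (integrable_mul_of_memLp hg hηL), integral_const_mul]
        ring
      have hη0 : l2 η ≤ τ⁻¹ * l2 ψ := hw2 j
      have hη1 : ∑ i, l2 (dd i η) ≤ n * l2 ψ := by
        refine (Finset.sum_le_sum fun i _ => hw3 i j).trans_eq ?_
        simp
      rw [e1]
      refine (norm_add_le _ _).trans ?_
      have b1 : ‖-((τ : ℂ) ^ 2 * ∫ x, g x * η x)‖ ≤ τ ^ 2 * (l2 g * (τ⁻¹ * l2 ψ)) := by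
        rw [norm_neg, norm_mul, norm_pow, Complex.norm_real, Real.norm_eq_abs, sq_abs]
        refine mul_le_mul_of_nonneg_left ?_ (sq_nonneg _)
        exact (norm_integral_mul_le hg hηm).trans (mul_le_mul_of_nonneg_left hη0 hl2)
      have b2 := (h η).trans (add_le_add (mul_le_mul_of_nonneg_left hη1 hK₁)
        (mul_le_mul_of_nonneg_left hη0 hK₀))
      refine (add_le_add b1 b2).trans_eq ?_
      simp only [hT, LinearMap.coe_mk, AddHom.coe_mk]
      field_simp
      ring)
  refine ⟨D, hD1, hD2, fun ψ => ?_⟩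
  have := hD3 ψ
  simp only [hT, hℓ, LinearMap.coe_mk, AddHom.coe_mk] at this
  rw [this, neg_neg]

end elliptic

/-! ### Solvability of the conjugated equation -/

section tests

variable {n : ℕ} {U : Set (E n)}

theorem contDiff_two_of_infty {F : Type*} [NormedAddCommGroup F] [NormedSpace ℝ F] {f : E n → F}
    (hf : ContDiff ℝ ∞ f) : ContDiff ℝ 2 f := by
  exact_mod_cast contDiff_infty.1 hf 2

/-- The space of test functions `C_0^∞(U)`. -/
def testSpace (U : Set (E n)) : Submodule ℂ (E n → ℂ) where
  carrier := {v | IsTest U v}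
  add_mem' := fun {a b} ha hb => ⟨ha.1.add hb.1, ha.2.1.add hb.2.1,
    (tsupport_add a b).trans (union_subset ha.2.2 hb.2.2)⟩
  zero_mem' := ⟨contDiff_const, HasCompactSupport.zero, by
    rw [show tsupport (0 : E n → ℂ) = ∅ from tsupport_eq_empty_iff.2 rfl]; exact empty_subset _⟩
  smul_mem' := fun c v hv => by
    have hts : tsupport (c • v) ⊆ tsupport v :=
      closure_mono fun x hx hx' => hx (by simp [hx'])
    exact ⟨hv.1.const_smul c, hv.2.1.of_isClosed_subset (isClosed_tsupport _) hts,
      hts.trans hv.2.2⟩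

variable {β : Fin n → E n → ℂ} {γ : E n → ℂ} {v w : E n → ℂ} {x : E n}

theorem ellOp_add (hv : ContDiff ℝ 2 v) (hw : ContDiff ℝ 2 w) :
    ellOp β γ (v + w) x = ellOp β γ v x + ellOp β γ w x := by
  have d1 : ∀ {u : E n → ℂ}, ContDiff ℝ 2 u → ∀ y, DifferentiableAt ℝ u y :=
    fun hu y => hu.differentiable (by norm_num) y
  have d2 : ∀ {u : E n → ℂ}, ContDiff ℝ 2 u → ∀ j y, DifferentiableAt ℝ (dd j u) y :=
    fun hu j y => (contDiff_dd (k := 1) hu (by norm_num)).differentiable (by norm_num) y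
  have h1 : ∀ j, dd j (v + w) = fun y => dd j v y + dd j w y := fun j =>
    funext fun y => dd_add (d1 hv y) (d1 hw y)
  have h2 : ∀ j, dd j (fun y => dd j v y + dd j w y) x = dd j (dd j v) x + dd j (dd j w) x :=
    fun j => dd_add (d2 hv j x) (d2 hw j x)
  simp only [ellOp, h1, h2, Finset.sum_add_distrib, mul_add, Pi.add_apply]
  ring

theorem ellOp_smul (c : ℂ) (hv : ContDiff ℝ 2 v) :
    ellOp β γ (c • v) x = c * ellOp β γ v x := by
  have d1 : ∀ y, DifferentiableAt ℝ v y := fun y => hv.differentiable (by norm_num) y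
  have d2 : ∀ j y, DifferentiableAt ℝ (dd j v) y :=
    fun j y => (contDiff_dd (k := 1) hv (by norm_num)).differentiable (by norm_num) y
  have h1 : ∀ j, dd j (c • v) = fun y => c * dd j v y := fun j =>
    funext fun y => dd_const_mul c (d1 y)
  have h2 : ∀ j, dd j (fun y => c * dd j v y) x = c * dd j (dd j v) x := fun j =>
    dd_const_mul c (d2 j x)
  simp only [ellOp, h1, h2, Pi.smul_apply, smul_eq_mul, mul_add, mul_neg, Finset.mul_sum]
  congr 1
  · congr 1
    exact Finset.sum_congr rfl fun j _ => by ring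
  · ring

end tests

/-! ### Products of L² functions with bounded functions -/

section products

variable {n : ℕ} {f g : E n → ℂ}

theorem memLp_bdd_mul {b : ℝ} {c : E n → ℂ} (hc : AEStronglyMeasurable c volume)
    (hb : ∀ x, ‖c x‖ ≤ b) (hf : MemLp f 2 volume) : MemLp (fun x => c x * f x) 2 volume :=
  hf.of_le_mul (hc.mul hf.1) (Filter.Eventually.of_forall fun x => by
    rw [norm_mul]; exact mul_le_mul_of_nonneg_right (hb x) (norm_nonneg _))

theorem integrable_sq_norm (hf : MemLp f 2 volume) : Integrable (fun x => ‖f x‖ ^ 2) volume :=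
  (memLp_two_iff_integrable_sq_norm hf.1).1 hf

theorem l2_bdd_mul_le {b : ℝ} (hb0 : 0 ≤ b) {c : E n → ℂ} (hc : AEStronglyMeasurable c volume)
    (hb : ∀ x, ‖c x‖ ≤ b) (hf : MemLp f 2 volume) : l2 (fun x => c x * f x) ≤ b * l2 f := by
  refine le_of_sq_le_sq ?_ (mul_nonneg hb0 (l2_nonneg _))
  rw [mul_pow, l2_sq, l2_sq, ← integral_const_mul]
  refine integral_mono (integrable_sq_norm (memLp_bdd_mul hc hb hf))
    ((integrable_sq_norm hf).const_mul _) fun x => ?_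
  simp only [norm_mul, mul_pow]
  have := hb x
  gcongr

theorem norm_integral_bdd_mul_le {b : ℝ} (hb0 : 0 ≤ b) {c : E n → ℂ}
    (hc : AEStronglyMeasurable c volume) (hb : ∀ x, ‖c x‖ ≤ b) (hf : MemLp f 2 volume)
    (hg : MemLp g 2 volume) : ‖∫ x, f x * (c x * g x)‖ ≤ b * (l2 f * l2 g) := by
  refine (norm_integral_mul_le hf (memLp_bdd_mul hc hb hg)).trans ?_
  have := mul_le_mul_of_nonneg_left (l2_bdd_mul_le hb0 hc hb hg) (l2_nonneg f)
  linarith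

end products

/-- The `L²` solvability that is dual to the Carleman estimate. -/
theorem IsLogWeight.exists_l2_solution {n : ℕ} {x₀ : E n} {U : Set (E n)} {M : ℝ} {p : E n → ℝ}
    (hp : IsLogWeight x₀ U M p) (hM : 0 ≤ M) (K : ℝ) :
    ∃ C τ₀ : ℝ, 0 < C ∧ 1 ≤ τ₀ ∧ ∀ (β : Fin n → E n → ℂ) (γ : E n → ℂ),
      (∀ j, AEStronglyMeasurable (β j) volume) → AEStronglyMeasurable γ volume →
      (∀ j x, ‖β j x‖ ≤ K) → (∀ x, ‖γ x‖ ≤ K) →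
      ∀ τ : ℝ, τ₀ ≤ τ → ∀ f : E n → ℂ, MemLp f 2 volume →
      ∃ R : E n → ℂ, MemLp R 2 volume ∧ τ * l2 R ≤ C * l2 f ∧ ∀ v, IsTest U v →
        ∫ x, R x * ((Real.exp (τ * p x) : ℂ) * ellOp β γ v x)
          = ∫ x, f x * ((Real.exp (τ * p x) : ℂ) * v x) := by
  obtain ⟨C, τ₀, hC, hτ₀, hCarl⟩ := hp.exists_carleman hM K
  refine ⟨Real.sqrt C, τ₀, Real.sqrt_pos.2 hC, hτ₀, ?_⟩
  intro β γ hβ hγ hβK hγK τ hτ f hf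
  have hτpos : 0 < τ := by linarith
  have hec : Continuous fun x => (Real.exp (τ * p x) : ℂ) :=
    Complex.continuous_ofReal.comp (Real.continuous_exp.comp
      (continuous_const.mul hp.contDiff.continuous))
  set T : testSpace U →ₗ[ℂ] (E n → ℂ) :=
    { toFun := fun v x => (Real.exp (τ * p x) : ℂ) * ellOp β γ v x
      map_add' := fun a b => funext fun x => by
        have := ellOp_add (β := β) (γ := γ) (x := x) (contDiff_two_of_infty a.2.1)
          (contDiff_two_of_infty b.2.1)
        rw [Submodule.coe_add, this, Pi.add_apply, mul_add]
      map_smul' := fun c a => funext fun x => by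
        have := ellOp_smul (β := β) (γ := γ) (x := x) c (contDiff_two_of_infty a.2.1)
        rw [Submodule.coe_smul, this, Pi.smul_apply, RingHom.id_apply, smul_eq_mul]
        ring } with hT
  have hTm : ∀ v, MemLp (T v) 2 volume := fun v =>
    memLp_mul_ellOp hβ hγ hβK hγK (contDiff_two_of_infty v.2.1) v.2.2.1 hec
  have hvm : ∀ v : testSpace U, MemLp (fun x => (Real.exp (τ * p x) : ℂ) * (v : E n → ℂ) x) 2
      volume := fun v =>
    (hec.mul v.2.1.continuous).memLp_of_hasCompactSupport (v.2.2.1.mul_left)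
  set ℓ : testSpace U →ₗ[ℂ] ℂ :=
    { toFun := fun v => ∫ x, f x * ((Real.exp (τ * p x) : ℂ) * (v : E n → ℂ) x)
      map_add' := fun a b => by
        rw [← integral_add (integrable_mul_of_memLp hf (hvm a)) (integrable_mul_of_memLp hf (hvm b))]
        simp only [Submodule.coe_add, Pi.add_apply, mul_add]
      map_smul' := fun c a => by
        rw [RingHom.id_apply, smul_eq_mul, ← integral_const_mul]
        refine integral_congr_ae (Filter.Eventually.of_forall fun x => ?_)
        simp only [Submodule.coe_smul, Pi.smul_apply, smul_eq_mul]
        ring } with hℓ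
  obtain ⟨R, hR1, hR2, hR3⟩ := exists_l2_dual T hTm ℓ
    (K := Real.sqrt C / τ * l2 f) (mul_nonneg (by positivity) (l2_nonneg f)) (fun v => by
      have h1 := hCarl β γ hβ hγ hβK hγK τ hτ v (contDiff_two_of_infty v.2.1) v.2.2.1 v.2.2.2
      rw [← l2_sq, ← l2_sq] at h1
      have h2 : τ * l2 (fun x => (Real.exp (τ * p x) : ℂ) * (v : E n → ℂ) x)
          ≤ Real.sqrt C * l2 (T v) := by
        refine le_of_sq_le_sq ?_ (mul_nonneg (Real.sqrt_nonneg _) (l2_nonneg _))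
        rw [mul_pow, mul_pow, Real.sq_sqrt hC.le]
        exact h1
      refine (norm_integral_mul_le hf (hvm v)).trans ?_
      have h3 : l2 (fun x => (Real.exp (τ * p x) : ℂ) * (v : E n → ℂ) x)
          ≤ Real.sqrt C / τ * l2 (T v) := by
        rw [div_mul_eq_mul_div, le_div_iff₀ hτpos, mul_comm]
        exact h2
      calc _ ≤ l2 f * (Real.sqrt C / τ * l2 (T v)) := mul_le_mul_of_nonneg_left h3 (l2_nonneg _)
        _ = _ := by ring)
  refine ⟨R, hR1, ?_, fun v hv => hR3 ⟨v, hv⟩⟩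
  calc τ * l2 R ≤ τ * (Real.sqrt C / τ * l2 f) := mul_le_mul_of_nonneg_left hR2 hτpos.le
    _ = Real.sqrt C * l2 f := by field_simp

/-! ### Conjugation and localization of a first order perturbation of the Laplacian -/

section localize

variable {n : ℕ} {β : Fin n → E n → ℂ} {γ P X : E n → ℂ} {s : ℂ}

/-- First order coefficients of `η ↦ e^{sP} L (e^{-sP} X η)`, `L = -Δ + β·∇ + γ`. -/
def locB (β : Fin n → E n → ℂ) (P X : E n → ℂ) (s : ℂ) (j : Fin n) (x : E n) : ℂ :=
  -(2 * dd j X x) + 2 * s * (dd j P x * X x) + β j x * X x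

/-- Zeroth order coefficient of `η ↦ e^{sP} L (e^{-sP} X η)`, `L = -Δ + β·∇ + γ`. -/
def locC (β : Fin n → E n → ℂ) (γ P X : E n → ℂ) (s : ℂ) (x : E n) : ℂ :=
  (∑ j, (-dd j (dd j X) x + 2 * s * (dd j P x * dd j X x) + s * (dd j (dd j P) x * X x)
    - s ^ 2 * (dd j P x ^ 2 * X x) + β j x * (dd j X x - s * (dd j P x * X x)))) + γ x * X x

/-- Testing the weak equation for R with e^{-sP}Xη removes the exponential and turns it into an
equation for Δ(XR) tested on η, which need not have compact support. -/
theorem exp_mul_ellOp (hP : ContDiff ℝ ∞ P) (hX : ContDiff ℝ ∞ X) {η : E n → ℂ}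
    (hη : ContDiff ℝ ∞ η) (x : E n) :
    Complex.exp (s * P x) * ellOp β γ (fun y => Complex.exp (-(s * P y)) * (X y * η y)) x
      = -(X x * ∑ j, dd j (dd j η) x) + ∑ j, locB β P X s j x * dd j η x
        + locC β γ P X s x * η x := by
  have d1 : ∀ {u : E n → ℂ}, ContDiff ℝ ∞ u → ∀ y, DifferentiableAt ℝ u y :=
    fun hu y => hu.differentiable (by simp) y
  have d2 : ∀ {u : E n → ℂ}, ContDiff ℝ ∞ u → ∀ j y, DifferentiableAt ℝ (dd j u) y :=
    fun hu j y => (contDiff_dd (k := 1) (contDiff_two_of_infty hu)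
      (by norm_num)).differentiable (by norm_num) y
  have dE : ∀ y, DifferentiableAt ℝ (fun z => -(s * P z)) y := fun y =>
    ((d1 hP y).const_mul s).fun_neg
  have hg : ∀ j (g : E n → ℂ) y, DifferentiableAt ℝ g y →
      dd j (fun z => Complex.exp (-(s * P z)) * g z) y
        = Complex.exp (-(s * P y)) * (dd j g y - s * dd j P y * g y) := by
    intro j g y hg
    rw [dd_mul (dE y).cexp hg, dd_cexp (dE y), dd_neg, dd_const_mul _ (d1 hP y)]
    ring
  have dζ : ∀ y, DifferentiableAt ℝ (fun z => X z * η z) y := fun y =>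
    (d1 hX y).fun_mul (d1 hη y)
  have h1 : ∀ j, dd j (fun z => Complex.exp (-(s * P z)) * (X z * η z))
      = fun y => Complex.exp (-(s * P y)) * ((dd j X y * η y + X y * dd j η y)
        - s * dd j P y * (X y * η y)) := fun j =>
    funext fun y => by rw [hg j _ y (dζ y), dd_mul (d1 hX y) (d1 hη y)]
  have h2 : ∀ j, dd j (fun y => Complex.exp (-(s * P y)) * ((dd j X y * η y + X y * dd j η y)
        - s * dd j P y * (X y * η y))) x
      = Complex.exp (-(s * P x)) * (
        (dd j (dd j X) x * η x + 2 * dd j X x * dd j η x + X x * dd j (dd j η) x)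
        - (s * dd j (dd j P) x * (X x * η x)
          + s * dd j P x * (dd j X x * η x + X x * dd j η x))
        - s * dd j P x * ((dd j X x * η x + X x * dd j η x) - s * dd j P x * (X x * η x))) := by
    intro j
    have a1 := (d2 hX j x).fun_mul (d1 hη x)
    have a2 := (d1 hX x).fun_mul (d2 hη j x)
    have a3 := ((d2 hP j x).const_mul s).fun_mul (dζ x)
    rw [hg j _ x ((a1.fun_add a2).fun_sub a3), dd_sub (a1.fun_add a2) a3, dd_add a1 a2,
      dd_mul (d2 hX j x) (d1 hη x), dd_mul (d1 hX x) (d2 hη j x),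
      dd_mul ((d2 hP j x).const_mul s) (dζ x), dd_mul (d1 hX x) (d1 hη x),
      dd_const_mul _ (d2 hP j x)]
    ring
  have hee : Complex.exp (s * P x) * Complex.exp (-(s * P x)) = 1 := by
    rw [← Complex.exp_add]; simp
  simp only [ellOp, h1, h2, locB, locC]
  set e1 := Complex.exp (s * P x)
  set e2 := Complex.exp (-(s * P x))
  rw [mul_add, mul_add, mul_neg, Finset.mul_sum, Finset.mul_sum, Finset.mul_sum, add_mul,
    Finset.sum_mul, ← Finset.sum_neg_distrib, ← Finset.sum_neg_distrib, ← Finset.sum_add_distrib,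
    ← add_assoc, ← Finset.sum_add_distrib, ← Finset.sum_add_distrib]
  congr 1
  · refine Finset.sum_congr rfl fun j _ => ?_
    linear_combination (-((dd j (dd j X) x * η x + 2 * dd j X x * dd j η x
          + X x * dd j (dd j η) x)
        - (s * dd j (dd j P) x * (X x * η x)
          + s * dd j P x * (dd j X x * η x + X x * dd j η x))
        - s * dd j P x * ((dd j X x * η x + X x * dd j η x) - s * dd j P x * (X x * η x)))
        + β j x * ((dd j X x * η x + X x * dd j η x) - s * dd j P x * (X x * η x))) * hee
  · linear_combination γ x * (X x * η x) * hee

/-- The powers of τ are the point: each derivative missing from η costs one factor τ. Every term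
carries X or a derivative of X, whose compact support makes it bounded, with N independent of the
coefficients and of τ. -/
theorem exists_bound_loc (hP : ContDiff ℝ ∞ P) (hX : ContDiff ℝ ∞ X) (hXc : HasCompactSupport X)
    {K : ℝ} (hK : 0 ≤ K) :
    ∃ N : ℝ, 0 ≤ N ∧ ∀ (β : Fin n → E n → ℂ) (γ : E n → ℂ),
      (∀ j x, ‖β j x‖ ≤ K) → (∀ x, ‖γ x‖ ≤ K) → ∀ τ : ℝ, 1 ≤ τ →
      (∀ j x, ‖locB β P X τ j x‖ ≤ N * τ) ∧ ∀ x, ‖locC β γ P X τ x‖ ≤ N * τ ^ 2 := by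
  have c1 : ∀ {u : E n → ℂ}, ContDiff ℝ ∞ u → ∀ j, Continuous (dd j u) := fun hu j =>
    (contDiff_dd (k := 1) (contDiff_two_of_infty hu) (by norm_num)).continuous
  have c2 : ∀ {u : E n → ℂ}, ContDiff ℝ ∞ u → ∀ j, Continuous (dd j (dd j u)) := fun hu j =>
    (contDiff_dd (k := 0) (contDiff_dd (k := 1) (contDiff_two_of_infty hu) (by norm_num))
      (by norm_num)).continuous
  have bd : ∀ {u : E n → ℂ}, Continuous u → HasCompactSupport u → ∃ B, ∀ x, ‖u x‖ ≤ B :=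
    fun hu huc => huc.exists_bound_of_continuous hu
  have hB : ∃ B : ℝ, 0 ≤ B ∧ (∀ x, ‖X x‖ ≤ B) ∧ ∀ j x, ‖dd j X x‖ ≤ B ∧ ‖dd j (dd j X) x‖ ≤ B ∧
      ‖dd j P x * X x‖ ≤ B ∧ ‖dd j P x * dd j X x‖ ≤ B ∧ ‖dd j (dd j P) x * X x‖ ≤ B ∧
      ‖dd j P x ^ 2 * X x‖ ≤ B := by
    obtain ⟨B0, h0⟩ := bd hX.continuous hXc
    have hXj := fun j => hasCompactSupport_dd (j := j) hXc
    choose B1 h1 using fun j => bd (c1 hX j) (hXj j)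
    choose B2 h2 using fun j => bd (c2 hX j) (hasCompactSupport_dd (j := j) (hXj j))
    choose B3 h3 using fun j => bd ((c1 hP j).mul hX.continuous) hXc.mul_left
    choose B4 h4 using fun j => bd ((c1 hP j).mul (c1 hX j)) (hXj j).mul_left
    choose B5 h5 using fun j => bd ((c2 hP j).mul hX.continuous) hXc.mul_left
    choose B6 h6 using fun j => bd (((c1 hP j).pow 2).mul hX.continuous) hXc.mul_left
    have p0 := fun x => (norm_nonneg _).trans (h0 x)
    have p1 := fun j => (norm_nonneg _).trans (h1 j 0)
    have p2 := fun j => (norm_nonneg _).trans (h2 j 0)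
    have p3 := fun j => (norm_nonneg _).trans (h3 j 0)
    have p4 := fun j => (norm_nonneg _).trans (h4 j 0)
    have p5 := fun j => (norm_nonneg _).trans (h5 j 0)
    have p6 := fun j => (norm_nonneg _).trans (h6 j 0)
    have q0 := p0 0
    have hs : ∀ j, B1 j + B2 j + B3 j + B4 j + B5 j + B6 j
        ≤ ∑ j, (B1 j + B2 j + B3 j + B4 j + B5 j + B6 j) := fun j =>
      Finset.single_le_sum (f := fun j => B1 j + B2 j + B3 j + B4 j + B5 j + B6 j)
        (fun i _ => by have := p1 i; have := p2 i; have := p3 i; have := p4 i; have := p5 i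
                       have := p6 i; positivity) (Finset.mem_univ j)
    have hs0 : 0 ≤ ∑ j, (B1 j + B2 j + B3 j + B4 j + B5 j + B6 j) :=
      Finset.sum_nonneg fun i _ => by
        have := p1 i; have := p2 i; have := p3 i; have := p4 i; have := p5 i
        have := p6 i; positivity
    refine ⟨B0 + ∑ j, (B1 j + B2 j + B3 j + B4 j + B5 j + B6 j), by positivity,
      fun x => (h0 x).trans (by linarith), fun j x => ?_⟩
    have := hs j
    have := p1 j; have := p2 j; have := p3 j; have := p4 j; have := p5 j; have := p6 j
    exact ⟨(h1 j x).trans (by linarith), (h2 j x).trans (by linarith),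
      (h3 j x).trans (by linarith), (h4 j x).trans (by linarith), (h5 j x).trans (by linarith),
      (h6 j x).trans (by linarith)⟩
  obtain ⟨B, hB0, hBX, hBj⟩ := hB
  refine ⟨(4 + K) * B + ((n : ℝ) * ((5 + 2 * K) * B) + K * B), by positivity, ?_⟩
  intro β γ hβ hγ τ hτ
  have hτ0 : 0 ≤ τ := by linarith
  have hτ2 : τ ≤ τ ^ 2 := by nlinarith
  have hnτ : ‖(τ : ℂ)‖ = τ := by rw [Complex.norm_real, Real.norm_of_nonneg hτ0]
  have hn0 : (0 : ℝ) ≤ (n : ℝ) * ((5 + 2 * K) * B) + K * B := by positivity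
  constructor
  · intro j x
    obtain ⟨b1, b2, b3, b4, b5, b6⟩ := hBj j x
    have t1 : ‖2 * dd j X x‖ ≤ 2 * B := by
      rw [norm_mul]; norm_num; exact b1
    have t2 : ‖2 * (τ : ℂ) * (dd j P x * X x)‖ ≤ 2 * τ * B := by
      rw [norm_mul, norm_mul, hnτ]; norm_num only [RCLike.norm_ofNat]; gcongr
    have t3 : ‖β j x * X x‖ ≤ K * B := by
      rw [norm_mul]; exact mul_le_mul (hβ j x) (hBX x) (norm_nonneg _) hK
    have : ‖locB β P X τ j x‖ ≤ 2 * B + 2 * τ * B + K * B :=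
      (norm_add_le _ _).trans (add_le_add ((norm_add_le _ _).trans
        (add_le_add (by rw [norm_neg]; exact t1) t2)) t3)
    have u1 : B ≤ B * τ := le_mul_of_one_le_right hB0 hτ
    have u2 : K * B ≤ K * B * τ := le_mul_of_one_le_right (by positivity) hτ
    have u3 := mul_nonneg hn0 hτ0
    linarith
  · intro x
    have hterm : ∀ j, ‖-dd j (dd j X) x + 2 * (τ : ℂ) * (dd j P x * dd j X x)
        + (τ : ℂ) * (dd j (dd j P) x * X x) - (τ : ℂ) ^ 2 * (dd j P x ^ 2 * X x)
        + β j x * (dd j X x - (τ : ℂ) * (dd j P x * X x))‖ ≤ ((5 + 2 * K) * B) * τ ^ 2 := by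
      intro j
      obtain ⟨b1, b2, b3, b4, b5, b6⟩ := hBj j x
      have t2 : ‖2 * (τ : ℂ) * (dd j P x * dd j X x)‖ ≤ 2 * τ * B := by
        rw [norm_mul, norm_mul, hnτ]; norm_num only [RCLike.norm_ofNat]; gcongr
      have t3 : ‖(τ : ℂ) * (dd j (dd j P) x * X x)‖ ≤ τ * B := by
        rw [norm_mul, hnτ]; gcongr
      have t4 : ‖(τ : ℂ) ^ 2 * (dd j P x ^ 2 * X x)‖ ≤ τ ^ 2 * B := by
        rw [norm_mul, norm_pow, hnτ]; gcongr
      have t5 : ‖β j x * (dd j X x - (τ : ℂ) * (dd j P x * X x))‖ ≤ K * (B + τ * B) := by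
        rw [norm_mul]
        refine mul_le_mul (hβ j x) ((norm_sub_le _ _).trans (add_le_add b1 ?_))
          (norm_nonneg _) hK
        rw [norm_mul, hnτ]; gcongr
      have key := (norm_add_le _ _).trans (add_le_add ((norm_sub_le _ _).trans (add_le_add
        ((norm_add_le _ _).trans (add_le_add ((norm_add_le _ _).trans (add_le_add
          ((norm_neg (dd j (dd j X) x)).trans_le b2) t2)) t3)) t4)) t5)
      refine key.trans ?_
      have u1 : τ * B ≤ τ ^ 2 * B := by gcongr
      have u2 : B ≤ τ * B := le_mul_of_one_le_left hB0 hτ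
      have u3 : K * (τ * B) ≤ K * (τ ^ 2 * B) := by gcongr
      have u4 : K * B ≤ K * (τ * B) := by gcongr
      linarith
    have hsum : ‖locC β γ P X τ x‖ ≤ (∑ _j : Fin n, ((5 + 2 * K) * B) * τ ^ 2) + K * B :=
      (norm_add_le _ _).trans (add_le_add ((norm_sum_le _ _).trans
        (Finset.sum_le_sum fun j _ => hterm j)) (by
          rw [norm_mul]; exact mul_le_mul (hγ x) (hBX x) (norm_nonneg _) hK))
    rw [Finset.sum_const, Finset.card_univ, Fintype.card_fin, nsmul_eq_mul] at hsum
    have u1 : K * B ≤ K * B * τ ^ 2 :=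
      le_mul_of_one_le_right (by positivity) (hτ.trans hτ2)
    have u2 : 0 ≤ (4 + K) * B * τ ^ 2 := by positivity
    linarith

theorem aestronglyMeasurable_loc (hP : ContDiff ℝ ∞ P) (hX : ContDiff ℝ ∞ X)
    (hβ : ∀ j, AEStronglyMeasurable (β j) volume) (hγ : AEStronglyMeasurable γ volume) :
    (∀ j, AEStronglyMeasurable (locB β P X s j) volume)
      ∧ AEStronglyMeasurable (locC β γ P X s) volume := by
  have c1 : ∀ {u : E n → ℂ}, ContDiff ℝ ∞ u → ∀ j, Continuous (dd j u) := fun hu j =>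
    (contDiff_dd (k := 1) (contDiff_two_of_infty hu) (by norm_num)).continuous
  have c2 : ∀ {u : E n → ℂ}, ContDiff ℝ ∞ u → ∀ j, Continuous (dd j (dd j u)) := fun hu j =>
    (contDiff_dd (k := 0) (contDiff_dd (k := 1) (contDiff_two_of_infty hu) (by norm_num))
      (by norm_num)).continuous
  have hX0 := hX.continuous
  constructor
  · intro j
    have := c1 hX j
    have := c1 hP j
    exact (Continuous.aestronglyMeasurable (by fun_prop)).add
      ((hβ j).mul hX0.aestronglyMeasurable)
  · refine AEStronglyMeasurable.add ?_ (hγ.mul hX0.aestronglyMeasurable)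
    refine Finset.aestronglyMeasurable_fun_sum _ fun j _ => ?_
    have := c1 hX j
    have := c1 hP j
    have := c2 hX j
    have := c2 hP j
    exact (Continuous.aestronglyMeasurable (by fun_prop)).add
      ((hβ j).mul (Continuous.aestronglyMeasurable (by fun_prop)))

end localize

open scoped SchwartzMap

/-- Solvability with a gain of one derivative in the interior. -/
theorem IsLogWeight.exists_h1_solution {n : ℕ} {x₀ : E n} {U : Set (E n)} {M : ℝ} {p : E n → ℝ}
    (hp : IsLogWeight x₀ U M p) (hM : 0 ≤ M) {K : ℝ} (hK : 0 ≤ K) {X : E n → ℂ}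
    (hX : ContDiff ℝ ∞ X) (hXc : HasCompactSupport X) (hXU : tsupport X ⊆ U) :
    ∃ C τ₀ : ℝ, 0 < C ∧ 1 ≤ τ₀ ∧ ∀ (β : Fin n → E n → ℂ) (γ : E n → ℂ),
      (∀ j, AEStronglyMeasurable (β j) volume) → AEStronglyMeasurable γ volume →
      (∀ j x, ‖β j x‖ ≤ K) → (∀ x, ‖γ x‖ ≤ K) →
      ∀ τ : ℝ, τ₀ ≤ τ → ∀ f : E n → ℂ, MemLp f 2 volume →
      ∃ (R : E n → ℂ) (D : Fin n → E n → ℂ), MemLp R 2 volume ∧ (∀ j, MemLp (D j) 2 volume) ∧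
        τ * l2 R ≤ C * l2 f ∧ (∀ j, l2 (D j) ≤ C * l2 f) ∧
        (∀ v, IsTest U v → ∫ x, R x * (Complex.exp (τ * p x) * ellOp β γ v x)
          = ∫ x, f x * (Complex.exp (τ * p x) * v x)) ∧
        ∀ v, ContDiff ℝ ∞ v → HasCompactSupport v → ∀ j,
          ∫ x, X x * R x * dd j v x = -∫ x, D j x * v x := by
  obtain ⟨C, τ₀, hC, hτ₀, hsol⟩ := hp.exists_l2_solution hM K
  set P : E n → ℂ := fun x => (p x : ℂ) with hPdef
  have hP : ContDiff ℝ ∞ P := Complex.ofRealCLM.contDiff.comp hp.contDiff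
  obtain ⟨N, hN, hloc⟩ := exists_bound_loc hP hX hXc hK
  obtain ⟨B, hB⟩ := hXc.exists_bound_of_continuous hX.continuous
  have hB0 : 0 ≤ B := (norm_nonneg _).trans (hB 0)
  refine ⟨C + (B * C + n * (N * C) + (N * C + B)), τ₀, by positivity, hτ₀, ?_⟩
  intro β γ hβ hγ hβK hγK τ hτ f hf
  have hτ1 : 1 ≤ τ := hτ₀.trans hτ
  have hτ0 : 0 < τ := by linarith
  obtain ⟨R, hR, hRl, hRw⟩ := hsol β γ hβ hγ hβK hγK τ hτ f hf
  obtain ⟨hBb, hCb⟩ := hloc β γ hβK hγK τ hτ1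
  obtain ⟨hBm, hCm⟩ := aestronglyMeasurable_loc (s := (τ : ℂ)) hP hX hβ hγ
  have hRw' : ∀ v, IsTest U v → ∫ x, R x * (Complex.exp (τ * p x) * ellOp β γ v x)
          = ∫ x, f x * (Complex.exp (τ * p x) * v x) := fun v hv => by
    have := hRw v hv
    simpa only [Complex.ofReal_exp, Complex.ofReal_mul] using this
  have hXR : MemLp (fun x => X x * R x) 2 volume :=
    memLp_bdd_mul hX.continuous.aestronglyMeasurable hB hR
  have hXRl : l2 (fun x => X x * R x) ≤ B * l2 R :=
    l2_bdd_mul_le hB0 hX.continuous.aestronglyMeasurable hB hR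
  have hmem : ∀ (η : 𝓢(E n, ℂ)), MemLp η 2 volume := fun η => η.memLp 2 volume
  -- The weak equation solved for the Laplacian term. It places Δ(XR) in L² plus first derivatives
  -- of L² functions, quantitatively in τ.
  have hest : ∀ η : 𝓢(E n, ℂ), ‖∫ x, (X x * R x) * ∑ j, dd j (dd j η) x‖
      ≤ (N * τ * l2 R) * ∑ j, l2 (dd j η) + (N * τ ^ 2 * l2 R + B * l2 f) * l2 η := by
    intro η
    have hη : ContDiff ℝ ∞ (η : E n → ℂ) := η.smooth ⊤
    have hdη : ∀ j, MemLp (dd j η) 2 volume := fun j =>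
      (LineDeriv.lineDerivOp (EuclideanSpace.single j (1 : ℝ) : E n) η : 𝓢(E n, ℂ)).memLp 2 volume
    set v : E n → ℂ := fun y => Complex.exp (-(τ * P y)) * (X y * η y) with hv
    have hts : tsupport v ⊆ tsupport X := closure_mono fun x hx hx' => hx (by simp [hv, hx'])
    have hvt : IsTest U v := ⟨((contDiff_const.mul hP).neg.cexp).mul (hX.mul hη),
      hXc.of_isClosed_subset (isClosed_tsupport _) hts, hts.trans hXU⟩
    have e1 := hRw' v hvt
    have e2 : ∀ x, R x * (Complex.exp (τ * p x) * ellOp β γ v x)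
        = -((X x * R x) * ∑ j, dd j (dd j η) x) + (∑ j, R x * (locB β P X τ j x * dd j η x)
          + R x * (locC β γ P X τ x * η x)) := fun x => by
      rw [show Complex.exp (τ * p x) * ellOp β γ v x = _ from exp_mul_ellOp hP hX hη x,
        ← Finset.mul_sum]
      ring
    have e3 : ∀ x, f x * (Complex.exp (τ * p x) * v x) = f x * (X x * η x) := fun x => by
      rw [hv]
      simp only
      rw [← mul_assoc (Complex.exp _) (Complex.exp _), ← Complex.exp_add]
      simp [hPdef]
    have iL : Integrable (fun x => (X x * R x) * ∑ j, dd j (dd j η) x) volume := by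
      refine integrable_mul_of_memLp hXR (memLp_finsetSum _ fun j _ => ?_)
      exact (LineDeriv.lineDerivOp (EuclideanSpace.single j (1 : ℝ) : E n)
        (LineDeriv.lineDerivOp (EuclideanSpace.single j (1 : ℝ) : E n) η : 𝓢(E n, ℂ))
        : 𝓢(E n, ℂ)).memLp 2 volume
    have iB : ∀ j, Integrable (fun x => R x * (locB β P X τ j x * dd j η x)) volume := fun j =>
      integrable_mul_of_memLp hR (memLp_bdd_mul (hBm j) (hBb j) (hdη j))
    have iC : Integrable (fun x => R x * (locC β γ P X τ x * η x)) volume :=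
      integrable_mul_of_memLp hR (memLp_bdd_mul hCm hCb (hmem η))
    simp only [e2, e3] at e1
    have iS := integrable_finsetSum Finset.univ fun j _ => iB j
    have e5 := integral_add (f := fun x => -((X x * R x) * ∑ j, dd j (dd j η) x)) iL.neg
      (iS.add iC)
    simp only [Pi.add_apply] at e5
    rw [e5, integral_neg, integral_add iS iC, integral_finsetSum _ fun j _ => iB j] at e1
    have e4 : ∫ x, (X x * R x) * ∑ j, dd j (dd j η) x
        = (∑ j, ∫ x, R x * (locB β P X τ j x * dd j η x))
          + (∫ x, R x * (locC β γ P X τ x * η x)) - ∫ x, f x * (X x * η x) := by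
      linear_combination -e1
    rw [e4]
    have b1 : ‖∑ j, ∫ x, R x * (locB β P X τ j x * dd j η x)‖
        ≤ ∑ j, (N * τ) * (l2 R * l2 (dd j η)) :=
      (norm_sum_le _ _).trans (Finset.sum_le_sum fun j _ =>
        norm_integral_bdd_mul_le (by positivity) (hBm j) (hBb j) hR (hdη j))
    have b2 := norm_integral_bdd_mul_le (by positivity) hCm hCb hR (hmem η)
    have b3 := norm_integral_bdd_mul_le hB0 hX.continuous.aestronglyMeasurable hB hf (hmem η)
    refine ((norm_sub_le _ _).trans (add_le_add ((norm_add_le _ _).trans (add_le_add b1 b2))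
      b3)).trans_eq ?_
    rw [← Finset.mul_sum, ← Finset.mul_sum]
    ring
  have hR0 := l2_nonneg R
  have hf0 := l2_nonneg f
  choose D hD1 hD2 hD3 using exists_weak_derivative hXR hτ0 (by positivity) (by positivity) hest
  refine ⟨R, D, hR, hD1, ?_, fun j => ?_, hRw', ?_⟩
  · refine hRl.trans (mul_le_mul_of_nonneg_right ?_ hf0)
    have : 0 ≤ B * C + n * (N * C) + (N * C + B) := by positivity
    linarith
  -- Balance of powers: τ‖XR‖, the first order bound Nτ‖R‖, and Nτ²‖R‖/τ are all multiples of τ‖R‖ ≤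
  -- C‖f‖. This is the reason for taking τ as the resolvent parameter too.
  · refine (hD2 j).trans ?_
    have k1 : τ * l2 (fun x => X x * R x) ≤ B * (C * l2 f) := by
      calc _ ≤ τ * (B * l2 R) := by gcongr
        _ = B * (τ * l2 R) := by ring
        _ ≤ _ := by gcongr
    have k2 : (n : ℝ) * (N * τ * l2 R) ≤ n * (N * (C * l2 f)) := by
      rw [mul_assoc N]; gcongr
    have k3 : (N * τ ^ 2 * l2 R + B * l2 f) / τ ≤ N * (C * l2 f) + B * l2 f := by
      rw [add_div]
      refine add_le_add ?_ (div_le_self (by positivity) hτ1)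
      rw [show N * τ ^ 2 * l2 R / τ = N * (τ * l2 R) by field_simp]
      gcongr
    have k4 : 0 ≤ C * l2 f := by positivity
    refine (add_le_add (add_le_add k1 k2) k3).trans ?_
    linarith
  · intro v hv hvc j
    exact hD3 j (hvc.toSchwartzMap hv)

/-! ### Calculus of weak gradients -/

section weakgrad

variable {n : ℕ} {Ω : Set (E n)}

/-- The vector field with given components. -/
def vec (G : Fin n → E n → ℂ) (x : E n) : EuclideanSpace ℂ (Fin n) :=
  WithLp.toLp 2 fun j => G j x

@[simp] theorem vec_apply (G : Fin n → E n → ℂ) (x : E n) (j : Fin n) : vec G x j = G j x := rfl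

theorem integrable_vec {μ : Measure (E n)} {G : Fin n → E n → ℂ}
    (hG : ∀ j, Integrable (G j) μ) : Integrable (vec G) μ :=
  Integrable.of_eval_piLp hG

theorem memLp_vec {μ : Measure (E n)} {p : ℝ≥0∞} {G : Fin n → E n → ℂ}
    (hG : ∀ j, MemLp (G j) p μ) : MemLp (vec G) p μ :=
  MemLp.of_eval_piLp hG

theorem isWeakGrad_vec (hΩ : IsOpen Ω) {u : E n → ℂ} {G : Fin n → E n → ℂ}
    (hu : LocallyIntegrableOn u Ω volume) (hG : ∀ j, LocallyIntegrableOn (G j) Ω volume)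
    (h : ∀ v, IsTest Ω v → ∀ j, ∫ x in Ω, u x * dd j v x = -∫ x in Ω, G j x * v x) :
    IsWeakGrad Ω u (vec G) := by
  refine ⟨hu, ?_, fun v hv j => h v hv j⟩
  rw [locallyIntegrableOn_iff hΩ.isLocallyClosed]
  exact fun K hK hKc => integrable_vec fun j => (hG j).integrableOn_compact_subset hK hKc

theorem IsWeakGrad.congr (hΩ : IsOpen Ω) {u u' : E n → ℂ} {G : E n → EuclideanSpace ℂ (Fin n)}
    (h : IsWeakGrad Ω u G) (hu : EqOn u u' Ω) : IsWeakGrad Ω u' G := by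
  refine ⟨?_, h.2.1, fun v hv j => ?_⟩
  · have h1 := h.1
    rw [locallyIntegrableOn_iff hΩ.isLocallyClosed] at h1 ⊢
    intro K hK hKc
    exact (h1 K hK hKc).congr_fun (hu.mono hK) hKc.measurableSet
  · rw [← h.2.2 v hv j]
    exact setIntegral_congr_fun hΩ.measurableSet fun x hx => by simp only [hu hx]

theorem isWeakGrad_of_contDiff (hΩ : IsOpen Ω) {u : E n → ℂ} (hu : ContDiff ℝ 1 u) :
    IsWeakGrad Ω u (vec fun j => dd j u) := by
  refine isWeakGrad_vec hΩ (hu.continuous.locallyIntegrable.locallyIntegrableOn _)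
    (fun j => ((contDiff_dd (k := 0) hu (by norm_num)).continuous.locallyIntegrable
      ).locallyIntegrableOn _) fun v hv j => ?_
  rw [setIntegral_eq_integral_of_forall_compl_eq_zero,
    setIntegral_eq_integral_of_forall_compl_eq_zero]
  · exact integral_mul_dd hu (hv.1.of_le (by simp)) hv.2.1
  · intro x hx
    rw [image_eq_zero_of_notMem_tsupport fun h' => hx (hv.2.2 h'), mul_zero]
  · intro x hx
    rw [dd_eq_zero_of_notMem fun h' => hx (hv.2.2 h'), mul_zero]

theorem IsWeakGrad.add {u u' : E n → ℂ} {G G' : Fin n → E n → ℂ}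
    (h : IsWeakGrad Ω u (vec G)) (h' : IsWeakGrad Ω u' (vec G')) :
    IsWeakGrad Ω (fun x => u x + u' x) (vec fun j x => G j x + G' j x) := by
  have hv : (vec fun j x => G j x + G' j x) = fun x => vec G x + vec G' x := by
    funext x; ext j; simp
  refine ⟨h.1.add h'.1, by rw [hv]; exact h.2.1.add h'.2.1, fun v hv j => ?_⟩
  have c0 : Continuous v := hv.1.continuous
  have c1 : Continuous (dd j v) := (contDiff_dd (k := 0) hv.1 (by simp)).continuous
  have s1 : HasCompactSupport (dd j v) := hasCompactSupport_dd hv.2.1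
  have t1 : tsupport (dd j v) ⊆ Ω := (tsupport_dd_subset v).trans hv.2.2
  simp only [pd_eq_dd, vec_apply, add_mul]
  have iG : ∀ {u : E n → ℂ} {G : Fin n → E n → ℂ}, IsWeakGrad Ω u (vec G) →
      Integrable (fun x => G j x * v x) (volume.restrict Ω) := fun h =>
    integrable_mul_of_locallyIntegrableOn (locallyIntegrableOn_apply h.2.1 j) c0 hv.2.1 hv.2.2
  rw [integral_add (integrable_mul_of_locallyIntegrableOn h.1 c1 s1 t1)
      (integrable_mul_of_locallyIntegrableOn h'.1 c1 s1 t1), integral_add (iG h) (iG h'), neg_add]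
  exact congrArg₂ (· + ·) (h.2.2 v hv j) (h'.2.2 v hv j)

/-- Product rule, obtained by testing the gradient of u with gv. This function is only C¹, so the
enlarged class of test functions is required. -/
theorem IsWeakGrad.contDiff_mul (hΩ : IsOpen Ω) {g u : E n → ℂ} {G : Fin n → E n → ℂ}
    (hg : ContDiff ℝ 1 g) (h : IsWeakGrad Ω u (vec G)) :
    IsWeakGrad Ω (fun x => g x * u x) (vec fun j x => g x * G j x + dd j g x * u x) := by
  have hgc := hg.continuous
  have hdg : ∀ j, Continuous (dd j g) := fun j =>
    (contDiff_dd (k := 0) hg (by norm_num)).continuous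
  have hGj : ∀ j, LocallyIntegrableOn (G j) Ω volume := fun j => locallyIntegrableOn_apply h.2.1 j
  refine isWeakGrad_vec hΩ (h.1.continuousOn_mul hgc.continuousOn hΩ.isLocallyClosed)
    (fun j => ((hGj j).continuousOn_mul hgc.continuousOn hΩ.isLocallyClosed).add
      (h.1.continuousOn_mul (hdg j).continuousOn hΩ.isLocallyClosed)) fun v hv j => ?_
  have hv1 : ContDiff ℝ 1 v := hv.1.of_le (by simp)
  have hdv : Continuous (dd j v) := (contDiff_dd (k := 0) hv.1 (by simp)).continuous
  have hts : tsupport (fun x => g x * v x) ⊆ Ω :=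
    (tsupport_mul_subset_right (f := g) (g := v)).trans hv.2.2
  have key := h.integral_mul_dd_of_contDiff_one hΩ (hg.mul hv1) hv.2.1.mul_left hts j
  have e1 : ∀ x, u x * dd j (fun x => g x * v x) x
      = u x * (dd j g x * v x) + u x * (g x * dd j v x) := fun x => by
    rw [dd_mul (hg.differentiable (by norm_num) x) (hv1.differentiable (by norm_num) x), mul_add]
  simp only [e1, vec_apply] at key
  have i1 : Integrable (fun x => u x * (dd j g x * v x)) (volume.restrict Ω) :=
    integrable_mul_of_locallyIntegrableOn h.1 ((hdg j).mul hv.1.continuous) hv.2.1.mul_left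
      ((tsupport_mul_subset_right (f := dd j g) (g := v)).trans hv.2.2)
  have i2 : Integrable (fun x => u x * (g x * dd j v x)) (volume.restrict Ω) :=
    integrable_mul_of_locallyIntegrableOn h.1 (hgc.mul hdv) (hasCompactSupport_dd hv.2.1).mul_left
      ((tsupport_mul_subset_right (f := g) (g := dd j v)).trans
        ((tsupport_dd_subset v).trans hv.2.2))
  have i3 : Integrable (fun x => G j x * (g x * v x)) (volume.restrict Ω) :=
    integrable_mul_of_locallyIntegrableOn (hGj j) (hgc.mul hv.1.continuous) hv.2.1.mul_left hts
  rw [integral_add i1 i2] at key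
  have e2 : ∫ x in Ω, g x * u x * dd j v x = ∫ x in Ω, u x * (g x * dd j v x) := by
    congr 1; funext x; ring
  have e3 : ∫ x in Ω, (g x * G j x + dd j g x * u x) * v x
      = (∫ x in Ω, G j x * (g x * v x)) + ∫ x in Ω, u x * (dd j g x * v x) := by
    rw [← integral_add i3 i1]; congr 1; funext x; ring
  rw [e2, e3]
  linear_combination key

end weakgrad

/-! ### The weak magnetic equation -/

section magnetic

variable {n : ℕ} {Ω : Set (E n)}

/-- The first order coefficients of the transpose of `L_{A,q}`. -/
def magB (A : E n → E n) (j : Fin n) (x : E n) : ℂ := 2 * Complex.I * (A x j : ℂ)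

/-- The zeroth order coefficient of the transpose of `L_{A,q}`. -/
def magC (A : E n → E n) (q : E n → ℂ) (x : E n) : ℂ :=
  (∑ j, (Complex.I * dd j (fun y => (A y j : ℂ)) x + (A x j : ℂ) ^ 2)) + q x

/-- `L_{A,q} u` for `u` of class `C²`. -/
def magL (A : E n → E n) (q : E n → ℂ) (u : E n → ℂ) (x : E n) : ℂ :=
  (∑ j, (-dd j (dd j u) x - 2 * Complex.I * (A x j : ℂ) * dd j u x
    + (-Complex.I * dd j (fun y => (A y j : ℂ)) x + (A x j : ℂ) ^ 2) * u x)) + q x * u x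

theorem contDiff_comp_ofReal {A : E n → E n} {k : WithTop ℕ∞} (hA : ContDiff ℝ k A) (j : Fin n) :
    ContDiff ℝ k fun y => (A y j : ℂ) := by
  have h1 : ContDiff ℝ k fun y => A y j :=
    (EuclideanSpace.proj (𝕜 := ℝ) j : E n →L[ℝ] ℝ).contDiff.comp hA
  exact Complex.ofRealCLM.contDiff.comp h1

theorem IsTest.integrable_mul {u f v : E n → ℂ} (hv : IsTest Ω v)
    (hu : LocallyIntegrableOn u Ω volume) (hf : Continuous f) (hfv : ∀ x, v x = 0 → f x = 0) :
    Integrable (fun x => u x * f x) (volume.restrict Ω) := by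
  have hs : Function.support f ⊆ Function.support v := fun x hx hx' => hx (hfv x hx')
  exact integrable_mul_of_locallyIntegrableOn hu hf (hv.2.1.mono hs)
    ((closure_mono hs).trans hv.2.2)

theorem IsTest.dd {v : E n → ℂ} (hv : IsTest Ω v) (j : Fin n) : IsTest Ω (dd j v) :=
  ⟨contDiff_dd (k := ∞) hv.1 (by simp), hasCompactSupport_dd hv.2.1,
    (tsupport_dd_subset v).trans hv.2.2⟩

/-- All derivatives are moved from u to w. With w the conjugate of the test function v, the left
side is the weak form of L_{A,q}, and the operator on the right is its bilinear transpose L_{-A,q}.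
-/
theorem integral_bilinear_eq (hΩ : IsOpen Ω) {A : E n → E n} (hA : ContDiff ℝ 2 A) {q : E n → ℂ}
    (hq : AEStronglyMeasurable q volume) {K : ℝ} (hqK : ∀ x, ‖q x‖ ≤ K) {u : E n → ℂ}
    {G : Fin n → E n → ℂ} (h : IsWeakGrad Ω u (vec G)) {w : E n → ℂ} (hw : IsTest Ω w) :
    ∫ x in Ω, ((∑ j, (-Complex.I * G j x + (A x j : ℂ) * u x)
        * (Complex.I * dd j w x + (A x j : ℂ) * w x)) + q x * u x * w x)
      = ∫ x in Ω, u x * ellOp (magB A) (magC A q) w x := by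
  have hAj := contDiff_comp_ofReal hA
  have hAc : ∀ j, Continuous fun y => (A y j : ℂ) := fun j => (hAj j).continuous
  have hdA : ∀ j, Continuous (dd j fun y => (A y j : ℂ)) := fun j =>
    (contDiff_dd (k := 1) (hAj j) (by norm_num)).continuous
  have hGj : ∀ j, LocallyIntegrableOn (G j) Ω volume := fun j => locallyIntegrableOn_apply h.2.1 j
  have hwc := hw.1.continuous
  have hwj : ∀ j, Continuous (dd j w) := fun j => (hw.dd j).1.continuous
  have hwjj : ∀ j, Continuous (dd j (dd j w)) := fun j => ((hw.dd j).dd j).1.continuous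
  have i1 : ∀ j, Integrable (fun x => G j x * dd j w x) (volume.restrict Ω) := fun j =>
    (hw.dd j).integrable_mul (hGj j) (hwj j) fun _ h => h
  have i2 : ∀ j, Integrable (fun x => G j x * ((A x j : ℂ) * w x)) (volume.restrict Ω) := fun j =>
    hw.integrable_mul (hGj j) ((hAc j).mul hwc) fun x h => by simp [h]
  have i3 : ∀ j, Integrable (fun x => u x * ((A x j : ℂ) * dd j w x)) (volume.restrict Ω) :=
    fun j => (hw.dd j).integrable_mul h.1 ((hAc j).mul (hwj j)) fun x h => by simp [h]
  have i4 : ∀ j, Integrable (fun x => u x * ((A x j : ℂ) ^ 2 * w x)) (volume.restrict Ω) :=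
    fun j => hw.integrable_mul h.1 (((hAc j).pow 2).mul hwc) fun x h => by simp [h]
  have i5 : ∀ j, Integrable (fun x => u x * dd j (dd j w) x) (volume.restrict Ω) := fun j =>
    ((hw.dd j).dd j).integrable_mul h.1 (hwjj j) fun _ h => h
  have i6 : ∀ j, Integrable (fun x => u x * (dd j (fun y => (A y j : ℂ)) x * w x))
      (volume.restrict Ω) := fun j =>
    hw.integrable_mul h.1 ((hdA j).mul hwc) fun x h => by simp [h]
  have i7 : Integrable (fun x => q x * u x * w x) (volume.restrict Ω) := by
    have := (hw.integrable_mul h.1 hwc fun _ h => h).bdd_mul (c := K)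
      hq.restrict (Filter.Eventually.of_forall hqK)
    simpa [mul_assoc] using this
  have w1 : ∀ j, ∫ x in Ω, G j x * dd j w x = -∫ x in Ω, u x * dd j (dd j w) x := fun j => by
    have := h.2.2 _ (hw.dd j) j
    rw [pd_eq_dd] at this
    simp only [vec_apply] at this
    rw [this, neg_neg]
  have w2 : ∀ j, ∫ x in Ω, G j x * ((A x j : ℂ) * w x)
      = -((∫ x in Ω, u x * (dd j (fun y => (A y j : ℂ)) x * w x))
        + ∫ x in Ω, u x * ((A x j : ℂ) * dd j w x)) := fun j => by
    have hts : tsupport (fun x => (A x j : ℂ) * w x) ⊆ Ω :=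
      (tsupport_mul_subset_right (f := fun x => (A x j : ℂ)) (g := w)).trans hw.2.2
    have hw1 : ContDiff ℝ 1 w := hw.1.of_le (by simp)
    have hA1 : ContDiff ℝ 1 fun y => (A y j : ℂ) := (hAj j).of_le (by norm_num)
    have := h.integral_mul_dd_of_contDiff_one hΩ (hA1.mul hw1) hw.2.1.mul_left hts j
    rw [← integral_add (i6 j) (i3 j)]
    simp only [vec_apply] at this
    rw [← neg_eq_iff_eq_neg, ← this]
    congr 1; funext x
    rw [dd_mul (hA1.differentiable (by norm_num) x) (hw1.differentiable (by norm_num) x), mul_add]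
  have lhs : ∀ x, ((∑ j, (-Complex.I * G j x + (A x j : ℂ) * u x)
        * (Complex.I * dd j w x + (A x j : ℂ) * w x)) + q x * u x * w x)
      = (∑ j, (G j x * dd j w x - Complex.I * (G j x * ((A x j : ℂ) * w x))
        + Complex.I * (u x * ((A x j : ℂ) * dd j w x)) + u x * ((A x j : ℂ) ^ 2 * w x)))
        + q x * u x * w x := fun x => by
    congr 1
    refine Finset.sum_congr rfl fun j _ => ?_
    linear_combination (-(G j x) * dd j w x) * Complex.I_mul_I
  have rhs : ∀ x, u x * ellOp (magB A) (magC A q) w x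
      = (∑ j, (-(u x * dd j (dd j w) x) + 2 * Complex.I * (u x * ((A x j : ℂ) * dd j w x))
        + Complex.I * (u x * (dd j (fun y => (A y j : ℂ)) x * w x))
        + u x * ((A x j : ℂ) ^ 2 * w x))) + q x * u x * w x := fun x => by
    simp only [ellOp, magB, magC]
    rw [add_mul, Finset.sum_mul, ← Finset.sum_neg_distrib, ← Finset.sum_add_distrib, ← add_assoc,
      ← Finset.sum_add_distrib, mul_add, Finset.mul_sum]
    congr 1
    · exact Finset.sum_congr rfl fun j _ => by ring
    · ring
  have iL : ∀ j, Integrable (fun x => G j x * dd j w x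
      - Complex.I * (G j x * ((A x j : ℂ) * w x))
        + Complex.I * (u x * ((A x j : ℂ) * dd j w x)) + u x * ((A x j : ℂ) ^ 2 * w x))
      (volume.restrict Ω) := fun j =>
    (((i1 j).sub ((i2 j).const_mul _)).add ((i3 j).const_mul _)).add (i4 j)
  have iR : ∀ j, Integrable (fun x => -(u x * dd j (dd j w) x)
        + 2 * Complex.I * (u x * ((A x j : ℂ) * dd j w x))
        + Complex.I * (u x * (dd j (fun y => (A y j : ℂ)) x * w x))
        + u x * ((A x j : ℂ) ^ 2 * w x)) (volume.restrict Ω) := fun j =>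
    (((i5 j).neg.add ((i3 j).const_mul _)).add ((i6 j).const_mul _)).add (i4 j)
  simp only [lhs, rhs]
  rw [integral_add (integrable_finsetSum _ fun j _ => iL j) i7,
    integral_add (integrable_finsetSum _ fun j _ => iR j) i7,
    integral_finsetSum _ fun j _ => iL j, integral_finsetSum _ fun j _ => iR j]
  congr 1
  refine Finset.sum_congr rfl fun j _ => ?_
  have eL := integral_add (((i1 j).sub ((i2 j).const_mul Complex.I)).add
    ((i3 j).const_mul Complex.I)) (i4 j)
  have eL2 := integral_add ((i1 j).sub ((i2 j).const_mul Complex.I)) ((i3 j).const_mul Complex.I)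
  have eL3 := integral_sub (i1 j) ((i2 j).const_mul Complex.I)
  have eR := integral_add (((i5 j).neg.add ((i3 j).const_mul (2 * Complex.I))).add
    ((i6 j).const_mul Complex.I)) (i4 j)
  have eR2 := integral_add ((i5 j).neg.add ((i3 j).const_mul (2 * Complex.I)))
    ((i6 j).const_mul Complex.I)
  have eR3 := integral_add (i5 j).neg ((i3 j).const_mul (2 * Complex.I))
  simp only [Pi.add_apply, Pi.sub_apply, Pi.neg_apply, integral_const_mul, integral_neg]
    at eL eL2 eL3 eR eR2 eR3
  rw [eL, eL2, eL3, eR, eR2, eR3, w1, w2]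
  ring

/-- For C² functions u the transpose is undone. It is applied to the explicit part e^{τZ} e^Φ of the
solution. -/
theorem integral_mul_ellOp_eq {A : E n → E n} (hA : ContDiff ℝ 2 A) {q : E n → ℂ}
    (hq : AEStronglyMeasurable q volume) {K : ℝ} (hqK : ∀ x, ‖q x‖ ≤ K) {u : E n → ℂ}
    (hu : ContDiff ℝ 2 u) {w : E n → ℂ} (hw : IsTest univ w) :
    ∫ x, u x * ellOp (magB A) (magC A q) w x = ∫ x, magL A q u x * w x := by
  have hAj := contDiff_comp_ofReal hA
  have hA1 : ∀ j, ContDiff ℝ 1 fun y => (A y j : ℂ) := fun j => (hAj j).of_le (by norm_num)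
  have hAc : ∀ j, Continuous fun y => (A y j : ℂ) := fun j => (hAj j).continuous
  have hdA : ∀ j, Continuous (dd j fun y => (A y j : ℂ)) := fun j =>
    (contDiff_dd (k := 1) (hAj j) (by norm_num)).continuous
  have huc := hu.continuous
  have hu1 : ContDiff ℝ 1 u := hu.of_le (by norm_num)
  have hduj : ∀ j, ContDiff ℝ 1 (dd j u) := fun j => contDiff_dd hu (by norm_num)
  have hduc : ∀ j, Continuous (dd j u) := fun j => (hduj j).continuous
  have hddu : ∀ j, Continuous (dd j (dd j u)) := fun j =>
    (contDiff_dd (k := 0) (hduj j) (by norm_num)).continuous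
  have hwc := hw.1.continuous
  have hwj : ∀ j, Continuous (dd j w) := fun j => (hw.dd j).1.continuous
  have hwjj : ∀ j, Continuous (dd j (dd j w)) := fun j => ((hw.dd j).dd j).1.continuous
  have int : ∀ {f v : E n → ℂ}, Continuous f → IsTest univ v → Integrable (fun x => f x * v x)
      volume := fun hf hv =>
    (hf.mul hv.1.continuous).integrable_of_hasCompactSupport hv.2.1.mul_left
  have i1 : ∀ j, Integrable (fun x => u x * dd j (dd j w) x) volume := fun j =>
    int huc ((hw.dd j).dd j)
  have i2 : ∀ j, Integrable (fun x => (u x * (A x j : ℂ)) * dd j w x) volume := fun j =>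
    int (huc.mul (hAc j)) (hw.dd j)
  have i3 : ∀ j, Integrable (fun x => (u x * dd j (fun y => (A y j : ℂ)) x) * w x) volume :=
    fun j => int (huc.mul (hdA j)) hw
  have i4 : ∀ j, Integrable (fun x => (u x * (A x j : ℂ) ^ 2) * w x) volume := fun j =>
    int (huc.mul ((hAc j).pow 2)) hw
  have i5 : ∀ j, Integrable (fun x => dd j (dd j u) x * w x) volume := fun j => int (hddu j) hw
  have i6 : ∀ j, Integrable (fun x => ((A x j : ℂ) * dd j u x) * w x) volume := fun j =>
    int ((hAc j).mul (hduc j)) hw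
  have i7 : Integrable (fun x => q x * (u x * w x)) volume :=
    (int huc hw).bdd_mul (c := K) hq (Filter.Eventually.of_forall hqK)
  have w1 : ∀ j, ∫ x, u x * dd j (dd j w) x = ∫ x, dd j (dd j u) x * w x := fun j => by
    rw [integral_mul_dd hu1 ((hw.dd j).1.of_le (by simp)) (hw.dd j).2.1,
      integral_mul_dd (hduj j) (hw.1.of_le (by simp)) hw.2.1, neg_neg]
  have w2 : ∀ j, ∫ x, (u x * (A x j : ℂ)) * dd j w x
      = -((∫ x, (u x * dd j (fun y => (A y j : ℂ)) x) * w x)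
        + ∫ x, ((A x j : ℂ) * dd j u x) * w x) := fun j => by
    rw [integral_mul_dd (hu1.mul (hA1 j)) (hw.1.of_le (by simp)) hw.2.1,
      ← integral_add (i3 j) (i6 j)]
    congr 2; funext x
    rw [dd_mul (hu1.differentiable (by norm_num) x) ((hA1 j).differentiable (by norm_num) x)]
    ring
  have lhs : ∀ x, u x * ellOp (magB A) (magC A q) w x
      = (∑ j, (-(u x * dd j (dd j w) x) + 2 * Complex.I * ((u x * (A x j : ℂ)) * dd j w x)
        + Complex.I * ((u x * dd j (fun y => (A y j : ℂ)) x) * w x)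
        + (u x * (A x j : ℂ) ^ 2) * w x)) + q x * (u x * w x) := fun x => by
    simp only [ellOp, magB, magC]
    rw [add_mul, Finset.sum_mul, ← Finset.sum_neg_distrib, ← Finset.sum_add_distrib, ← add_assoc,
      ← Finset.sum_add_distrib, mul_add, Finset.mul_sum]
    congr 1
    · exact Finset.sum_congr rfl fun j _ => by ring
    · ring
  have rhs : ∀ x, magL A q u x * w x
      = (∑ j, (-(dd j (dd j u) x * w x) + -(2 * Complex.I) * (((A x j : ℂ) * dd j u x) * w x)
        + -Complex.I * ((u x * dd j (fun y => (A y j : ℂ)) x) * w x)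
        + (u x * (A x j : ℂ) ^ 2) * w x)) + q x * (u x * w x) := fun x => by
    simp only [magL]
    rw [add_mul, Finset.sum_mul, mul_assoc (q x)]
    congr 1
    exact Finset.sum_congr rfl fun j _ => by ring
  have comb : ∀ {f1 f2 f3 f4 : E n → ℂ} (a b : ℂ), Integrable f1 volume → Integrable f2 volume →
      Integrable f3 volume → Integrable f4 volume →
      Integrable (fun x => -(f1 x) + a * f2 x + b * f3 x + f4 x) volume ∧
      ∫ x, (-(f1 x) + a * f2 x + b * f3 x + f4 x)
        = -(∫ x, f1 x) + a * (∫ x, f2 x) + b * (∫ x, f3 x) + ∫ x, f4 x := by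
    intro f1 f2 f3 f4 a b h1 h2 h3 h4
    refine ⟨((h1.neg.add (h2.const_mul a)).add (h3.const_mul b)).add h4, ?_⟩
    have e1 := integral_add ((h1.neg.add (h2.const_mul a)).add (h3.const_mul b)) h4
    have e2 := integral_add (h1.neg.add (h2.const_mul a)) (h3.const_mul b)
    have e3 := integral_add h1.neg (h2.const_mul a)
    simp only [Pi.add_apply, Pi.neg_apply, integral_const_mul, integral_neg] at e1 e2 e3
    rw [e1, e2, e3]
  have cL := fun j => comb (2 * Complex.I) Complex.I (i1 j) (i2 j) (i3 j) (i4 j)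
  have cR := fun j => comb (-(2 * Complex.I)) (-Complex.I) (i5 j) (i6 j) (i3 j) (i4 j)
  simp only [lhs, rhs]
  rw [integral_add (integrable_finsetSum _ fun j _ => (cL j).1) i7,
    integral_add (integrable_finsetSum _ fun j _ => (cR j).1) i7,
    integral_finsetSum _ fun j _ => (cL j).1, integral_finsetSum _ fun j _ => (cR j).1]
  congr 1
  refine Finset.sum_congr rfl fun j _ => ?_
  rw [(cL j).2, (cR j).2, w1, w2]
  ring

/-- The WKB computation: the coefficient of τ² is a multiple of (∇Z)², that of τ a multiple of the
transport expression, so the exponential passes through the operator at this point. -/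
theorem magL_exp_mul {A : E n → E n} {q : E n → ℂ} {Z Φ : E n → ℂ} {x : E n} (τ : ℂ)
    (hZ : ContDiff ℝ 2 Z) (hΦ : ContDiff ℝ 2 Φ) (heik : ∑ j, dd j Z x ^ 2 = 0)
    (htr : (∑ j, dd j Z x * dd j Φ x) + Complex.I * (∑ j, dd j Z x * (A x j : ℂ))
      + (1 / 2 : ℂ) * ∑ j, dd j (dd j Z) x = 0) :
    magL A q (fun y => Complex.exp (τ * Z y) * Complex.exp (Φ y)) x
      = Complex.exp (τ * Z x) * magL A q (fun y => Complex.exp (Φ y)) x := by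
  have d1 : ∀ {f : E n → ℂ}, ContDiff ℝ 2 f → ∀ y, DifferentiableAt ℝ f y :=
    fun hf y => hf.differentiable (by norm_num) y
  have d2 : ∀ {f : E n → ℂ}, ContDiff ℝ 2 f → ∀ j y, DifferentiableAt ℝ (dd j f) y :=
    fun hf j y => (contDiff_dd (k := 1) hf (by norm_num)).differentiable (by norm_num) y
  have hg : ∀ (s : ℂ) (F g : E n → ℂ) j y, ContDiff ℝ 2 F → DifferentiableAt ℝ g y →
      dd j (fun z => Complex.exp (s * F z) * g z) y
        = Complex.exp (s * F y) * (s * dd j F y * g y + dd j g y) := by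
    intro s F g j y hF hg
    rw [dd_mul ((d1 hF y).const_mul s).cexp hg, dd_cexp ((d1 hF y).const_mul s),
      dd_const_mul _ (d1 hF y)]
    ring
  set a : E n → ℂ := fun y => Complex.exp (Φ y) with ha
  have haC : ContDiff ℝ 2 a := hΦ.cexp
  have haj : ∀ j, dd j a x = a x * dd j Φ x := fun j => dd_cexp (d1 hΦ x)
  have h1 : ∀ j, dd j (fun y => Complex.exp (τ * Z y) * a y)
      = fun y => Complex.exp (τ * Z y) * (τ * dd j Z y * a y + dd j a y) := fun j =>
    funext fun y => hg τ Z a j y hZ (d1 haC y)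
  have h2 : ∀ j, dd j (fun y => Complex.exp (τ * Z y) * (τ * dd j Z y * a y + dd j a y)) x
      = Complex.exp (τ * Z x) * (τ * dd j Z x * (τ * dd j Z x * a x + dd j a x)
        + (τ * dd j (dd j Z) x * a x + τ * dd j Z x * dd j a x + dd j (dd j a) x)) := by
    intro j
    have a1 := ((d2 hZ j x).const_mul τ).fun_mul (d1 haC x)
    rw [hg τ Z _ j x hZ (a1.fun_add (d2 haC j x)), dd_add a1 (d2 haC j x),
      dd_mul ((d2 hZ j x).const_mul τ) (d1 haC x), dd_const_mul _ (d2 hZ j x)]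
  change magL A q (fun y => Complex.exp (τ * Z y) * a y) x = _ * magL A q a x
  simp only [magL, h1, h2, haj]
  have e : ∀ j, -(Complex.exp (τ * Z x) * (τ * dd j Z x * (τ * dd j Z x * a x + a x * dd j Φ x)
        + (τ * dd j (dd j Z) x * a x + τ * dd j Z x * (a x * dd j Φ x) + dd j (dd j a) x)))
      - 2 * Complex.I * (A x j : ℂ)
        * (Complex.exp (τ * Z x) * (τ * dd j Z x * a x + a x * dd j Φ x))
      + (-Complex.I * dd j (fun y => (A y j : ℂ)) x + (A x j : ℂ) ^ 2)
        * (Complex.exp (τ * Z x) * a x)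
      = Complex.exp (τ * Z x) * (-dd j (dd j a) x - 2 * Complex.I * (A x j : ℂ) * (a x * dd j Φ x)
          + (-Complex.I * dd j (fun y => (A y j : ℂ)) x + (A x j : ℂ) ^ 2) * a x)
        - Complex.exp (τ * Z x) * a x * (τ ^ 2 * dd j Z x ^ 2 + 2 * τ * (dd j Z x * dd j Φ x
          + Complex.I * (dd j Z x * (A x j : ℂ)) + (1 / 2 : ℂ) * dd j (dd j Z) x)) := fun j => by
    ring
  rw [Finset.sum_congr rfl fun j _ => e j, Finset.sum_sub_distrib, ← Finset.mul_sum,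
    ← Finset.mul_sum]
  have z : ∑ j, (τ ^ 2 * dd j Z x ^ 2 + 2 * τ * (dd j Z x * dd j Φ x
          + Complex.I * (dd j Z x * (A x j : ℂ)) + (1 / 2 : ℂ) * dd j (dd j Z) x)) = 0 := by
    rw [Finset.sum_add_distrib, ← Finset.mul_sum, ← Finset.mul_sum, heik, Finset.sum_add_distrib,
      Finset.sum_add_distrib, ← Finset.mul_sum, ← Finset.mul_sum, htr]
    ring
  rw [z]
  ring

end magnetic

/-! ### Construction of the remainder -/

section remainder

variable {n : ℕ} {Ω : Set (E n)}

theorem memLp_restrict_continuous_mul (hΩm : MeasurableSet Ω) (hΩ : IsCompact (closure Ω))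
    {g f : E n → ℂ} (hg : Continuous g) (hf : MemLp f 2 (volume.restrict Ω)) :
    MemLp (fun x => g x * f x) 2 (volume.restrict Ω) := by
  obtain ⟨B, hB⟩ := hΩ.exists_bound_of_continuousOn hg.continuousOn
  refine hf.of_le_mul (c := B) (hg.aestronglyMeasurable.mul hf.1) ?_
  refine (ae_restrict_iff' hΩm).2 (Filter.Eventually.of_forall fun x hx => ?_)
  rw [norm_mul]
  exact mul_le_mul_of_nonneg_right (hB x (subset_closure hx)) (norm_nonneg _)

theorem memLp_restrict_of_continuous (hΩm : MeasurableSet Ω) (hΩ : IsCompact (closure Ω))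
    {g : E n → ℂ} (hg : Continuous g) : MemLp g 2 (volume.restrict Ω) := by
  have : IsFiniteMeasure (volume.restrict Ω) := ⟨by
    rw [Measure.restrict_apply_univ]
    exact (measure_mono subset_closure).trans_lt hΩ.measure_lt_top⟩
  simpa using memLp_restrict_continuous_mul hΩm hΩ hg (memLp_const (1 : ℂ))

/-- The Carleman estimate is stated with coefficients bounded everywhere on ℝⁿ; truncating a
measurable version of q changes it only on a null set of Ω. -/
theorem exists_bounded_representative {q : E n → ℂ}
    (hq : MemLp q ∞ (volume.restrict Ω)) :
    ∃ (q' : E n → ℂ) (K : ℝ), AEStronglyMeasurable q' volume ∧ (∀ x, ‖q' x‖ ≤ K) ∧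
      ∀ᵐ x ∂(volume.restrict Ω), q x = q' x := by
  obtain ⟨C, hC⟩ : ∃ C : ℝ, ∀ᵐ x ∂(volume.restrict Ω), ‖q x‖ ≤ C := by
    have h := hq.2
    rw [eLpNorm_exponent_top] at h
    obtain ⟨C, hC⟩ := ENNReal.lt_iff_exists_nnreal_btwn.1 h
    refine ⟨C, ?_⟩
    filter_upwards [ae_le_eLpNormEssSup (f := q) (μ := volume.restrict Ω)] with x hx
    have := hx.trans hC.1.le
    exact_mod_cast this
  set g := hq.1.mk q with hg
  have hgm : Measurable g := hq.1.stronglyMeasurable_mk.measurable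
  have hS : MeasurableSet {x | ‖g x‖ ≤ C} := measurableSet_le hgm.norm measurable_const
  refine ⟨(({x | ‖g x‖ ≤ C}).indicator g), max C 0, (hgm.indicator hS).aestronglyMeasurable,
    fun x => ?_, ?_⟩
  · by_cases hx : ‖g x‖ ≤ C
    · rw [indicator_of_mem (s := {x | ‖g x‖ ≤ C}) hx]; exact hx.trans (le_max_left _ _)
    · rw [indicator_of_notMem (s := {x | ‖g x‖ ≤ C}) hx]; simp
  · filter_upwards [hC, hq.1.ae_eq_mk] with x hx hx'
    have hx'' : q x = g x := hx'
    rw [indicator_of_mem (s := {x | ‖g x‖ ≤ C}) (by rw [mem_ofPred_eq, ← hx'']; exact hx), hx'']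

theorem IsTest.conj {v : E n → ℂ} (hv : IsTest Ω v) :
    IsTest Ω fun x => (starRingEnd ℂ) (v x) := by
  have hts : Function.support (fun x => (starRingEnd ℂ) (v x)) ⊆ Function.support v :=
    fun x hx hx' => hx (by simp [hx'])
  exact ⟨Complex.conjCLE.contDiff.comp hv.1, hv.2.1.mono hts, (closure_mono hts).trans hv.2.2⟩

theorem dd_conj {v : E n → ℂ} {j : Fin n} {x : E n} (hv : DifferentiableAt ℝ v x) :
    dd j (fun y => (starRingEnd ℂ) (v y)) x = (starRingEnd ℂ) (dd j v x) :=
  dd_clm_comp (Complex.conjCLE : ℂ →L[ℝ] ℂ) hv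

theorem setIntegral_mul_ellOp {β : Fin n → E n → ℂ} {γ u w : E n → ℂ} (hw : IsTest Ω w) :
    ∫ x in Ω, u x * ellOp β γ w x = ∫ x, u x * ellOp β γ w x :=
  setIntegral_eq_integral_of_forall_compl_eq_zero fun x hx => by
    rw [ellOp_eq_zero fun h' => hx (hw.2.2 h'), mul_zero]

theorem exists_bound_mag {A : E n → E n} (hA : ContDiff ℝ 2 A) (hAc : HasCompactSupport A)
    {q : E n → ℂ} {K : ℝ} (hqK : ∀ x, ‖q x‖ ≤ K) :
    ∃ K', 0 ≤ K' ∧ (∀ j x, ‖magB A j x‖ ≤ K') ∧ ∀ x, ‖magC A q x‖ ≤ K' := by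
  have hAj := contDiff_comp_ofReal hA
  have hAcj : ∀ j, HasCompactSupport fun y => (A y j : ℂ) := fun j =>
    hAc.mono fun x hx hx' => hx (by simp [hx'])
  have hdA : ∀ j, Continuous (dd j fun y => (A y j : ℂ)) := fun j =>
    (contDiff_dd (k := 1) (hAj j) (by norm_num)).continuous
  choose B1 h1 using fun j => (hAcj j).exists_bound_of_continuous (hAj j).continuous
  choose B2 h2 using fun j =>
    (hasCompactSupport_dd (j := j) (hAcj j)).exists_bound_of_continuous (hdA j)
  have p1 : ∀ j, 0 ≤ B1 j := fun j => (norm_nonneg _).trans (h1 j 0)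
  have p2 : ∀ j, 0 ≤ B2 j := fun j => (norm_nonneg _).trans (h2 j 0)
  have hK : 0 ≤ K := (norm_nonneg _).trans (hqK 0)
  have s1 : 0 ≤ ∑ j, (B2 j + B1 j ^ 2) := Finset.sum_nonneg fun j _ => by
    have := p2 j; positivity
  have s2 : 0 ≤ ∑ j, B1 j := Finset.sum_nonneg fun j _ => p1 j
  refine ⟨2 * (∑ j, B1 j) + ((∑ j, (B2 j + B1 j ^ 2)) + K), by positivity, fun j x => ?_,
    fun x => ?_⟩
  · have : ‖magB A j x‖ ≤ 2 * B1 j := by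
      rw [magB, norm_mul, norm_mul, Complex.norm_I]
      norm_num only [RCLike.norm_ofNat, mul_one]
      exact mul_le_mul_of_nonneg_left (h1 j x) (by norm_num)
    have h3 := Finset.single_le_sum (f := B1) (fun i _ => p1 i) (Finset.mem_univ j)
    linarith
  · have : ‖magC A q x‖ ≤ (∑ j, (B2 j + B1 j ^ 2)) + K := by
      refine (norm_add_le _ _).trans (add_le_add ((norm_sum_le _ _).trans
        (Finset.sum_le_sum fun j _ => (norm_add_le _ _).trans (add_le_add ?_ ?_))) (hqK x))
      · rw [norm_mul, Complex.norm_I, one_mul]; exact h2 j x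
      · rw [norm_pow]; have := h1 j x; gcongr
    linarith

theorem aestronglyMeasurable_mag {A : E n → E n} (hA : ContDiff ℝ 2 A) {q : E n → ℂ}
    (hq : AEStronglyMeasurable q volume) :
    (∀ j, AEStronglyMeasurable (magB A j) volume) ∧ AEStronglyMeasurable (magC A q) volume := by
  have hAj := fun j => (contDiff_comp_ofReal hA j).continuous
  have hdA : ∀ j, Continuous (dd j fun y => (A y j : ℂ)) := fun j =>
    (contDiff_dd (k := 1) (contDiff_comp_ofReal hA j) (by norm_num)).continuous
  exact ⟨fun j => (continuous_const.mul (hAj j)).aestronglyMeasurable,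
    (continuous_finsetSum _ fun j _ =>
      (continuous_const.mul (hdA j)).add ((hAj j).pow 2)).aestronglyMeasurable.add hq⟩

theorem memLp_indicator_magL (hΩm : MeasurableSet Ω) (hΩ : IsCompact (closure Ω))
    {A : E n → E n} (hA : ContDiff ℝ 2 A) {q : E n → ℂ} (hq : AEStronglyMeasurable q volume)
    {K : ℝ} (hqK : ∀ x, ‖q x‖ ≤ K) {a : E n → ℂ} (ha : ContDiff ℝ 2 a) :
    MemLp (Ω.indicator (magL A q a)) 2 volume := by
  rw [memLp_indicator_iff_restrict hΩm]
  have hAj := fun j => (contDiff_comp_ofReal hA j).continuous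
  have hdA : ∀ j, Continuous (dd j fun y => (A y j : ℂ)) := fun j =>
    (contDiff_dd (k := 1) (contDiff_comp_ofReal hA j) (by norm_num)).continuous
  have ha0 := ha.continuous
  have ha1 : ∀ j, Continuous (dd j a) := fun j =>
    (contDiff_dd (k := 1) ha (by norm_num)).continuous
  have ha2 : ∀ j, Continuous (dd j (dd j a)) := fun j =>
    (contDiff_dd (k := 0) (contDiff_dd (k := 1) ha (by norm_num)) (by norm_num)).continuous
  refine MemLp.add (memLp_restrict_of_continuous hΩm hΩ (continuous_finsetSum _ fun j _ => ?_)) ?_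
  · exact ((ha2 j).neg.sub ((continuous_const.mul (hAj j)).mul (ha1 j))).add
      (((continuous_const.mul (hdA j)).add ((hAj j).pow 2)).mul ha0)
  · exact (memLp_restrict_of_continuous hΩm hΩ ha0).of_le_mul (c := K)
      (hq.restrict.mul ha0.aestronglyMeasurable) (Filter.Eventually.of_forall fun x => by
        rw [norm_mul]; exact mul_le_mul_of_nonneg_right (hqK x) (norm_nonneg _))

/-- The `H¹_scl` bound for `r = τ e^{-iτY} R`, `h = 1/τ`. -/
theorem normH1scl_oscillating_le (hΩo : IsOpen Ω) {R : E n → ℂ} {D : Fin n → E n → ℂ}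
    (hR : MemLp R 2 volume) (hD : ∀ j, MemLp (D j) 2 volume) (hRD : IsWeakGrad Ω R (vec D))
    {Y : E n → ℝ} (hY : ContDiff ℝ 2 Y) {B c τ h : ℝ} (hh : 0 < h) (hτ : τ = h⁻¹)
    (hB : ∀ j, ∀ x ∈ Ω, |dd j Y x| ≤ B)
    (hRc : τ * l2 R ≤ c) (hDc : ∀ j, l2 (D j) ≤ c) :
    normH1scl Ω h (fun x => τ * Complex.exp (-(τ * Complex.I * Y x)) * R x)
      ≤ Real.sqrt (n * (2 * c ^ 2 + 2 * B ^ 2 * c ^ 2) + c ^ 2) := by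
  have hτ0 : 0 < τ := by rw [hτ]; positivity
  have hhτ : (h : ℂ) * τ = 1 := by
    rw [hτ, ← Complex.ofReal_mul, mul_inv_cancel₀ hh.ne', Complex.ofReal_one]
  have hYc : ContDiff ℝ 2 fun x => (Y x : ℂ) := Complex.ofRealCLM.contDiff.comp hY
  have hg : ContDiff ℝ 2 fun x => (τ : ℂ) * Complex.exp (-(τ * Complex.I * Y x)) :=
    contDiff_const.mul ((contDiff_const.mul hYc).neg.cexp)
  have hgrad := IsWeakGrad.contDiff_mul hΩo (hg.of_le (by norm_num)) hRD
  have hdg : ∀ j x, dd j (fun x => (τ : ℂ) * Complex.exp (-(τ * Complex.I * Y x))) x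
      = τ * (Complex.exp (-(τ * Complex.I * Y x)) * -(τ * Complex.I * ((dd j Y x : ℝ) : ℂ))) :=
      fun j x => by
    have d := hY.differentiable (by norm_num) x
    have dc := hYc.differentiable (by norm_num) x
    rw [dd_const_mul _ (dc.const_mul _).fun_neg.cexp, dd_cexp (dc.const_mul _).fun_neg, dd_neg,
      dd_const_mul _ dc, dd_ofReal d]
  have hen : ∀ x, ‖Complex.exp (-(τ * Complex.I * Y x))‖ = 1 := fun x => by
    rw [show -((τ : ℂ) * Complex.I * Y x) = ((-(τ * Y x) : ℝ) : ℂ) * Complex.I by push_cast; ring,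
      Complex.norm_exp_ofReal_mul_I]
  have hsq : ∀ {f : E n → ℂ}, MemLp f 2 volume → ∀ {s : ℝ}, 0 ≤ s →
      ∀ {t : ℝ}, s * l2 f ≤ t → s ^ 2 * ∫ x in Ω, ‖f x‖ ^ 2 ≤ t ^ 2 := by
    intro f hf s hs t ht
    have h1 : ∫ x in Ω, ‖f x‖ ^ 2 ≤ l2 f ^ 2 := by
      rw [l2_sq]
      exact setIntegral_le_integral (integrable_sq_norm hf)
        (Filter.Eventually.of_forall fun x => sq_nonneg _)
    calc s ^ 2 * ∫ x in Ω, ‖f x‖ ^ 2 ≤ s ^ 2 * l2 f ^ 2 := by gcongr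
      _ = (s * l2 f) ^ 2 := by ring
      _ ≤ t ^ 2 := pow_le_pow_left₀ (mul_nonneg hs (l2_nonneg _)) ht 2
  refine Real.sqrt_le_sqrt (add_le_add ?_ ?_)
  · have hint : ∀ j, Integrable (fun x => 2 * ‖D j x‖ ^ 2 + 2 * B ^ 2 * (τ ^ 2 * ‖R x‖ ^ 2))
        (volume.restrict Ω) := fun j =>
      ((integrable_sq_norm (hD j)).restrict.const_mul 2).add
        (((integrable_sq_norm hR).restrict.const_mul (τ ^ 2)).const_mul (2 * B ^ 2))
    have hle : ∀ᵐ x ∂(volume.restrict Ω), ‖(h : ℂ) • weakGrad Ω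
        (fun x => τ * Complex.exp (-(τ * Complex.I * Y x)) * R x) x‖ ^ 2
          ≤ ∑ j, (2 * ‖D j x‖ ^ 2 + 2 * B ^ 2 * (τ ^ 2 * ‖R x‖ ^ 2)) := by
      filter_upwards [hgrad.weakGrad_ae_eq hΩo, ae_restrict_mem hΩo.measurableSet] with x hx hxΩ
      rw [hx, EuclideanSpace.norm_sq_eq]
      refine Finset.sum_le_sum fun j _ => ?_
      -- Since hτ = 1, h∇r is a unimodular factor times D - i∇Y(τR): the oscillation costs one
      -- factor τ, which R = O(1/τ) compensates.
      have e : ((h : ℂ) • vec (fun j x => (τ : ℂ) * Complex.exp (-(τ * Complex.I * Y x)) * D j x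
          + dd j (fun x => (τ : ℂ) * Complex.exp (-(τ * Complex.I * Y x))) x * R x) x) j
          = Complex.exp (-(τ * Complex.I * Y x))
            * (D j x - Complex.I * ((dd j Y x : ℝ) : ℂ) * (τ * R x)) := by
        rw [PiLp.smul_apply, vec_apply, hdg, smul_eq_mul]
        linear_combination (Complex.exp (-(τ * Complex.I * Y x))
            * (D j x - Complex.I * ((dd j Y x : ℝ) : ℂ) * (τ * R x))) * hhτ
      rw [e, norm_mul, hen, one_mul]
      have h1 : ‖D j x - Complex.I * ((dd j Y x : ℝ) : ℂ) * (τ * R x)‖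
          ≤ ‖D j x‖ + B * (τ * ‖R x‖) := by
        refine (norm_sub_le _ _).trans (add_le_add le_rfl ?_)
        rw [norm_mul, norm_mul, norm_mul, Complex.norm_I, one_mul, Complex.norm_real,
          Complex.norm_real, Real.norm_eq_abs, Real.norm_of_nonneg hτ0.le]
        exact mul_le_mul_of_nonneg_right (hB j x hxΩ) (by positivity)
      calc _ ≤ (‖D j x‖ + B * (τ * ‖R x‖)) ^ 2 := pow_le_pow_left₀ (norm_nonneg _) h1 2
        _ ≤ _ := by nlinarith [sq_nonneg (‖D j x‖ - B * (τ * ‖R x‖))]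
    refine (integral_mono_of_nonneg (Filter.Eventually.of_forall fun x => sq_nonneg _)
      (integrable_finsetSum _ fun j _ => hint j) hle).trans ?_
    rw [integral_finsetSum _ fun j _ => hint j]
    have hj : ∀ j ∈ (Finset.univ : Finset (Fin n)),
        ∫ x in Ω, (2 * ‖D j x‖ ^ 2 + 2 * B ^ 2 * (τ ^ 2 * ‖R x‖ ^ 2))
          ≤ 2 * c ^ 2 + 2 * B ^ 2 * c ^ 2 := fun j _ => by
      rw [integral_add ((integrable_sq_norm (hD j)).restrict.const_mul 2)
        (((integrable_sq_norm hR).restrict.const_mul (τ ^ 2)).const_mul (2 * B ^ 2)),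
        integral_const_mul, integral_const_mul, integral_const_mul]
      have h1 := hsq (hD j) (s := 1) zero_le_one ((one_mul _).trans_le (hDc j))
      have h2 := hsq hR hτ0.le hRc
      rw [one_pow, one_mul] at h1
      gcongr
    refine (Finset.sum_le_sum hj).trans_eq ?_
    rw [Finset.sum_const, Finset.card_univ, Fintype.card_fin, nsmul_eq_mul]
  · have e : ∀ x, ‖(τ : ℂ) * Complex.exp (-(τ * Complex.I * Y x)) * R x‖ ^ 2
        = τ ^ 2 * ‖R x‖ ^ 2 := fun x => by
      rw [norm_mul, norm_mul, hen, Complex.norm_real, Real.norm_of_nonneg hτ0.le]; ring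
    simp only [e]
    rw [integral_const_mul]
    exact hsq hR hτ0.le hRc

/-- The threshold is chosen before Z: only its real part, the common weight p, is seen by the
Carleman estimate, while Im Z enters through unimodular factors in the source and in r. The constant
C may depend on Z and Φ. -/
theorem exists_remainder (hΩo : IsOpen Ω) (hΩc : IsCompact (closure Ω)) {x₀ : E n}
    {U : Set (E n)} {M : ℝ} {p : E n → ℝ} (hp : IsLogWeight x₀ U M p) (hM : 0 ≤ M)
    (hU : closure Ω ⊆ U) {A A' : E n → E n} (hA' : ContDiff ℝ 2 A') (hAA' : EqOn A A' (closure Ω))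
    {q : E n → ℂ} (hq : MemLp q ∞ (volume.restrict Ω)) :
    ∃ h₀ : ℝ, 0 < h₀ ∧ ∀ Z : E n → ℂ, ContDiff ℝ 2 Z → (∀ x ∈ Ω, (Z x).re = p x) →
      (∀ x ∈ Ω, ∑ j, dd j Z x ^ 2 = 0) → ∀ Φ : E n → ℂ, ContDiff ℝ 2 Φ →
      (∀ x ∈ Ω, (∑ j, dd j Z x * dd j Φ x) + Complex.I * (∑ j, dd j Z x * (A x j : ℂ))
        + (1 / 2 : ℂ) * ∑ j, dd j (dd j Z) x = 0) →
      ∃ (C : ℝ) (r : ℝ → E n → ℂ), ∀ h : ℝ, 0 < h → h ≤ h₀ →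
        MemH1 Ω (r h) ∧ normH1scl Ω h (r h) ≤ C ∧ ∀ u : E n → ℂ,
          EqOn u (fun x => Complex.exp (Z x / h) * (Complex.exp (Φ x) + h * r h x)) Ω →
          IsMagneticSolution Ω A q u := by
  have hΩm := hΩo.measurableSet
  -- A is cut off outside the closure of Ω so that it and its derivatives are bounded on ℝⁿ.
  obtain ⟨Ac, hAc, hAcs, hAAc⟩ : ∃ Ac : E n → E n, ContDiff ℝ 2 Ac ∧ HasCompactSupport Ac ∧
      EqOn A Ac Ω := by
    obtain ⟨χ, h1, h2, -, W, -, hW, h3⟩ := exists_cutoff hΩc isOpen_univ (subset_univ _)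
    refine ⟨fun x => χ x • A' x, (contDiff_two_of_infty h1).smul hA', h2.smul_right,
      fun x hx => ?_⟩
    simp [h3 x (hW (subset_closure hx)), hAA' (subset_closure hx)]
  obtain ⟨q', K, hq'm, hq'K, hqq'⟩ := exists_bounded_representative hq
  obtain ⟨K', hK'0, hBK, hCK⟩ := exists_bound_mag hAc hAcs hq'K
  obtain ⟨hBm, hCm⟩ := aestronglyMeasurable_mag hAc hq'm
  obtain ⟨χ, hχ1, hχ2, hχ3, W, -, hW, hχ4⟩ := exists_cutoff hΩc hp.isOpen hU
  set X : E n → ℂ := fun x => (χ x : ℂ) with hX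
  have hXs : Function.support X ⊆ Function.support χ := fun x hx hx' => hx (by simp [hX, hx'])
  obtain ⟨C, τ₀, hC, hτ₀, hsol⟩ := hp.exists_h1_solution hM hK'0 (X := X)
    (Complex.ofRealCLM.contDiff.comp hχ1) (hχ2.mono hXs) ((closure_mono hXs).trans hχ3)
  have hτ₀0 : 0 < τ₀ := by linarith
  refine ⟨τ₀⁻¹, by positivity, ?_⟩
  intro Z hZ hZp heik Φ hΦ htr
  set Y : E n → ℝ := fun x => (Z x).im with hY
  have hYC : ContDiff ℝ 2 Y := Complex.imCLM.contDiff.comp hZ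
  have hYc : ContDiff ℝ 2 fun x => (Y x : ℂ) := Complex.ofRealCLM.contDiff.comp hYC
  have hZY : ∀ x ∈ Ω, Z x = p x + Complex.I * Y x := fun x hx => by
    rw [← hZp x hx, mul_comm]; exact (Complex.re_add_im _).symm
  have hp2 : ContDiff ℝ 2 fun x => (p x : ℂ) :=
    Complex.ofRealCLM.contDiff.comp (contDiff_two_of_infty hp.contDiff)
  set a : E n → ℂ := fun x => Complex.exp (Φ x) with ha
  have haC : ContDiff ℝ 2 a := hΦ.cexp
  set k : E n → ℂ := Ω.indicator (magL Ac q' a) with hk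
  have hkm : MemLp k 2 volume := memLp_indicator_magL hΩm hΩc hAc hq'm hq'K haC
  -- The source is chosen to cancel L(e^{τZ} e^Φ) = e^{τp} e^{iτY} L(e^Φ) on Ω; its L² norm is
  -- bounded by that of k for every τ.
  set f : ℝ → E n → ℂ := fun (τ : ℝ) x => -Complex.exp (τ * Complex.I * Y x) * k x with hf
  have hfn : ∀ (τ : ℝ) x, ‖-Complex.exp (τ * Complex.I * Y x)‖ ≤ 1 := fun τ x => by
    rw [norm_neg, show ((τ : ℂ) * Complex.I * Y x) = ((τ * Y x : ℝ) : ℂ) * Complex.I by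
      push_cast; ring, Complex.norm_exp_ofReal_mul_I]
  have hfc : ∀ τ : ℝ, Continuous fun x => -Complex.exp ((τ : ℂ) * Complex.I * Y x) := fun τ =>
    (contDiff_const.mul hYc).cexp.neg.continuous
  have hfm : ∀ τ, MemLp (f τ) 2 volume := fun τ =>
    memLp_bdd_mul (hfc τ).aestronglyMeasurable (hfn τ) hkm
  have hfl : ∀ τ, l2 (f τ) ≤ l2 k := fun τ => by
    have := l2_bdd_mul_le zero_le_one (hfc τ).aestronglyMeasurable (hfn τ) hkm
    rwa [one_mul] at this
  choose! R D hRm hDm hRl hDl hRw hRD using fun (τ : ℝ) (hτ : τ₀ ≤ τ) =>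
    hsol (magB Ac) (magC Ac q') hBm hCm hBK hCK τ hτ (f τ) (hfm τ)
  obtain ⟨B, hB⟩ : ∃ B : ℝ, ∀ j, ∀ x ∈ Ω, |dd j Y x| ≤ B := by
    choose b hb using fun j => hΩc.exists_bound_of_continuousOn
      (contDiff_dd (j := j) (k := 1) hYC (by norm_num)).continuous.continuousOn
    refine ⟨∑ j, |b j|, fun j x hx => ((hb j x (subset_closure hx)).trans (le_abs_self _)).trans ?_⟩
    exact Finset.single_le_sum (f := fun j => |b j|) (fun i _ => abs_nonneg _) (Finset.mem_univ j)
  set c := C * l2 k with hc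
  -- The remainder is r = τ e^{-iτY} R with τ = 1/h, so that e^{τZ} h r = e^{τp} R on Ω.
  refine ⟨Real.sqrt (n * (2 * c ^ 2 + 2 * B ^ 2 * c ^ 2) + c ^ 2),
    fun h x => ((h⁻¹ : ℝ) : ℂ) * Complex.exp (-(((h⁻¹ : ℝ) : ℂ) * Complex.I * Y x)) * R h⁻¹ x,
    fun h hh hh₀ => ?_⟩
  set τ : ℝ := h⁻¹ with hτ
  have hτ₀' : τ₀ ≤ τ := by rw [hτ]; exact (le_inv_comm₀ hh hτ₀0).1 hh₀
  have hhτ : (h : ℂ) * τ = 1 := by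
    rw [hτ, ← Complex.ofReal_mul, mul_inv_cancel₀ hh.ne', Complex.ofReal_one]
  have hRm := hRm τ hτ₀'
  have hDm := hDm τ hτ₀'
  have hRw := hRw τ hτ₀'
  have hRD := hRD τ hτ₀'
  have hRl : τ * l2 (R τ) ≤ c :=
    (hRl τ hτ₀').trans (mul_le_mul_of_nonneg_left (hfl τ) hC.le)
  have hDl : ∀ j, l2 (D τ j) ≤ c := fun j =>
    (hDl τ hτ₀' j).trans (mul_le_mul_of_nonneg_left (hfl τ) hC.le)
  have hloc : ∀ {g : E n → ℂ}, MemLp g 2 volume → LocallyIntegrableOn g Ω volume := fun hg =>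
    (hg.locallyIntegrable (by norm_num)).locallyIntegrableOn _
  have hRgrad : IsWeakGrad Ω (R τ) (vec (D τ)) := by
    refine isWeakGrad_vec hΩo (hloc hRm) (fun j => hloc (hDm j)) fun v hv j => ?_
    have e1 := hRD v hv.1 hv.2.1 j
    rw [setIntegral_eq_integral_of_forall_compl_eq_zero,
      setIntegral_eq_integral_of_forall_compl_eq_zero, ← e1]
    · refine integral_congr_ae (Filter.Eventually.of_forall fun x => ?_)
      by_cases hx : x ∈ Ω
      -- The cutoff X is 1 on Ω, so the weak derivatives of XR are those of R there.
      · simp [hX, hχ4 x (hW (subset_closure hx))]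
      · simp [dd_eq_zero_of_notMem (f := v) (j := j) fun h' => hx (hv.2.2 h')]
    · intro x hx
      rw [image_eq_zero_of_notMem_tsupport fun h' => hx (hv.2.2 h'), mul_zero]
    · intro x hx
      rw [dd_eq_zero_of_notMem fun h' => hx (hv.2.2 h'), mul_zero]
  have hRr : MemLp (R τ) 2 (volume.restrict Ω) := hRm.restrict _
  have hDr : ∀ j, MemLp (D τ j) 2 (volume.restrict Ω) := fun j => (hDm j).restrict _
  have hmul : ∀ {g : E n → ℂ}, ContDiff ℝ 2 g → MemLp (fun x => g x * R τ x) 2 (volume.restrict Ω)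
      ∧ IsWeakGrad Ω (fun x => g x * R τ x) (vec fun j x => g x * D τ j x + dd j g x * R τ x)
      ∧ MemLp (vec fun j x => g x * D τ j x + dd j g x * R τ x) 2 (volume.restrict Ω) :=
    fun hg => ⟨memLp_restrict_continuous_mul hΩm hΩc hg.continuous hRr,
      IsWeakGrad.contDiff_mul hΩo (hg.of_le (by norm_num)) hRgrad,
      memLp_vec fun j => (memLp_restrict_continuous_mul hΩm hΩc hg.continuous (hDr j)).add
        (memLp_restrict_continuous_mul hΩm hΩc
          (contDiff_dd (k := 1) hg (by norm_num)).continuous hRr)⟩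
  refine ⟨?_, normH1scl_oscillating_le hΩo hRm hDm hRgrad hYC hh hτ hB hRl hDl, ?_⟩
  · have := hmul (g := fun x => (τ : ℂ) * Complex.exp (-(τ * Complex.I * Y x)))
      (contDiff_const.mul ((contDiff_const.mul hYc).neg.cexp))
    exact ⟨this.1, _, this.2.1, this.2.2⟩
  · intro u hu
    set u1 : E n → ℂ := fun x => Complex.exp (τ * Z x) * a x with hu1
    set g2 : E n → ℂ := fun x => Complex.exp (τ * p x) with hg2
    have hu1C : ContDiff ℝ 2 u1 := (contDiff_const.mul hZ).cexp.mul haC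
    have hu1m : MemLp u1 2 (volume.restrict Ω) :=
      memLp_restrict_of_continuous hΩm hΩc hu1C.continuous
    have hu1g := isWeakGrad_of_contDiff hΩo (hu1C.of_le (m := 1) (by norm_num))
    obtain ⟨hu2m, hu2g, hu2gm⟩ := hmul (g := g2) (contDiff_const.mul hp2).cexp
    have huu : EqOn (fun x => u1 x + g2 x * R τ x) u Ω := fun x hx => by
      rw [hu hx]
      have e1 : Z x / h = τ * Z x := by rw [hτ]; push_cast; ring
      have e2 : Complex.exp (τ * Z x) * Complex.exp (-(τ * Complex.I * Y x)) = g2 x := by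
        rw [← Complex.exp_add, hZY x hx, hg2]; congr 1; ring
      simp only [e1, hu1]
      linear_combination -(R τ x) * e2
        - Complex.exp (τ * Z x) * Complex.exp (-(τ * Complex.I * Y x)) * R τ x * hhτ
    have hug := (hu1g.add hu2g).congr hΩo huu
    have hgm1 : ∀ j, MemLp (dd j u1) 2 (volume.restrict Ω) := fun j =>
      memLp_restrict_of_continuous hΩm hΩc (contDiff_dd (k := 1) hu1C (by norm_num)).continuous
    have hum : MemLp u 2 (volume.restrict Ω) :=
      (hu1m.add hu2m).ae_eq ((ae_restrict_iff' hΩm).2 (Filter.Eventually.of_forall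
        fun x hx => huu hx))
    refine ⟨⟨hum, _, hug, ?_⟩, fun v hv => ?_⟩
    · have : (vec fun j x => dd j u1 x + (g2 x * D τ j x + dd j g2 x * R τ x))
          = fun x => vec (fun j => dd j u1) x
            + vec (fun j x => g2 x * D τ j x + dd j g2 x * R τ x) x := by
        funext x; ext j; simp
      rw [this]
      exact (memLp_vec hgm1).add hu2gm
    -- Conjugating the test function makes the sesquilinear weak form bilinear, as in the duality
    -- argument.
    · set w : E n → ℂ := fun x => (starRingEnd ℂ) (v x) with hw
      have hwt : IsTest Ω w := hv.conj
      have e1 : ∫ x in Ω, ((∑ j, (-Complex.I * weakGrad Ω u x j + (A x j : ℂ) * u x) *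
            (starRingEnd ℂ) (-Complex.I * pd j v x + (A x j : ℂ) * v x))
            + q x * u x * (starRingEnd ℂ) (v x))
          = ∫ x in Ω, ((∑ j, (-Complex.I * (dd j u1 x + (g2 x * D τ j x + dd j g2 x * R τ x))
              + (Ac x j : ℂ) * u x)
            * (Complex.I * dd j w x + (Ac x j : ℂ) * w x)) + q' x * u x * w x) := by
        refine integral_congr_ae ?_
        filter_upwards [hug.weakGrad_ae_eq hΩo, hqq', ae_restrict_mem hΩm] with x hx1 hx2 hxΩ
        simp only [hx1, hx2, hAAc hxΩ, vec_apply, map_add, map_mul, map_neg, Complex.conj_I,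
          Complex.conj_ofReal, neg_neg, pd_eq_dd]
        congr 1
        refine Finset.sum_congr rfl fun j _ => ?_
        rw [hw, dd_conj (hv.1.differentiable (by simp) x)]
      rw [e1, integral_bilinear_eq hΩo hAc hq'm hq'K hug hwt]
      have hLw : MemLp (ellOp (magB Ac) (magC Ac q') w) 2 (volume.restrict Ω) := by
        have := memLp_mul_ellOp hBm hCm hBK hCK (contDiff_two_of_infty hwt.1) hwt.2.1
          (continuous_const (y := (1 : ℂ)))
        simpa using this.restrict Ω
      have e2 : ∫ x in Ω, u x * ellOp (magB Ac) (magC Ac q') w x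
          = (∫ x in Ω, u1 x * ellOp (magB Ac) (magC Ac q') w x)
            + ∫ x in Ω, g2 x * R τ x * ellOp (magB Ac) (magC Ac q') w x := by
        have i1 : Integrable (fun x => u1 x * ellOp (magB Ac) (magC Ac q') w x)
          (volume.restrict Ω) := hu1m.integrable_mul hLw
        have i2 : Integrable (fun x => g2 x * R τ x * ellOp (magB Ac) (magC Ac q') w x)
          (volume.restrict Ω) := hu2m.integrable_mul hLw
        rw [← integral_add i1 i2]
        refine setIntegral_congr_fun hΩm fun x hx => ?_
        simp only [← huu hx, add_mul]
      have e3 : ∫ x, g2 x * R τ x * ellOp (magB Ac) (magC Ac q') w x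
          = ∫ x, f τ x * (Complex.exp (τ * p x) * w x) := by
        rw [← hRw w ⟨hwt.1, hwt.2.1, hwt.2.2.trans (subset_closure.trans hU)⟩]
        congr 1; funext x; rw [hg2]; ring
      have hwt' : IsTest univ w := ⟨hwt.1, hwt.2.1, subset_univ _⟩
      rw [e2, setIntegral_mul_ellOp hwt, setIntegral_mul_ellOp hwt, e3,
        integral_mul_ellOp_eq hAc hq'm hq'K hu1C hwt', ← setIntegral_eq_integral_of_forall_compl_eq_zero
          (s := Ω), ← setIntegral_eq_integral_of_forall_compl_eq_zero (s := Ω)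
          (f := fun x => f τ x * (Complex.exp (τ * p x) * w x))]
      · rw [← eq_neg_iff_add_eq_zero, ← integral_neg]
        refine setIntegral_congr_fun hΩm fun x hx => ?_
        have h1 : magL Ac q' u1 x = Complex.exp (τ * Z x) * magL Ac q' a x :=
          magL_exp_mul τ hZ hΦ (heik x hx) (by
            rw [← htr x hx]
            simp only [hAAc hx])
        have h2 : k x = magL Ac q' a x := indicator_of_mem hx _
        simp only [h1, hf, h2]
        rw [show (τ : ℂ) * Z x = τ * Complex.I * Y x + τ * p x by rw [hZY x hx]; ring,
          Complex.exp_add]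
        ring
      · intro x hx
        rw [image_eq_zero_of_notMem_tsupport fun h' => hx (hwt.2.2 h'), mul_zero, mul_zero]
      · intro x hx
        rw [image_eq_zero_of_notMem_tsupport fun h' => hx (hwt.2.2 h'), mul_zero]

end remainder

/-! ### The Cauchy transform -/

section cauchy

theorem locallyIntegrable_inv : LocallyIntegrable (fun w : ℂ => w⁻¹) volume := by
  refine locallyIntegrable_of_norm_le_rpow (C := 1) (α := 1) (by simp)
    (by rw [Complex.finrank_real_complex]; norm_num) (Filter.Eventually.of_forall fun w => ?_)
    measurable_inv.aestronglyMeasurable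
  rw [norm_inv, one_mul, Real.rpow_neg_one]

variable {H : ℂ → ℂ}

/-- The Cauchy–Pompeiu formula for compactly supported functions. -/
theorem integral_inv_mul_dbar (hH : ContDiff ℝ 1 H) (hc : HasCompactSupport H) :
    ∫ w : ℂ, w⁻¹ * (fderiv ℝ H w 1 + Complex.I * fderiv ℝ H w Complex.I)
      = -(2 * Real.pi) * H 0 := by
  have hd : ∀ w, HasFDerivAt H (fderiv ℝ H w) w := fun w =>
    (hH.differentiable (by norm_num) w).hasFDerivAt
  have hfd : Continuous (fderiv ℝ H) := hH.continuous_fderiv (by norm_num)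
  set u : ℝ → ℂ := fun φ => Complex.exp (φ * Complex.I) with hu
  have huc : Continuous u := by fun_prop
  set A : ℝ × ℝ → ℂ := fun p => fderiv ℝ H (p.1 * u p.2) (u p.2) with hA
  set B : ℝ × ℝ → ℂ := fun p => fderiv ℝ H (p.1 * u p.2) (Complex.I * u p.2) with hB
  have hAc : Continuous A := by
    rw [hA]; exact (hfd.comp (by fun_prop)).clm_apply (by fun_prop)
  have hBc : Continuous B := by
    rw [hB]; exact (hfd.comp (by fun_prop)).clm_apply (by fun_prop)
  obtain ⟨R, hR⟩ := hc.isCompact.isBounded.exists_norm_le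
  have hun : ∀ φ, ‖u φ‖ = 1 := fun φ => Complex.norm_exp_ofReal_mul_I φ
  have hz : ∀ (r φ : ℝ), R < |r| → (r * u φ : ℂ) ∉ tsupport H := fun r φ hr h => by
    have := hR _ h
    rw [norm_mul, hun, mul_one, Complex.norm_real, Real.norm_eq_abs] at this
    linarith
  have hfz : ∀ w, w ∉ tsupport H → fderiv ℝ H w = 0 := fun w hw =>
    image_eq_zero_of_notMem_tsupport fun h => hw (tsupport_fderiv_subset ℝ h)
  set T : Set (ℝ × ℝ) := Ioi 0 ×ˢ Ioo (-Real.pi) Real.pi with hT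
  have hint : ∀ F : ℝ × ℝ → ℂ, Continuous F → (∀ r φ, R < |r| → F (r, φ) = 0) →
      IntegrableOn F T volume := by
    intro F hF hF0
    have h1 : IntegrableOn F (Icc 0 R ×ˢ Icc (-Real.pi) Real.pi) volume :=
      hF.continuousOn.integrableOn_compact (isCompact_Icc.prod isCompact_Icc)
    refine h1.of_forall_sdiff_eq_zero (measurableSet_Ioi.prod measurableSet_Ioo) ?_
    rintro ⟨r, φ⟩ ⟨⟨h2, h3⟩, h4⟩
    refine hF0 r φ (not_le.1 fun h => h4 ⟨⟨le_of_lt h2, ?_⟩, ⟨h3.1.le, h3.2.le⟩⟩)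
    exact (le_abs_self _).trans h
  have iA : IntegrableOn A T volume := hint A hAc fun r φ hr => by
    simp only [hA, hfz _ (hz r φ hr)]; rfl
  have iB : IntegrableOn B T volume := hint B hBc fun r φ hr => by
    simp only [hB, hfz _ (hz r φ hr)]; rfl
  -- In polar coordinates the Jacobian r cancels 1/|w|, and e^{-iφ}(∂₁ + i∂₂) is the radial
  -- derivative A plus i times B = r⁻¹∂_φ.
  have e1 : ∫ w : ℂ, w⁻¹ * (fderiv ℝ H w 1 + Complex.I * fderiv ℝ H w Complex.I)
      = ∫ p in T, (A p + Complex.I * B p) := by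
    rw [← Complex.integral_comp_polarCoord_symm]
    refine setIntegral_congr_fun (measurableSet_Ioi.prod measurableSet_Ioo) ?_
    rintro ⟨r, φ⟩ ⟨hr, hφ⟩
    have hr' : (r : ℂ) ≠ 0 := by exact_mod_cast (ne_of_gt hr)
    have e0 : Complex.polarCoord.symm (r, φ) = r * u φ := by
      rw [Complex.polarCoord_symm_apply, hu]
      simp only [Complex.exp_mul_I, Complex.ofReal_cos, Complex.ofReal_sin]
    have hu1 : u φ = (Real.cos φ : ℝ) • (1 : ℂ) + (Real.sin φ : ℝ) • Complex.I := by
      simp [hu, Complex.exp_mul_I]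
    have hu2 : Complex.I * u φ = (-Real.sin φ : ℝ) • (1 : ℂ) + (Real.cos φ : ℝ) • Complex.I := by
      rw [hu1]
      simp only [Complex.real_smul, Complex.ofReal_neg]
      linear_combination (Real.sin φ : ℂ) * Complex.I_mul_I
    have hui : (u φ)⁻¹ = Real.cos φ - Real.sin φ * Complex.I := by
      rw [hu]
      simp only
      rw [← Complex.exp_neg, ← neg_mul, Complex.exp_mul_I]
      simp [sub_eq_add_neg]
    have key : ∀ L : ℂ →L[ℝ] ℂ, (r : ℂ) * ((r * u φ)⁻¹ * (L 1 + Complex.I * L Complex.I))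
        = L (u φ) + Complex.I * L (Complex.I * u φ) := fun L => by
      have h1 : L (u φ) = Real.cos φ * L 1 + Real.sin φ * L Complex.I := by
        rw [hu1, map_add, map_smul, map_smul, Complex.real_smul, Complex.real_smul]
      have h2 : L (Complex.I * u φ) = -Real.sin φ * L 1 + Real.cos φ * L Complex.I := by
        rw [hu2, map_add, map_smul, map_smul, Complex.real_smul, Complex.real_smul,
          Complex.ofReal_neg]
      rw [h1, h2, mul_inv, hui, ← mul_assoc, ← mul_assoc, mul_inv_cancel₀ hr', one_mul]
      linear_combination (-(Real.sin φ : ℂ) * L Complex.I) * Complex.I_mul_I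
    simp only [e0, hA, hB, Complex.real_smul]
    exact key _
  rw [e1]
  have e2 := integral_add iA (iB.const_mul Complex.I)
  rw [e2, integral_const_mul]
  have hvol : (volume : Measure (ℝ × ℝ)) = (volume : Measure ℝ).prod volume := rfl
  -- Along every ray the radial derivative integrates to -H(0), by compact support.
  have eA : ∫ p in T, A p = -(2 * Real.pi) * H 0 := by
    rw [hT, hvol, ← Measure.prod_restrict, integral_prod_symm]
    · have : ∀ φ : ℝ, ∫ r in Ioi (0 : ℝ), A (r, φ) = -H 0 := fun φ => by
        set g : ℝ → ℂ := fun r => H (r * u φ) with hg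
        have hgC : ContDiff ℝ 1 g :=
          hH.comp ((Complex.ofRealCLM.contDiff).mul contDiff_const)
        have hgc : HasCompactSupport g :=
          HasCompactSupport.of_support_subset_isCompact (isCompact_Icc (a := -R) (b := R))
            fun r hr => by
              by_contra h
              rw [mem_Icc, ← abs_le] at h
              exact hr (image_eq_zero_of_notMem_tsupport (f := H) (hz r φ (not_le.1 h)))
        have hgd : ∀ r, deriv g r = A (r, φ) := fun r => by
          have h1 : HasDerivAt (fun r : ℝ => (r : ℂ) * u φ) (1 * u φ) r :=
            (Complex.ofRealCLM.hasDerivAt).mul_const _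
          rw [one_mul] at h1
          exact ((hd _).comp_hasDerivAt r h1).deriv
        have := hgc.integral_Ioi_deriv_eq hgC 0
        simp only [hgd] at this
        rw [this, hg]; simp
      simp only [this]
      rw [integral_const]
      simp [Measure.real, Real.volume_Ioo, Real.pi_pos.le, two_mul]
      ring
    · rw [Measure.prod_restrict]; exact iA
  -- Around every circle the angular derivative integrates to zero, by periodicity.
  have eB : ∫ p in T, B p = 0 := by
    rw [hT, hvol, ← Measure.prod_restrict, integral_prod]
    · refine integral_eq_zero_of_ae ?_
      refine (ae_restrict_iff' measurableSet_Ioi).2 (Filter.Eventually.of_forall fun r hr => ?_)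
      have hr' : (r : ℂ) ≠ 0 := by exact_mod_cast (ne_of_gt hr)
      have hder : ∀ φ : ℝ, HasDerivAt (fun φ : ℝ => H (r * u φ)) (r * B (r, φ)) φ := fun φ => by
        have h1 : HasDerivAt u (Complex.exp (φ * Complex.I) * (1 * Complex.I)) φ :=
          ((Complex.ofRealCLM.hasDerivAt).mul_const _).cexp
        have h2 := (hd (r * u φ)).comp_hasDerivAt φ (h1.const_mul (r : ℂ))
        rw [show (r : ℂ) * (Complex.exp (φ * Complex.I) * (1 * Complex.I))
          = r • (Complex.I * u φ) by rw [Complex.real_smul, hu]; ring, map_smul,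
          Complex.real_smul] at h2
        exact h2
      have hBr : Continuous fun φ => (r : ℂ) * B (r, φ) := by fun_prop
      have := intervalIntegral.integral_eq_sub_of_hasDerivAt (a := -Real.pi) (b := Real.pi)
        (fun φ _ => hder φ) (hBr.intervalIntegrable _ _)
      have hper : u Real.pi = u (-Real.pi) := by
        simp [hu, Complex.exp_neg]
      rw [hper, sub_self, intervalIntegral.integral_const_mul,
        intervalIntegral.integral_of_le (by linarith [Real.pi_pos]),
        integral_Ioc_eq_integral_Ioo] at this
      exact (mul_eq_zero.1 this).resolve_left hr'
    · rw [Measure.prod_restrict]; exact iB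
  rw [eA, eB, mul_zero, add_zero]

end cauchy

/-! ### Solving a Cauchy–Riemann equation on a family of planes -/

section dbar

open scoped Convolution

variable {n : ℕ} {e : E n} {θ : E n → E n} {W : Set (E n)} {F : E n → ℂ}

/-- The function `F` on the plane through `x` spanned by `e` and `θ x`. -/
def planeSlice (e : E n) (θ : E n → E n) (F : E n → ℂ) (x : E n) (w : ℂ) : ℂ :=
  F (x + (w.re • e + w.im • θ x))

/-- The Cauchy transform of `F` along the planes spanned by `e` and `θ x`. -/
def planeCauchy (e : E n) (θ : E n → E n) (F : E n → ℂ) (x : E n) : ℂ :=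
  (2 * Real.pi : ℂ)⁻¹ * ((fun w : ℂ => w⁻¹) ⋆[ContinuousLinearMap.mul ℝ ℂ, volume]
    planeSlice e θ F x) 0

theorem norm_re_smul_add_im_smul {e v : E n} (he : ‖e‖ = 1) (hv : ‖v‖ = 1) (hev : inner ℝ e v = 0)
    (w : ℂ) : ‖w.re • e + w.im • v‖ = ‖w‖ := by
  refine (pow_left_inj₀ (norm_nonneg _) (norm_nonneg _) two_ne_zero).1 ?_
  rw [norm_add_sq_real, norm_smul, norm_smul, he, hv, inner_smul_left, inner_smul_right, hev,
    Complex.sq_norm, Complex.normSq_apply]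
  simp [sq]

/-- The parameter x appears only in the C² factor of a convolution with the locally integrable
kernel 1/w. Orthonormality of e and θ makes w ↦ w.re e + w.im θ isometric, so the slices have a
common compact support for x in a unit ball. -/
theorem contDiffOn_planeCauchy (he : ‖e‖ = 1) (hW : IsOpen W) (hθ : ContDiffOn ℝ 2 θ W)
    (hθ1 : ∀ x ∈ W, ‖θ x‖ = 1) (hθe : ∀ x ∈ W, inner ℝ e (θ x) = 0) (hF : ContDiff ℝ 2 F)
    (hFc : HasCompactSupport F) : ContDiffOn ℝ 2 (planeCauchy e θ F) W := by
  intro x hx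
  refine ContDiffAt.contDiffWithinAt ?_
  obtain ⟨R, hR⟩ := hFc.isCompact.isBounded.exists_norm_le
  set s : Set (E n) := W ∩ Metric.ball x 1 with hs
  have hso : IsOpen s := hW.inter Metric.isOpen_ball
  have hxs : x ∈ s := ⟨hx, Metric.mem_ball_self one_pos⟩
  have hzero : ∀ p, ∀ w : ℂ, p ∈ s → w ∉ Metric.closedBall (0 : ℂ) (R + ‖x‖ + 1) →
      planeSlice e θ F p w = 0 := by
    intro p w hp hw
    refine image_eq_zero_of_notMem_tsupport (f := F) fun h => hw ?_
    have h1 := hR _ h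
    have h2 := norm_re_smul_add_im_smul he (hθ1 p hp.1) (hθe p hp.1) w
    have h3 : ‖w.re • e + w.im • θ p‖ ≤ ‖p + (w.re • e + w.im • θ p)‖ + ‖p‖ := by
      have := norm_sub_le (p + (w.re • e + w.im • θ p)) p
      rwa [add_sub_cancel_left] at this
    have h4 : ‖p‖ ≤ ‖x‖ + 1 := by
      have := norm_le_norm_add_norm_sub' p x
      have h5 := mem_ball_iff_norm.1 hp.2
      linarith
    rw [mem_closedBall_zero_iff]
    linarith
  have hg : ContDiffOn ℝ 2 (↿(planeSlice e θ F)) (s ×ˢ (univ : Set ℂ)) := by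
    have h1 : ContDiffOn ℝ 2 (fun q : E n × ℂ => θ q.1) (s ×ˢ (univ : Set ℂ)) :=
      hθ.comp contDiff_fst.contDiffOn fun q hq => hq.1.1
    have hre : ContDiff ℝ 2 fun q : E n × ℂ => q.2.re := Complex.reCLM.contDiff.comp contDiff_snd
    have him : ContDiff ℝ 2 fun q : E n × ℂ => q.2.im := Complex.imCLM.contDiff.comp contDiff_snd
    exact hF.comp_contDiffOn (contDiff_fst.contDiffOn.add
      ((hre.smul contDiff_const).contDiffOn.add (him.contDiffOn.smul h1)))
  have key := contDiffOn_convolution_right_with_param_comp (n := 2) (ContinuousLinearMap.mul ℝ ℂ)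
    (v := fun _ => (0 : ℂ)) contDiffOn_const hso (isCompact_closedBall (0 : ℂ) (R + ‖x‖ + 1)) hzero
    locallyIntegrable_inv hg
  exact contDiffAt_const.mul (key.contDiffAt (hso.mem_nhds hxs))

/-- Moving x inside its plane translates the slice, so derivatives along e and θ fall on the slice
and Cauchy–Pompeiu applies. Constancy of θ along the plane is needed only near x, since only first
derivatives at x are taken. -/
theorem planeCauchy_spec (he : ‖e‖ = 1) (hW : IsOpen W) (hθ : ContDiffOn ℝ 2 θ W)
    (hθ1 : ∀ x ∈ W, ‖θ x‖ = 1) (hθe : ∀ x ∈ W, inner ℝ e (θ x) = 0) (hF : ContDiff ℝ 2 F)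
    (hFc : HasCompactSupport F) {x : E n} (hx : x ∈ W)
    (hθθ : ∀ᶠ w : ℂ in nhds 0, θ (x + (w.re • e + w.im • θ x)) = θ x) :
    fderiv ℝ (planeCauchy e θ F) x e + Complex.I * fderiv ℝ (planeCauchy e θ F) x (θ x) = F x := by
  have hd : DifferentiableAt ℝ (planeCauchy e θ F) x :=
    ((contDiffOn_planeCauchy he hW hθ hθ1 hθe hF hFc).contDiffAt (hW.mem_nhds hx)
      ).differentiableAt (by norm_num)
  set ℓ : ℂ →L[ℝ] E n := Complex.reCLM.smulRight e + Complex.imCLM.smulRight (θ x) with hℓ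
  have hℓa : ∀ w, ℓ w = w.re • e + w.im • θ x := fun w => rfl
  set H : ℂ → ℂ := planeSlice e θ F x with hH
  have hHC : ContDiff ℝ 1 H := (hF.of_le (by norm_num)).comp (contDiff_const.add ℓ.contDiff)
  obtain ⟨R, hR⟩ := hFc.isCompact.isBounded.exists_norm_le
  have hHc : HasCompactSupport H := by
    refine HasCompactSupport.of_support_subset_isCompact
      (isCompact_closedBall (0 : ℂ) (R + ‖x‖)) fun w hw => ?_
    have h1 := hR _ (subset_closure hw)
    have h2 := norm_re_smul_add_im_smul he (hθ1 x hx) (hθe x hx) w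
    have h3 := norm_sub_le (x + (w.re • e + w.im • θ x)) x
    rw [add_sub_cancel_left] at h3
    rw [mem_closedBall_zero_iff]
    linarith
  set c : ℂ := (2 * Real.pi : ℂ)⁻¹ with hc
  set f : ℂ → ℂ := fun w => w⁻¹ with hf
  have hconv := hHc.hasFDerivAt_convolution_right (ContinuousLinearMap.mul ℝ ℂ)
    (f := f) locallyIntegrable_inv hHC 0
  have hline : HasFDerivAt (fun w : ℂ => x + ℓ w) ℓ 0 := ℓ.hasFDerivAt.const_add x
  have hcomp : HasFDerivAt (fun w : ℂ => planeCauchy e θ F (x + ℓ w))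
      ((fderiv ℝ (planeCauchy e θ F) x).comp ℓ) 0 := by
    have h1 : HasFDerivAt (planeCauchy e θ F) (fderiv ℝ (planeCauchy e θ F) x) (x + ℓ 0) := by
      rw [map_zero, add_zero]; exact hd.hasFDerivAt
    exact h1.comp (0 : ℂ) hline
  have hev : (fun w : ℂ => planeCauchy e θ F (x + ℓ w)) =ᶠ[nhds 0]
      fun w => c * (f ⋆[ContinuousLinearMap.mul ℝ ℂ, volume] H) w := by
    filter_upwards [hθθ] with w hw
    rw [planeCauchy]
    congr 1
    simp only [convolution_def]
    congr 1; funext t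
    congr 1
    simp only [hH, planeSlice, hℓa, hw]
    congr 1
    simp only [Complex.sub_re, Complex.sub_im, Complex.zero_re, Complex.zero_im, sub_smul,
      zero_smul]
    abel
  have huniq := (hcomp.congr_of_eventuallyEq hev.symm).unique (hconv.const_mul c)
  have hval : ∀ v : ℂ, fderiv ℝ (planeCauchy e θ F) x (ℓ v)
      = c * ∫ t : ℂ, t⁻¹ * fderiv ℝ H (-t) v := fun v => by
    have h1 := DFunLike.congr_fun huniq v
    rw [ContinuousLinearMap.comp_apply] at h1
    rw [h1, _root_.smul_apply, smul_eq_mul,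
      convolution_precompR_apply _ locallyIntegrable_inv (hHc.fderiv ℝ)
        (hHC.continuous_fderiv (by norm_num)), convolution_def]
    simp
  have hint : ∀ v : ℂ, Integrable (fun t : ℂ => t⁻¹ * fderiv ℝ H (-t) v) volume := fun v => by
    have h1 : Continuous fun t => fderiv ℝ H (-t) v :=
      ((hHC.continuous_fderiv (by norm_num)).comp continuous_neg).clm_apply continuous_const
    have h2 : HasCompactSupport fun t => fderiv ℝ H (-t) v :=
      ((hHc.fderiv_apply ℝ v)).comp_homeomorph (Homeomorph.neg ℂ)
    have := locallyIntegrable_inv.integrable_smul_right_of_hasCompactSupport h1 h2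
    simpa using this
  have h1 := hval 1
  have h2 := hval Complex.I
  have hn : ∀ w v, fderiv ℝ (fun t => H (-t)) w v = -fderiv ℝ H (-w) v := fun w v => by
    have h3 : HasFDerivAt H (fderiv ℝ H (-w)) (-w) :=
      (hHC.differentiable (by norm_num) _).hasFDerivAt
    have h4 : HasFDerivAt (fun t => H (-t))
        ((fderiv ℝ H (-w)).comp (-(ContinuousLinearMap.id ℝ ℂ))) w :=
      h3.comp w (hasFDerivAt_id w).neg
    rw [h4.fderiv]
    simp
  -- The convolution at 0 evaluates the slice at -t, hence the reflection and the sign change of the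
  -- derivatives.
  have hCP := integral_inv_mul_dbar (H := fun t => H (-t)) (hHC.comp contDiff_neg)
    (hHc.comp_homeomorph (Homeomorph.neg ℂ))
  simp only [hn] at hCP
  have e1 : ∀ w : ℂ, w⁻¹ * (-fderiv ℝ H (-w) 1 + Complex.I * -fderiv ℝ H (-w) Complex.I)
      = -(w⁻¹ * fderiv ℝ H (-w) 1) + -Complex.I * (w⁻¹ * fderiv ℝ H (-w) Complex.I) :=
    fun w => by ring
  simp only [e1] at hCP
  have e2 := integral_add (hint 1).neg ((hint Complex.I).const_mul (-Complex.I))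
  simp only [Pi.neg_apply] at e2
  rw [e2, integral_neg, integral_const_mul] at hCP
  have hl1 : ℓ 1 = e := by simp [hℓa]
  have hlI : ℓ Complex.I = θ x := by simp [hℓa]
  rw [hl1] at h1
  rw [hlI] at h2
  have hpi : (2 * Real.pi : ℂ) ≠ 0 := by
    have := Real.pi_ne_zero
    exact mul_ne_zero two_ne_zero (by exact_mod_cast this)
  have hH0 : H (-0) = F x := by simp [hH, planeSlice]
  rw [hH0] at hCP
  have hcc : c * (2 * Real.pi) = 1 := inv_mul_cancel₀ hpi
  rw [h1, h2]
  linear_combination -c * hCP + F x * hcc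

end dbar

/-! ### The complex phase -/

theorem two_le_infty : (2 : WithTop ℕ∞) ≤ ((⊤ : ℕ∞) : WithTop ℕ∞) :=
  WithTop.coe_le_coe.2 (le_top : (2 : ℕ∞) ≤ ⊤)

section phase

variable {n : ℕ} {x₀ e x : E n}

/-- The component of `y` orthogonal to the unit vector `e`. -/
def perp (e : E n) : E n →L[ℝ] E n :=
  ContinuousLinearMap.id ℝ (E n) - (innerSL ℝ e).smulRight e

theorem perp_apply (e y : E n) : perp e y = y - inner ℝ e y • e := rfl

theorem inner_perp (he : ‖e‖ = 1) (y : E n) : inner ℝ e (perp e y) = 0 := by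
  rw [perp_apply, inner_sub_right, inner_smul_right, real_inner_self_eq_norm_sq, he]; ring

theorem inner_perp_perp (he : ‖e‖ = 1) (y v : E n) :
    inner ℝ (perp e y) (perp e v) = inner ℝ (perp e y) v := by
  rw [perp_apply e v, inner_sub_right, inner_smul_right, real_inner_comm e (perp e y), inner_perp he]
  simp

/-- The complex coordinate `⟨x - x₀, e⟩ + i |(x - x₀)^⊥|`. -/
def zeta (x₀ e x : E n) : ℂ :=
  ((inner ℝ e (x - x₀) : ℝ) : ℂ) + Complex.I * ((‖perp e (x - x₀)‖ : ℝ) : ℂ)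

/-- The unit vector in the direction of the component of `x - x₀` orthogonal to `e`. -/
def theta (x₀ e x : E n) : E n := ‖perp e (x - x₀)‖⁻¹ • perp e (x - x₀)

/-- The complement of the line `x₀ + ℝe`. -/
def offLine (x₀ e : E n) : Set (E n) := {x | perp e (x - x₀) ≠ 0}

theorem isOpen_offLine : IsOpen (offLine x₀ e) :=
  isOpen_ne_fun ((perp e).continuous.comp (continuous_id.sub continuous_const)) continuous_const

theorem mem_offLine_of_forall (h : ∀ t : ℝ, x₀ + t • e ≠ x) : x ∈ offLine x₀ e := by
  intro h0
  rw [perp_apply, sub_eq_zero] at h0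
  exact h (inner ℝ e (x - x₀)) (by rw [← h0]; abel)

theorem norm_sq_eq (he : ‖e‖ = 1) (y : E n) : ‖y‖ ^ 2 = inner ℝ e y ^ 2 + ‖perp e y‖ ^ 2 := by
  rw [perp_apply, norm_sub_sq_real, norm_smul, he, inner_smul_right, real_inner_comm,
    Real.norm_eq_abs, mul_one, sq_abs]
  ring

theorem norm_theta (hx : x ∈ offLine x₀ e) : ‖theta x₀ e x‖ = 1 := by
  rw [theta, norm_smul, norm_inv, norm_norm, inv_mul_cancel₀ (norm_ne_zero_iff.2 hx)]

theorem inner_theta (he : ‖e‖ = 1) : inner ℝ e (theta x₀ e x) = 0 := by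
  rw [theta, inner_smul_right, inner_perp he, mul_zero]

theorem contDiff_perp_sub : ContDiff ℝ ∞ fun x => perp e (x - x₀) :=
  (perp e).contDiff.comp (contDiff_id.sub contDiff_const)

theorem contDiffOn_norm_perp : ContDiffOn ℝ ∞ (fun x => ‖perp e (x - x₀)‖) (offLine x₀ e) :=
  contDiff_perp_sub.contDiffOn.norm ℝ fun _ hx => hx

theorem contDiffOn_theta : ContDiffOn ℝ ∞ (theta x₀ e) (offLine x₀ e) :=
  (contDiffOn_norm_perp.inv fun _ hx => norm_ne_zero_iff.2 hx).smul contDiff_perp_sub.contDiffOn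

theorem contDiff_axial : ContDiff ℝ ∞ fun x => inner ℝ e (x - x₀) :=
  (innerSL ℝ e).contDiff.comp (contDiff_id.sub contDiff_const)

theorem contDiffOn_zeta : ContDiffOn ℝ ∞ (zeta x₀ e) (offLine x₀ e) :=
  (Complex.ofRealCLM.contDiff.comp contDiff_axial).contDiffOn.add
    (contDiffOn_const.mul (Complex.ofRealCLM.contDiff.comp_contDiffOn contDiffOn_norm_perp))

/-- The displacement changes the orthogonal component only in length, by w.im; its direction
persists as long as the length stays positive, that is, until the line is reached. -/
theorem theta_add (he : ‖e‖ = 1) (hx : x ∈ offLine x₀ e) :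
    ∀ᶠ w : ℂ in nhds 0, theta x₀ e (x + (w.re • e + w.im • theta x₀ e x)) = theta x₀ e x := by
  have hpos : 0 < ‖perp e (x - x₀)‖ := norm_pos_iff.2 hx
  have hc : Filter.Tendsto (fun w : ℂ => ‖perp e (x - x₀)‖ + w.im) (nhds 0)
      (nhds (‖perp e (x - x₀)‖ + (0 : ℂ).im)) :=
    (continuous_const.add Complex.continuous_im).tendsto 0
  have hev := hc.eventually (lt_mem_nhds (show 0 < ‖perp e (x - x₀)‖ + (0 : ℂ).im by
    rwa [Complex.zero_im, add_zero]))
  filter_upwards [hev] with w hw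
  have h1 : perp e e = 0 := by
    rw [perp_apply, real_inner_self_eq_norm_sq, he]; simp
  have h2 : perp e (theta x₀ e x) = theta x₀ e x := by
    rw [perp_apply, inner_theta he]; simp
  have h0 : perp e (x - x₀) = ‖perp e (x - x₀)‖ • theta x₀ e x := by
    rw [theta, smul_smul, mul_inv_cancel₀ hpos.ne', one_smul]
  have h3 : perp e (x + (w.re • e + w.im • theta x₀ e x) - x₀)
      = (‖perp e (x - x₀)‖ + w.im) • theta x₀ e x := by
    rw [add_sub_right_comm, map_add, map_add, map_smul, map_smul, h1, h2, smul_zero, zero_add,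
      add_smul, ← h0]
  rw [theta, h3, norm_smul, norm_theta hx, mul_one, Real.norm_of_nonneg hw.le, smul_smul,
    inv_mul_cancel₀ hw.ne', one_smul]

theorem dd_norm_sq {g : E n →L[ℝ] E n} {j : Fin n} :
    dd j (fun x => ‖g (x - x₀)‖ ^ 2) x
      = 2 * inner ℝ (g (x - x₀)) (g (EuclideanSpace.single j 1)) := by
  have h : HasFDerivAt (fun x => g (x - x₀)) g x :=
    g.hasFDerivAt.comp x ((hasFDerivAt_id x).sub_const x₀)
  rw [dd, h.norm_sq.fderiv]
  simp [-map_sub]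

theorem dd_norm {g : E n →L[ℝ] E n} {j : Fin n} (hx : g (x - x₀) ≠ 0) :
    dd j (fun x => ‖g (x - x₀)‖) x
      = ‖g (x - x₀)‖⁻¹ * inner ℝ (g (x - x₀)) (g (EuclideanSpace.single j 1)) := by
  have hd : DifferentiableAt ℝ (fun x => ‖g (x - x₀)‖) x :=
    (g.differentiableAt.comp x (differentiableAt_id.sub_const x₀)).norm ℝ hx
  have h := dd_norm_sq (x := x) (x₀ := x₀) (g := g) (j := j)
  rw [dd_pow hd] at h
  have hn : ‖g (x - x₀)‖ ≠ 0 := norm_ne_zero_iff.2 hx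
  rw [eq_inv_mul_iff_mul_eq₀ hn]
  norm_num [-map_sub] at h
  linarith

theorem dd_zeta (he : ‖e‖ = 1) (hx : x ∈ offLine x₀ e) (j : Fin n) :
    dd j (zeta x₀ e) x = (e j : ℂ) + Complex.I * (theta x₀ e x j : ℂ) := by
  have d1 : DifferentiableAt ℝ (fun x => inner ℝ e (x - x₀)) x :=
    contDiff_axial.differentiable (by simp) x
  have d2 : DifferentiableAt ℝ (fun x => ‖perp e (x - x₀)‖) x :=
    (contDiffOn_norm_perp.contDiffAt (isOpen_offLine.mem_nhds hx)).differentiableAt (by simp)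
  have c1 : DifferentiableAt ℝ (fun x => ((inner ℝ e (x - x₀) : ℝ) : ℂ)) x :=
    Complex.ofRealCLM.differentiableAt.comp x d1
  have c2 : DifferentiableAt ℝ (fun x => ((‖perp e (x - x₀)‖ : ℝ) : ℂ)) x :=
    Complex.ofRealCLM.differentiableAt.comp x d2
  have e1 : dd j (fun x => inner ℝ e (x - x₀)) x = e j := by
    have h : HasFDerivAt (fun x => inner ℝ e (x - x₀)) (innerSL ℝ e) x :=
      (innerSL ℝ e).hasFDerivAt.comp x ((hasFDerivAt_id x).sub_const x₀)
    rw [dd, h.fderiv]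
    simp [EuclideanSpace.inner_single_right]
  have e2 : dd j (fun x => ‖perp e (x - x₀)‖) x = theta x₀ e x j := by
    rw [dd_norm hx, inner_perp_perp he, theta]
    simp [EuclideanSpace.inner_single_right]
  unfold zeta
  rw [dd_add c1 (c2.const_mul _), dd_const_mul _ c2, dd_ofReal d1, dd_ofReal d2, e1, e2]

theorem sum_dd_zeta_mul (he : ‖e‖ = 1) (hx : x ∈ offLine x₀ e) (Φ : E n → ℂ) :
    ∑ j, dd j (zeta x₀ e) x * dd j Φ x
      = fderiv ℝ Φ x e + Complex.I * fderiv ℝ Φ x (theta x₀ e x) := by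
  rw [fderiv_apply_eq_sum, fderiv_apply_eq_sum, Finset.mul_sum, ← Finset.sum_add_distrib]
  refine Finset.sum_congr rfl fun j _ => ?_
  rw [dd_zeta he hx, Complex.real_smul, Complex.real_smul]
  ring

/-- Here ∇ζ = e + iθ with e, θ orthonormal, so the real parts cancel and the cross term vanishes. -/
theorem sum_dd_zeta_sq (he : ‖e‖ = 1) (hx : x ∈ offLine x₀ e) :
    ∑ j, dd j (zeta x₀ e) x ^ 2 = 0 := by
  have h1 : ∑ j, e j ^ 2 = 1 := by rw [← EuclideanSpace.real_norm_sq_eq, he, one_pow]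
  have h2 : ∑ j, theta x₀ e x j ^ 2 = 1 := by
    rw [← EuclideanSpace.real_norm_sq_eq, norm_theta hx, one_pow]
  have h3 : ∑ j, theta x₀ e x j * e j = 0 := by
    have := inner_theta (x := x) (x₀ := x₀) he
    simpa [PiLp.inner_apply] using this
  have e1 : ∀ j, dd j (zeta x₀ e) x ^ 2
      = ((e j ^ 2 - theta x₀ e x j ^ 2 : ℝ) : ℂ)
        + 2 * Complex.I * ((theta x₀ e x j * e j : ℝ) : ℂ) := fun j => by
    rw [dd_zeta he hx]
    push_cast
    linear_combination (theta x₀ e x j : ℂ) ^ 2 * Complex.I_mul_I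
  simp only [e1]
  rw [Finset.sum_add_distrib, ← Finset.mul_sum, ← Complex.ofReal_sum, ← Complex.ofReal_sum,
    Finset.sum_sub_distrib, h1, h2, h3]
  simp

theorem zeta_re : (zeta x₀ e x).re = inner ℝ e (x - x₀) := by simp [zeta]

theorem zeta_im : (zeta x₀ e x).im = ‖perp e (x - x₀)‖ := by simp [zeta]

theorem zeta_mem_slitPlane (hx : x ∈ offLine x₀ e) : zeta x₀ e x ∈ Complex.slitPlane := by
  refine Or.inr ?_
  rw [zeta_im]
  exact norm_ne_zero_iff.2 hx

theorem norm_zeta (he : ‖e‖ = 1) : ‖zeta x₀ e x‖ = ‖x - x₀‖ := by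
  refine (pow_left_inj₀ (norm_nonneg _) (norm_nonneg _) two_ne_zero).1 ?_
  rw [Complex.sq_norm, Complex.normSq_apply, zeta_re, zeta_im, norm_sq_eq he (x - x₀)]
  ring

/-- Im ζ > 0 off the line, where the argument of ζ is arccos(Re ζ/|ζ|), the angle between x - x₀ and
e. -/
theorem phase_eq_log (he : ‖e‖ = 1) (hx : x ∈ offLine x₀ e) :
    phase x₀ e x = Complex.log (zeta x₀ e x) := by
  have him : 0 < (zeta x₀ e x).im := by rw [zeta_im]; exact norm_pos_iff.2 hx
  rw [Complex.log, norm_zeta he, Complex.arg_of_im_pos him, norm_zeta he, zeta_re, phase, phi, psi,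
    InnerProductGeometry.angle, he, mul_one, real_inner_comm, mul_comm]

theorem contDiffOn_phase (he : ‖e‖ = 1) : ContDiffOn ℝ ∞ (phase x₀ e) (offLine x₀ e) := by
  have h : ContDiffOn ℝ ∞ (fun x => Complex.log (zeta x₀ e x)) (offLine x₀ e) := fun x hx => by
    have h1 : ContDiffAt ℝ ∞ Complex.log (zeta x₀ e x) :=
      (Complex.contDiffAt_log (n := ∞) (zeta_mem_slitPlane hx)).restrict_scalars ℝ
    exact h1.comp_contDiffWithinAt x (contDiffOn_zeta x hx)
  exact h.congr fun x hx => phase_eq_log he hx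

theorem dd_phase (he : ‖e‖ = 1) (hx : x ∈ offLine x₀ e) (j : Fin n) :
    dd j (phase x₀ e) x = dd j (zeta x₀ e) x * (zeta x₀ e x)⁻¹ := by
  have hev : phase x₀ e =ᶠ[nhds x] fun x => Complex.log (zeta x₀ e x) := by
    filter_upwards [isOpen_offLine.mem_nhds hx] with y hy using phase_eq_log he hy
  have hd : DifferentiableAt ℝ (zeta x₀ e) x :=
    (contDiffOn_zeta.contDiffAt (isOpen_offLine.mem_nhds hx)).differentiableAt (by simp)
  have h := (Complex.hasDerivAt_log (zeta_mem_slitPlane hx)).hasFDerivAt.restrictScalars ℝ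
  have h2 := h.comp x hd.hasFDerivAt
  rw [dd_congr hev, dd, show (fun y => Complex.log (zeta x₀ e y)) = Complex.log ∘ zeta x₀ e from rfl,
    h2.fderiv]
  simp [dd]

theorem sum_dd_phase_sq (he : ‖e‖ = 1) (hx : x ∈ offLine x₀ e) :
    ∑ j, dd j (phase x₀ e) x ^ 2 = 0 := by
  simp only [dd_phase he hx, mul_pow]
  rw [← Finset.sum_mul, sum_dd_zeta_sq he hx, zero_mul]

/-- The other term of Δ log ζ is -(∇ζ)²/ζ², which vanishes. So ζ⁻¹ is a common factor of the whole
transport equation. -/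
theorem sum_dd_dd_phase (he : ‖e‖ = 1) (hx : x ∈ offLine x₀ e) :
    ∑ j, dd j (dd j (phase x₀ e)) x
      = (∑ j, dd j (dd j (zeta x₀ e)) x) * (zeta x₀ e x)⁻¹ := by
  have hz : ContDiffAt ℝ ∞ (zeta x₀ e) x := contDiffOn_zeta.contDiffAt (isOpen_offLine.mem_nhds hx)
  have hd : DifferentiableAt ℝ (zeta x₀ e) x := hz.differentiableAt (by simp)
  have hdd : ∀ j, DifferentiableAt ℝ (dd j (zeta x₀ e)) x := fun j =>
    (contDiffAt_dd (k := ∞) hz (by simp)).differentiableAt (by simp)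
  have hne : zeta x₀ e x ≠ 0 := Complex.slitPlane_ne_zero (zeta_mem_slitPlane hx)
  have hinv : ∀ j, dd j (fun y => (zeta x₀ e y)⁻¹) x
      = -(zeta x₀ e x ^ 2)⁻¹ * dd j (zeta x₀ e) x := fun j => by
    have h := (hasDerivAt_inv hne).hasFDerivAt.restrictScalars ℝ
    have h2 := h.comp x hd.hasFDerivAt
    rw [dd, show (fun y => (zeta x₀ e y)⁻¹) = Inv.inv ∘ zeta x₀ e from rfl, h2.fderiv]
    simp [dd, mul_comm]
  have hj : ∀ j, dd j (dd j (phase x₀ e)) x = dd j (dd j (zeta x₀ e)) x * (zeta x₀ e x)⁻¹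
      + -(zeta x₀ e x ^ 2)⁻¹ * dd j (zeta x₀ e) x ^ 2 := fun j => by
    have hev : dd j (phase x₀ e) =ᶠ[nhds x]
        fun y => dd j (zeta x₀ e) y * (zeta x₀ e y)⁻¹ := by
      filter_upwards [isOpen_offLine.mem_nhds hx] with y hy using dd_phase he hy j
    rw [dd_congr hev, dd_mul (hdd j) (hd.fun_inv hne), hinv]
    ring
  simp only [hj]
  rw [Finset.sum_add_distrib, ← Finset.mul_sum, sum_dd_zeta_sq he hx, mul_zero, add_zero,
    Finset.sum_mul]

theorem laplacian_phase (he : ‖e‖ = 1) (hx : x ∈ offLine x₀ e) :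
    Laplacian.laplacian (phase x₀ e) x = ∑ j, dd j (dd j (phase x₀ e)) x :=
  laplacian_eq_sum_dd (((contDiffOn_phase he).contDiffAt (isOpen_offLine.mem_nhds hx)).of_le
    two_le_infty)

end phase

/-! ### Solvability of the transport equation -/

/-- After multiplication by ζ the equation is (∂_e + i∂_θ)Φ = f with f of class C² off the line.
Cutting f off near the closure of Ω makes the Cauchy transform along the planes available. -/
theorem exists_solvesTransport {n : ℕ} {Ω : Set (E n)}
    (hΩc : IsCompact (closure Ω)) {A : E n → E n} (hA : C2Closure Ω A) {x₀ e : E n}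
    (he : ‖e‖ = 1) (hΩ : closure Ω ⊆ offLine x₀ e) :
    ∃ Φ : E n → ℂ, C2Closure Ω Φ ∧ SolvesTransport Ω A x₀ e Φ := by
  obtain ⟨A', hA', hAA'⟩ := hA
  have hWo : IsOpen (offLine x₀ e) := isOpen_offLine
  obtain ⟨χ, hχ1, hχ2, hχ3, V, -, hV, hχ4⟩ := exists_cutoff hΩc hWo hΩ
  set f : E n → ℂ := fun x => -(Complex.I * (∑ j, dd j (zeta x₀ e) x * (A' x j : ℂ))
    + (1 / 2 : ℂ) * ∑ j, dd j (dd j (zeta x₀ e)) x) with hf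
  have hfC : ContDiffOn ℝ 2 f (offLine x₀ e) := fun x hx => by
    have hz : ContDiffAt ℝ ∞ (zeta x₀ e) x := contDiffOn_zeta.contDiffAt (hWo.mem_nhds hx)
    have h1 : ∀ j, ContDiffAt ℝ ∞ (dd j (zeta x₀ e)) x := fun j =>
      contDiffAt_dd (k := ∞) hz (by simp)
    have h2 : ∀ j, ContDiffAt ℝ 2 (dd j (zeta x₀ e)) x := fun j =>
      (h1 j).of_le two_le_infty
    have h3 : ∀ j, ContDiffAt ℝ 2 (dd j (dd j (zeta x₀ e))) x := fun j =>
      (contDiffAt_dd (k := ∞) (h1 j) (by simp)).of_le two_le_infty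
    exact ((contDiffAt_const.mul (ContDiffAt.sum fun j _ =>
      (h2 j).mul (contDiff_comp_ofReal hA' j).contDiffAt)).add
      (contDiffAt_const.mul (ContDiffAt.sum fun j _ => h3 j))).neg.contDiffWithinAt
  set F : E n → ℂ := fun x => χ x • f x with hF
  have hFC : ContDiff ℝ 2 F := contDiff_cutoff_smul hWo (contDiff_two_of_infty hχ1) hχ3 hfC
  have hFc : HasCompactSupport F := hχ2.smul_right
  have hθ : ContDiffOn ℝ 2 (theta x₀ e) (offLine x₀ e) :=
    contDiffOn_theta.of_le two_le_infty
  have hΦ := contDiffOn_planeCauchy he hWo hθ (fun x hx => norm_theta hx)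
    (fun x _ => inner_theta he) hFC hFc
  -- The Cauchy transform is known to be C² only off the line, whereas `C2Closure` asks for a
  -- function that is C² on ℝⁿ.
  obtain ⟨Φ, hΦC, V', hV'o, hV', -, hΦV⟩ := exists_contDiff_extension (k := 2) hΩc hWo hΩ hΦ
  refine ⟨Φ, ⟨Φ, hΦC, fun x _ => rfl⟩, fun x hx => ?_⟩
  have hxc := subset_closure hx
  have hxW := hΩ hxc
  have hev : Φ =ᶠ[nhds x] planeCauchy e (theta x₀ e) F :=
    Filter.eventuallyEq_of_mem (hV'o.mem_nhds (hV' hxc)) hΦV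
  have key := planeCauchy_spec he hWo hθ (fun x hx => norm_theta hx)
    (fun x _ => inner_theta he) hFC hFc hxW (theta_add he hxW)
  rw [← sum_dd_zeta_mul he hxW, Finset.sum_congr rfl fun j _ => by rw [← dd_congr hev]] at key
  have hFx : F x = f x := by simp [hF, hχ4 x (hV hxc)]
  rw [hFx, hf] at key
  simp only at key
  rw [laplacian_phase he hxW, sum_dd_dd_phase he hxW]
  simp only [pd_eq_dd, dd_phase he hxW, hAA' hxc]
  have e1 : ∀ g : Fin n → ℂ, ∑ j, dd j (zeta x₀ e) x * (zeta x₀ e x)⁻¹ * g j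
      = (zeta x₀ e x)⁻¹ * ∑ j, dd j (zeta x₀ e) x * g j := fun g => by
    rw [Finset.mul_sum]
    exact Finset.sum_congr rfl fun j _ => by ring
  rw [e1, e1]
  linear_combination (zeta x₀ e x)⁻¹ * key

/-! ### The logarithmic weight -/

theorem exists_isLogWeight {n : ℕ} {K : Set (E n)} (hK : IsCompact K) {x₀ : E n} (hx₀ : x₀ ∉ K) :
    ∃ (U : Set (E n)) (M : ℝ) (p : E n → ℝ), IsLogWeight x₀ U M p ∧ 0 ≤ M ∧ K ⊆ U ∧
      EqOn p (phi x₀) U := by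
  have hVo : IsOpen ({x₀}ᶜ : Set (E n)) := isOpen_compl_singleton
  have hphi : ContDiffOn ℝ ((⊤ : ℕ∞) : WithTop ℕ∞) (phi x₀) {x₀}ᶜ := fun x hx => by
    have hx' : x - x₀ ≠ 0 := sub_ne_zero.2 hx
    exact (((contDiffAt_id.sub contDiffAt_const).norm ℝ hx').log
      (norm_ne_zero_iff.2 hx')).contDiffWithinAt
  obtain ⟨p, hp, V, hV, hKV, hVx, hpV⟩ := exists_contDiff_extension hK hVo
    (fun x hx h => hx₀ (h ▸ hx)) hphi
  -- Shrinking to the interior of a compact set provides the bound on p that the structure requires.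
  obtain ⟨L, hL, hKL, hLV⟩ := exists_compact_between hK hV hKV
  obtain ⟨M, hM⟩ := hL.exists_bound_of_continuousOn hp.continuous.continuousOn
  have hUV : interior L ⊆ V := interior_subset.trans hLV
  refine ⟨interior L, max M 0, p, ⟨isOpen_interior, hp, fun x hx => ?_, fun x hx j => ?_,
    fun x hx => ?_⟩, le_max_right _ _, hKL, hpV.mono hUV⟩
  · have hx' : x - x₀ ≠ 0 := sub_ne_zero.2 (hVx (hUV hx))
    rw [hpV (hUV hx), phi, mul_comm, Real.exp_mul, Real.exp_log (norm_pos_iff.2 hx')]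
    norm_cast
    rw [EuclideanSpace.real_norm_sq_eq]
    rfl
  · have hx' : x - x₀ ≠ 0 := sub_ne_zero.2 (hVx (hUV hx))
    have hn := norm_pos_iff.2 hx'
    have hev : p =ᶠ[nhds x] phi x₀ :=
      Filter.eventuallyEq_of_mem (hV.mem_nhds (hUV hx)) hpV
    have hd : DifferentiableAt ℝ (fun x => ‖x - x₀‖) x :=
      (differentiableAt_id.sub_const x₀).norm ℝ hx'
    have h1 : dd j (phi x₀) x = ‖x - x₀‖⁻¹ * dd j (fun x => ‖x - x₀‖) x := by
      have h2 := (hd.hasFDerivAt.log hn.ne').fderiv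
      rw [dd, show fderiv ℝ (phi x₀) x = _ from h2]
      simp [dd]
    have h3 := dd_norm (g := ContinuousLinearMap.id ℝ (E n)) (x := x) (x₀ := x₀) (j := j) hx'
    simp only [ContinuousLinearMap.id_apply] at h3
    have h4 : Real.exp (-2 * phi x₀ x) = (‖x - x₀‖ ^ 2)⁻¹ := by
      rw [phi, neg_mul, Real.exp_neg, mul_comm, Real.exp_mul, Real.exp_log hn]
      norm_cast
    rw [dd_congr hev, hpV (hUV hx), h1, h3, h4]
    simp [EuclideanSpace.inner_single_right]
    field_simp
  · exact (hM x (interior_subset hx)).trans (le_max_left _ _)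

end MagneticCGO

end

/-! ### The theorem: phase, amplitude and remainder combined -/

theorem lemma3p4 {n : ℕ} (hn : 3 ≤ n)
    (Ω : Set (MagneticCGO.E n)) (hΩ_open : IsOpen Ω) (hΩ_bdd : Bornology.IsBounded Ω)
    (hΩ_smooth : MagneticCGO.HasSmoothBoundary Ω)
    (A : MagneticCGO.E n → MagneticCGO.E n) (hA : MagneticCGO.C2Closure Ω A)
    (q : MagneticCGO.E n → ℂ) (hq : MemLp q ∞ (volume.restrict Ω))
    (x₀ : MagneticCGO.E n) (hx₀ : x₀ ∉ closure (convexHull ℝ Ω)) :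
    ∃ h₀ : ℝ, 0 < h₀ ∧
      ∀ e : MagneticCGO.E n, ‖e‖ = 1 →
        (∀ t : ℝ, x₀ + t • e ∉ closure Ω) →
        (∃ Φ : MagneticCGO.E n → ℂ,
          MagneticCGO.C2Closure Ω Φ ∧ MagneticCGO.SolvesTransport Ω A x₀ e Φ) ∧
        ∀ Φ : MagneticCGO.E n → ℂ,
          MagneticCGO.C2Closure Ω Φ → MagneticCGO.SolvesTransport Ω A x₀ e Φ →
          ∃ (C : ℝ) (r : ℝ → MagneticCGO.E n → ℂ), ∀ h : ℝ, 0 < h → h ≤ h₀ →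
            MagneticCGO.MemH1 Ω (r h) ∧
            MagneticCGO.normH1scl Ω h (r h) ≤ C ∧
            MagneticCGO.IsMagneticSolution Ω A q (MagneticCGO.cgo x₀ e Φ (r h) h) := by
  have hΩc : IsCompact (closure Ω) := hΩ_bdd.isCompact_closure
  have hx₀' : x₀ ∉ closure Ω := fun h => hx₀ (closure_mono (subset_convexHull ℝ Ω) h)
  obtain ⟨U, M, p, hp, hM, hU, hpU⟩ := MagneticCGO.exists_isLogWeight hΩc hx₀'
  have hA2 := hA
  obtain ⟨A', hA', hAA'⟩ := hA2
  obtain ⟨h₀, hh₀, hrem⟩ :=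
    MagneticCGO.exists_remainder hΩ_open hΩc hp hM hU hA' hAA' hq
  refine ⟨h₀, hh₀, fun e he hline => ?_⟩
  have hΩW : closure Ω ⊆ MagneticCGO.offLine x₀ e := fun x hx =>
    MagneticCGO.mem_offLine_of_forall fun t h => hline t (h ▸ hx)
  refine ⟨MagneticCGO.exists_solvesTransport hΩc hA he hΩW, fun Φ hΦ htr => ?_⟩
  obtain ⟨Φ', hΦ', hΦΦ'⟩ := hΦ
  -- Z is a C² function on ℝⁿ that agrees with the phase near the closure of Ω, so all its
  -- derivatives there are those of φ + iψ.
  obtain ⟨Z, hZ, V, hV, hΩV, -, hZV⟩ := MagneticCGO.exists_contDiff_extension (k := 2) hΩc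
    MagneticCGO.isOpen_offLine hΩW
    ((MagneticCGO.contDiffOn_phase (x₀ := x₀) he).of_le MagneticCGO.two_le_infty)
  have hZev : ∀ x ∈ Ω, Z =ᶠ[nhds x] MagneticCGO.phase x₀ e := fun x hx =>
    Filter.eventuallyEq_of_mem (hV.mem_nhds (hΩV (subset_closure hx))) hZV
  have hΦev : ∀ x ∈ Ω, Φ =ᶠ[nhds x] Φ' := fun x hx =>
    Filter.eventuallyEq_of_mem (hΩ_open.mem_nhds hx) fun y hy => hΦΦ' (subset_closure hy)
  obtain ⟨C, r, hr⟩ := hrem Z hZ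
    (fun x hx => by
      rw [(hZev x hx).eq_of_nhds, hpU (hU (subset_closure hx))]
      simp [MagneticCGO.phase])
    (fun x hx => by
      rw [← MagneticCGO.sum_dd_phase_sq he (hΩW (subset_closure hx))]
      exact Finset.sum_congr rfl fun j _ => by rw [MagneticCGO.dd_congr (hZev x hx)])
    Φ' hΦ'
    (fun x hx => by
      have h := htr x hx
      rw [MagneticCGO.laplacian_phase he (hΩW (subset_closure hx))] at h
      simp only [MagneticCGO.pd_eq_dd, MagneticCGO.dd_congr (hΦev x hx)] at h
      simp only [MagneticCGO.dd_congr (MagneticCGO.dd_congr_nhds (hZev x hx)),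
        MagneticCGO.dd_congr (hZev x hx)]
      exact h)
  refine ⟨C, r, fun h hh hhh₀ => ?_⟩
  obtain ⟨h1, h2, h3⟩ := hr h hh hhh₀
  refine ⟨h1, h2, h3 _ fun x hx => ?_⟩
  simp only [MagneticCGO.cgo, (hZev x hx).eq_of_nhds, (hΦev x hx).eq_of_nhds]
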